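/- **Setting.** Let $m\ge 1$, $d\ge 0$. Node $i\in\{1,\dots,m\}$ holds a differentiable $f_i:\mathbb R^d\to\mathbb R$ and a probability distribution $\mathcal D_i$; put $f=\frac1m\sum_i f_i$. Assume: (1) $\inf f>-\infty$; for the initial point $x^0$ put $\Delta=f(x^0)-\inf f$ and $G_0=\big(\sum_i\|\nabla f_i(x^0)\|^2\big)^{1/2}$. (2) Heterogeneous variance: node $i$ can sample $\xi_i\sim\mathcal D_i$ and evaluate a jointly measurable $g_i(x;\xi_i)$ with finite second moment, $\mathbb E\,g_i(x;\xi_i)=\nabla f_i(x)$ and $\mathbb E\|g_i(x;\xi_i)-\nabla f_i(x)\|^2\le\sigma_i^2$ for all $x$, where $\sigma_i>0$; put $\bar\sigma_{\rm AM}=\frac1m\sum_i\sigma_i$. (3) Mixing matrix: $W\in\mathbb R^{m\times m}$ is symmetric and entrywise nonnegative, $W_{ij}\neq0$ iff $i=j$ or $i,j$ are adjacent in the network, $0\preceq W\preceq I$, $W\mathbf 1=\mathbf 1$, $\ker(I-W)=\operatorname{span}(\mathbf 1)$; put $\chi=1-\lambda_2(W)$, where $\lambda_2(W)$ is the second largest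 eigenvalue ($\lambda_2:=0$ if $m=1$). (4) Mean-squared smoothness with constant $\bar L>0$: $\frac1m\sum_i\mathbb E\|g_i(x;\xi_i)-g_i(y;\xi_i)\|^2\le\bar L^2\|x-y\|^2$ for all $x,y$. $\mathtt{FastMix}(\{\phi_i\},W,R)$ returns $z^R_i$, where $z_i^0=z_i^{-1}=\phi_i$, $z_i^{r+1}=(1+\theta)\sum_jW_{ij}z_j^r-\theta z_i^{r-1}$ and $\theta=\frac{1-\sqrt{1-\lambda_2(W)^2}}{1+\sqrt{1-\lambda_2(W)^2}}$. **Algorithm D-NSS-VR** (step size $\eta$, rounds $R_t$, batch sizes $B_i,b$, probabilities $p,q$). Set $x_i^0=x^0$. At $t=0$ node $i$ sets $y_i^0=\frac1{B_i}\sum_{j\le B_i}g_i(x_i^0;\xi_{ij})$ and $s^0=\mathtt{FastMix}(y^0,W,R_0)$, $x^1=\mathtt{FastMix}(x^0-\eta s^0,W,R_0)$. At $t=1,\dots,T-1$ draw $\zeta_t\sim\mathrm{Bernoulli}(p)$ (common to all nodes). If $\zeta_t=1$, then $y_i^t=\frac1{B_i}\sum_{j\le B_i}g_i(x_i^t;\xi_{ij})$;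 otherwise node $i$ draws $\omega_i^t\sim\mathrm{Bernoulli}(q)$ and sets $y_i^t=y_i^{t-1}+\frac{\omega_i^t}{bq}\sum_{j\le b}\big(g_i(x_i^t;\xi_{ij})-g_i(x_i^{t-1};\xi_{ij})\big)$ (no samples are drawn if $\omega_i^t=0$). Then $s^t=\mathtt{FastMix}(s^{t-1}+y^t-y^{t-1},W,R_t)$ and $x^{t+1}=\mathtt{FastMix}(x^t-\eta s^t,W,R_t)$. All draws are fresh and independent. Node $i$ outputs $x_{i,\rm out}$, uniform on $\{x_i^0,\dots,x_i^T\}$, the index being independent of the run. **Theorem.** There are absolute constants $\kappa,C>0$ such that, under (1)–(4) and for every $\varepsilon>0$, the algorithm with $$\eta=\tfrac1{48\bar L},\quad B_i=\max\Big\{\Big\lceil\tfrac{32\sigma_i\sum_j\sigma_j}{m^2\varepsilon^2}\Big\rceil,1\Big\},\quad b=\Big\lceil\tfrac{\sqrt{\sum_iB_i}}m\Big\rceil,\quad q=\tfrac{\sqrt{\sum_iB_i}}{bm},\quad p=\tfrac{bq}{bq+\sum_iB_i/m},$$ $$T=\Big\lceil\tfrac{384\Delta\bar L}{\varepsilon^2}+\tfrac2p\Big\rceil,\quad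 R_0=\Big\lceil\tfrac{\kappa}{\sqrt\chi}\log\Big(m+\tfrac{G_0}\varepsilon\Big)\Big\rceil,\quad R_t=\Big\lceil\tfrac{\kappa}{\sqrt\chi}\log m\Big\rceil\ (t\ge1)$$ (so that $R_0=O(\frac1{\sqrt\chi}\log\frac m\varepsilon)$ as $\varepsilon\to0$ for a given problem) satisfies: * $\mathbb E\|\nabla f(x_{i,\rm out})\|^2\le\varepsilon^2$ for every node $i$; * the expected total number of stochastic gradient evaluations in iterations $0,\dots,T-1$ is at most $C\Big(\frac{\Delta\bar L\bar\sigma_{\rm AM}}{\varepsilon^3}+\frac{\bar\sigma_{\rm AM}^2}{\varepsilon^2}+\sqrt m\,\frac{\Delta\bar L}{\varepsilon^2}+m\Big)$; * the total number of communication rounds $\sum_{t<T}2R_t$ is at most $C\Big(\frac{\Delta\bar L}{\sqrt\chi\varepsilon^2}+\frac{\bar\sigma_{\rm AM}}{\sqrt\chi\varepsilon}+\frac{\sqrt m}{\sqrt\chi}\Big)\Big(1+\log\big(m+\tfrac{G_0}\varepsilon\big)\Big)$, and, whenever $\sqrt m\,\varepsilon\le\bar\sigma_{\rm AM}$, at most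 $C\Big(\frac{\Delta\bar L}{\sqrt\chi\varepsilon^2}+\frac{\bar\sigma_{\rm AM}}{\sqrt\chi\varepsilon}\Big)\Big(1+\log\big(m+\tfrac{G_0}\varepsilon\big)\Big)$. -/

import Mathlib

open MeasureTheory ProbabilityTheory

noncomputable section

namespace DNSSVR

/-! ### The problem and its assumptions -/

/-- The global objective `f = (1/m) ∑ i, f i`. -/
def avgFun {m d : ℕ} (f : Fin m → EuclideanSpace ℝ (Fin d) → ℝ) :
    EuclideanSpace ℝ (Fin d) → ℝ :=
  fun x => (1 / (m : ℝ)) * ∑ i, f i x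

/-- The initial gap `Δ = f x⁰ - inf f`. -/
def initialGap {m d : ℕ} (f : Fin m → EuclideanSpace ℝ (Fin d) → ℝ)
    (x0 : EuclideanSpace ℝ (Fin d)) : ℝ :=
  avgFun f x0 - ⨅ x, avgFun f x

/-- Arithmetic mean of the local standard deviations. -/
def sigmaAM {m : ℕ} (σ : Fin m → ℝ) : ℝ := (1 / (m : ℝ)) * ∑ i, σ i

/-- `(∑ i, ‖∇ f i x⁰‖²)^(1/2)`, the size of the local gradients at the initial point. -/
def initialGradSize {m d : ℕ} (f : Fin m → EuclideanSpace ℝ (Fin d) → ℝ)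
    (x0 : EuclideanSpace ℝ (Fin d)) : ℝ :=
  Real.sqrt (∑ i, ‖gradient (f i) x0‖ ^ 2)

/-- Node `i` draws `ξ ∼ D i` and receives `g i x ξ`: jointly measurable, unbiased for `∇ f i x`,
square integrable, with variance at most `(σ i)²`, where `σ i > 0`. -/
structure HeterogeneousVariance {m d : ℕ} {Ξ : Fin m → Type*} [∀ i, MeasurableSpace (Ξ i)]
    (D : ∀ i, Measure (Ξ i)) (f : Fin m → EuclideanSpace ℝ (Fin d) → ℝ)
    (g : ∀ i, EuclideanSpace ℝ (Fin d) → Ξ i → EuclideanSpace ℝ (Fin d))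
    (σ : Fin m → ℝ) : Prop where
  sigma_pos : ∀ i, 0 < σ i
  measurable : ∀ i, Measurable (fun z : EuclideanSpace ℝ (Fin d) × Ξ i => g i z.1 z.2)
  memLp : ∀ i x, MemLp (g i x) 2 (D i)
  unbiased : ∀ i x, ∫ ξ, g i x ξ ∂(D i) = gradient (f i) x
  variance_le : ∀ i x, ∫ ξ, ‖g i x ξ - gradient (f i) x‖ ^ 2 ∂(D i) ≤ σ i ^ 2

/-- Mean-squared smoothness, on average over the nodes, with constant `L > 0`. -/
structure MeanSquaredSmooth {m d : ℕ} {Ξ : Fin m → Type*} [∀ i, MeasurableSpace (Ξ i)]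
    (D : ∀ i, Measure (Ξ i))
    (g : ∀ i, EuclideanSpace ℝ (Fin d) → Ξ i → EuclideanSpace ℝ (Fin d)) (L : ℝ) : Prop where
  const_pos : 0 < L
  smooth : ∀ x y : EuclideanSpace ℝ (Fin d),
    (1 / (m : ℝ)) * ∑ i, ∫ ξ, ‖g i x ξ - g i y ξ‖ ^ 2 ∂(D i) ≤ L ^ 2 * ‖x - y‖ ^ 2

/-- `W` is an admissible communication (mixing) matrix for the network `G`. -/
structure AdmissibleMixing {m : ℕ} (G : SimpleGraph (Fin m)) (W : Matrix (Fin m) (Fin m) ℝ) :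
    Prop where
  symm : W.IsSymm
  nonneg : ∀ i j, 0 ≤ W i j
  support : ∀ i j, W i j ≠ 0 ↔ (G.Adj i j ∨ i = j)
  psd : W.PosSemidef
  le_one : (1 - W).PosSemidef
  mulVec_one : W.mulVec (fun _ => 1) = fun _ => 1
  ker_eq : LinearMap.ker (Matrix.toLin' (1 - W)) = Submodule.span ℝ {(fun _ => 1 : Fin m → ℝ)}

/-- The second largest eigenvalue of a symmetric matrix, counted with multiplicity
(`eigenvalues₀` is listed in decreasing order from index `0`). Convention: `0` for a
single node, where there is no second eigenvalue. -/
def lambda2 {m : ℕ} (W : Matrix (Fin m) (Fin m) ℝ) : ℝ :=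
  if h : W.IsHermitian ∧ 1 < m then
    h.1.eigenvalues₀ ⟨1, lt_of_lt_of_eq h.2 (Fintype.card_fin m).symm⟩
  else 0

/-- The spectral gap `χ = 1 - λ₂(W)`. -/
def spectralGap {m : ℕ} (W : Matrix (Fin m) (Fin m) ℝ) : ℝ := 1 - lambda2 W

/-! ### FastMix -/

/-- The momentum parameter of FastMix. -/
def mixMomentum {m : ℕ} (W : Matrix (Fin m) (Fin m) ℝ) : ℝ :=
  (1 - Real.sqrt (1 - lambda2 W ^ 2)) / (1 + Real.sqrt (1 - lambda2 W ^ 2))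

/-- The pair `(z^r, z^(r-1))` of FastMix iterates, started at `z^0 = z^(-1) = φ`. -/
def fastMixPair {m d : ℕ} (W : Matrix (Fin m) (Fin m) ℝ)
    (φ : Fin m → EuclideanSpace ℝ (Fin d)) :
    ℕ → (Fin m → EuclideanSpace ℝ (Fin d)) × (Fin m → EuclideanSpace ℝ (Fin d))
  | 0 => (φ, φ)
  | r + 1 =>
    (fun i => (1 + mixMomentum W) • ∑ j, W i j • (fastMixPair W φ r).1 j
        - mixMomentum W • (fastMixPair W φ r).2 i,
      (fastMixPair W φ r).1)

/-- `FastMix(φ, W, R)`. -/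
def fastMix {m d : ℕ} (W : Matrix (Fin m) (Fin m) ℝ) (R : ℕ)
    (φ : Fin m → EuclideanSpace ℝ (Fin d)) : Fin m → EuclideanSpace ℝ (Fin d) :=
  (fastMixPair W φ R).1

/-! ### The algorithm D-NSS-VR -/

/-- The random draws available to one iteration: the common coin `ζ`, the local coins `ω i`, the
large batches (node `i` has `B i` samples) and the mini-batches (`b` samples per node). The
iteration uses, and pays for, only those batches that its coins select. -/
abbrev Draw {m : ℕ} (Ξ : Fin m → Type*) (B : Fin m → ℕ) (b : ℕ) :=
  Bool × (Fin m → Bool) × (∀ i, Fin (B i) → Ξ i) × (∀ i, Fin b → Ξ i)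

/-- The law of one round of draws: everything independent, `ζ ∼ Bernoulli(p)`,
`ω i ∼ Bernoulli(q)`, and all samples of node `i` distributed according to `D i`. -/
def drawLaw {m : ℕ} {Ξ : Fin m → Type*} [∀ i, MeasurableSpace (Ξ i)]
    (D : ∀ i, Measure (Ξ i)) (B : Fin m → ℕ) (b : ℕ) (p q : unitInterval) :
    Measure (Draw Ξ B b) :=
  (bernoulliMeasure true false p).prod
    ((Measure.pi fun _ : Fin m => bernoulliMeasure true false q).prod
      ((Measure.pi fun i => Measure.pi fun _ : Fin (B i) => D i).prod
        (Measure.pi fun i => Measure.pi fun _ : Fin b => D i)))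

/-- The variables after iteration `t`: `xPrev = x^t`, `x = x^(t+1)`, `y = y^t`, `s = s^t`
(one row per node). -/
structure State (m d : ℕ) where
  xPrev : Fin m → EuclideanSpace ℝ (Fin d)
  x : Fin m → EuclideanSpace ℝ (Fin d)
  y : Fin m → EuclideanSpace ℝ (Fin d)
  s : Fin m → EuclideanSpace ℝ (Fin d)

section Algorithm

variable {m d : ℕ} {Ξ : Fin m → Type*} {B : Fin m → ℕ} {b : ℕ}

/-- The large-batch stochastic gradient of node `i` at `x`. -/
def largeBatchGrad (g : ∀ i, EuclideanSpace ℝ (Fin d) → Ξ i → EuclideanSpace ℝ (Fin d))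
    (r : Draw Ξ B b) (i : Fin m) (x : EuclideanSpace ℝ (Fin d)) : EuclideanSpace ℝ (Fin d) :=
  (1 / (B i : ℝ)) • ∑ j, g i x (r.2.2.1 i j)

/-- Iteration `0`, with step size `η`, `R` rounds of FastMix and draws `r`. -/
def initState (g : ∀ i, EuclideanSpace ℝ (Fin d) → Ξ i → EuclideanSpace ℝ (Fin d))
    (W : Matrix (Fin m) (Fin m) ℝ) (η : ℝ) (x0 : EuclideanSpace ℝ (Fin d)) (R : ℕ)
    (r : Draw Ξ B b) : State m d :=
  let y : Fin m → EuclideanSpace ℝ (Fin d) := fun i => largeBatchGrad g r i x0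
  let s := fastMix W R y
  { xPrev := fun _ => x0
    x := fastMix W R (fun i => x0 - η • s i)
    y := y
    s := s }

/-- One iteration `t ≥ 1`, with `R` rounds of FastMix and draws `r`. -/
def step (g : ∀ i, EuclideanSpace ℝ (Fin d) → Ξ i → EuclideanSpace ℝ (Fin d))
    (W : Matrix (Fin m) (Fin m) ℝ) (η q : ℝ) (R : ℕ) (r : Draw Ξ B b) (S : State m d) :
    State m d :=
  let y : Fin m → EuclideanSpace ℝ (Fin d) := fun i =>
    if r.1 then largeBatchGrad g r i (S.x i)
    else if r.2.1 i then
      S.y i + (1 / ((b : ℝ) * q)) •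
        ∑ j, (g i (S.x i) (r.2.2.2 i j) - g i (S.xPrev i) (r.2.2.2 i j))
    else S.y i
  let s := fastMix W R (fun i => S.s i + y i - S.y i)
  { xPrev := S.x
    x := fastMix W R (fun i => S.x i - η • s i)
    y := y
    s := s }

/-- The state after iteration `t`; `R t` is the number of rounds of each FastMix call in
iteration `t`, and `r t` are the draws of iteration `t`. -/
def stateAfter (g : ∀ i, EuclideanSpace ℝ (Fin d) → Ξ i → EuclideanSpace ℝ (Fin d))
    (W : Matrix (Fin m) (Fin m) ℝ) (η q : ℝ) (x0 : EuclideanSpace ℝ (Fin d)) (R : ℕ → ℕ)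
    (r : ℕ → Draw Ξ B b) : ℕ → State m d
  | 0 => initState g W η x0 (R 0) (r 0)
  | t + 1 => step g W η q (R (t + 1)) (r (t + 1)) (stateAfter g W η q x0 R r t)

/-- The iterate `x_i^t` of node `i`. -/
def iterate (g : ∀ i, EuclideanSpace ℝ (Fin d) → Ξ i → EuclideanSpace ℝ (Fin d))
    (W : Matrix (Fin m) (Fin m) ℝ) (η q : ℝ) (x0 : EuclideanSpace ℝ (Fin d)) (R : ℕ → ℕ)
    (r : ℕ → Draw Ξ B b) (t : ℕ) (i : Fin m) : EuclideanSpace ℝ (Fin d) :=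
  match t with
  | 0 => x0
  | t + 1 => (stateAfter g W η q x0 R r t).x i

/-- The number of stochastic gradient evaluations, over all nodes, in iteration `t`. A mini-batch
step evaluates the stochastic gradient at two points for each of its `b` samples. -/
def gradEvals (r : ℕ → Draw Ξ B b) (t : ℕ) : ℕ :=
  if t = 0 ∨ (r t).1 then ∑ i, B i else ∑ i, if (r t).2.1 i then 2 * b else 0

/-- The number of stochastic gradient evaluations in iterations `0, …, T - 1`. -/
def sampleCount (r : ℕ → Draw Ξ B b) (T : ℕ) : ℕ := ∑ t ∈ Finset.range T, gradEvals r t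

/-- The number of communication rounds in iterations `0, …, T - 1`; each iteration calls
FastMix twice. -/
def commCount (R : ℕ → ℕ) (T : ℕ) : ℕ := ∑ t ∈ Finset.range T, 2 * R t

end Algorithm

/-- The randomness of one run on a probability space `(Ω, P)`: the draws `r t` of the iterations
are independent with law `drawLaw`, and the output index `τ` is uniform on `{0, …, T}` and
independent of all the draws. -/
structure IsRun {m : ℕ} {Ξ : Fin m → Type*} [∀ i, MeasurableSpace (Ξ i)]
    (D : ∀ i, Measure (Ξ i)) (B : Fin m → ℕ) (b : ℕ) (p q : unitInterval) (T : ℕ)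
    {Ω : Type*} [MeasurableSpace Ω] (P : Measure Ω)
    (r : ℕ → Ω → Draw Ξ B b) (τ : Ω → Fin (T + 1)) : Prop where
  measurable_draw : ∀ t, Measurable (r t)
  draw_law : ∀ t, P.map (r t) = drawLaw D B b p q
  draw_indep : iIndepFun r P
  measurable_out : Measurable τ
  out_law : P.map τ = (PMF.uniformOfFintype (Fin (T + 1))).toMeasure
  out_indep : IndepFun τ (fun w t => r t w) P

/-! ### The parameter choices -/

/-- The node-specific large batch sizes. -/
def largeBatch {m : ℕ} (σ : Fin m → ℝ) (ε : ℝ) (i : Fin m) : ℕ :=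
  max ⌈32 * σ i * (∑ j, σ j) / ((m : ℝ) ^ 2 * ε ^ 2)⌉₊ 1

/-- `√(∑ i, B i)`. -/
def sqrtTotal {m : ℕ} (B : Fin m → ℕ) : ℝ := Real.sqrt (∑ i, (B i : ℝ))

/-- The mini-batch size `b`. -/
def miniBatch {m : ℕ} (B : Fin m → ℕ) : ℕ := ⌈sqrtTotal B / (m : ℝ)⌉₊

theorem skipProb_mem {m : ℕ} (B : Fin m → ℕ) :
    sqrtTotal B / ((miniBatch B : ℝ) * (m : ℝ)) ∈ unitInterval := by
  have h0 : 0 ≤ sqrtTotal B := Real.sqrt_nonneg _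
  refine ⟨by positivity, ?_⟩
  rw [mul_comm, ← div_div]
  exact div_le_one_of_le₀ (Nat.le_ceil _) (Nat.cast_nonneg _)

/-- The local probability `q` of a mini-batch update. -/
def skipProb {m : ℕ} (B : Fin m → ℕ) : unitInterval :=
  ⟨sqrtTotal B / ((miniBatch B : ℝ) * (m : ℝ)), skipProb_mem B⟩

theorem resetProb_mem {m : ℕ} (B : Fin m → ℕ) :
    (miniBatch B : ℝ) * (skipProb B : ℝ) /
      ((miniBatch B : ℝ) * (skipProb B : ℝ) + (∑ i, (B i : ℝ)) / (m : ℝ)) ∈ unitInterval := by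
  have h0 : 0 ≤ (skipProb B : ℝ) := (skipProb B).2.1
  have h1 : 0 ≤ (∑ i, (B i : ℝ)) / (m : ℝ) := by positivity
  have h2 : 0 ≤ (miniBatch B : ℝ) * (skipProb B : ℝ) := by positivity
  exact ⟨by positivity, div_le_one_of_le₀ (by linarith) (by positivity)⟩

/-- The probability `p` of a large-batch update. -/
def resetProb {m : ℕ} (B : Fin m → ℕ) : unitInterval :=
  ⟨(miniBatch B : ℝ) * (skipProb B : ℝ) /
    ((miniBatch B : ℝ) * (skipProb B : ℝ) + (∑ i, (B i : ℝ)) / (m : ℝ)), resetProb_mem B⟩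

/-- The number of iterations `T`. -/
def horizon (Δ L ε : ℝ) (p : unitInterval) : ℕ := ⌈384 * Δ * L / ε ^ 2 + 2 / (p : ℝ)⌉₊

/-- The FastMix rounds: `⌈(κ/√χ) log(m + G₀/ε)⌉` at iteration `0` and `⌈(κ/√χ) log m⌉` later. -/
def mixRounds (κ χ : ℝ) (m : ℕ) (G₀ ε : ℝ) (t : ℕ) : ℕ :=
  if t = 0 then ⌈κ / Real.sqrt χ * Real.log ((m : ℝ) + G₀ / ε)⌉₊
  else ⌈κ / Real.sqrt χ * Real.log (m : ℝ)⌉₊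

end DNSSVR

end

namespace DNSSVR

/-! ### Contraction of FastMix -/

/-! FastMix preserves averages and gradient tracking keeps the average of `s` equal to that of `y`,
so the averaged iterate moves by exactly `-η • avg y`: inexact gradient descent on the average
objective. The descent lemma, summed in `ValidRun.sum_norm_gradient_sq_le`, bounds the squared
gradients at the averages by the initial gap, the error of `avg y` and the consensus error of the
iterates, minus almost the sum of `‖avg y‖²`. This negative term is what pays for the variance,
which grows with the movement of the iterates.

Variance. Write N = √(∑ B i). The parameters are balanced so that bq = N/m and p = 1/(1+N), hence
(1-p)/(bq) = pm. Each mini-batch step adds variance proportional to the movement and each reset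
forgets the past, so the error u obeys u(t+1) ≤ pc + (1-p)u(t) + p·3m²L²·movement. Summing and
dividing by p loses no factor N, and T ≥ 2/p absorbs the initial error (`sum_variance_le`). Two
functionals of the node errors need this recursion: the squared norm of their sum, which after
division by m² is the error in the descent inequality, and the sum of their squared norms, which
drives the disagreement of the trackers. Independence across nodes gives both the same constants;
`lintegral_sum_error_step_le` handles them together through an arbitrary set of nodes.

Consensus. In an eigenbasis of W, FastMix is a scalar two-term recursion solved by Chebyshev
polynomials, so the deviation contracts at rate √χ (`deviation_fastMix_le`). A number of rounds of
order log m / √χ makes the contraction factor at most 1/(1000m²), enough to beat the powers of m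
that appear because averaged smoothness controls a single node only up to a factor m. At iteration 0
the local gradients may disagree by G₀, which calls for log(m + G₀/ε) instead.

Closing the loop. The recursions for consensus errors, variances and descent are summed over time
and become a linear system with small couplings, solved in `gradient_le_of_sums`. A uniform
independent output index turns the sum into an expectation.

Costs. A reset costs N² evaluations with probability about 1/N and a mini-batch step costs 2N on
average, so an iteration costs O(N); moreover T = O(ΔL/ε² + N) and N ≤ 6σ/ε + √m, where σ is the
mean deviation. The complexity bounds are products of these quantities. -/

/-- Chebyshev polynomials of the third kind, evaluated at `c`. -/
noncomputable def chebyshevV (c : ℝ) : ℕ → ℝ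
  | 0 => 1
  | 1 => 2 * c - 1
  | n + 2 => 2 * c * chebyshevV c (n + 1) - chebyshevV c n

/-- A quadratic form conserved by the three-term recursion. It replaces the formula V_n(cos φ) =
cos((n+1/2)φ)/cos(φ/2) and avoids angles. -/
theorem chebyshevV_invariant (c : ℝ) (n : ℕ) :
    chebyshevV c (n + 1) ^ 2 - 2 * c * chebyshevV c (n + 1) * chebyshevV c n
      + chebyshevV c n ^ 2 = 2 - 2 * c := by
  induction n with
  | zero => simp only [chebyshevV]; ring
  | succ n ih => rw [← ih]; simp only [chebyshevV]; ring

/-- Completing the square in the invariant gives V²(1-c²) ≤ 2(1-c), and cancelling 1-c leaves V² ≤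
2/(1+c) ≤ 2. At c = 1 nothing can be cancelled, but there the sequence is constant. -/
theorem abs_chebyshevV_le {c : ℝ} (h0 : 0 ≤ c) (h1 : c ≤ 1) (n : ℕ) :
    |chebyshevV c n| ≤ Real.sqrt 2 := by
  rcases h1.eq_or_lt with rfl | h1
  · have h : ∀ n, chebyshevV 1 n = 1 ∧ chebyshevV 1 (n + 1) = 1 := by
      intro n
      induction n with
      | zero => simp only [chebyshevV]; norm_num
      | succ n ih => exact ⟨ih.2, by simp only [chebyshevV, ih.1, ih.2]; norm_num⟩
    rw [(h n).1, abs_one]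
    exact Real.one_le_sqrt.2 (by norm_num)
  · refine Real.abs_le_sqrt ?_
    have h := chebyshevV_invariant c n
    have h2 : chebyshevV c n ^ 2 * (1 - c ^ 2) ≤ 2 * (1 - c) := by
      nlinarith [sq_nonneg (chebyshevV c (n + 1) - c * chebyshevV c n)]
    have h3 : chebyshevV c n ^ 2 * (1 + c) ≤ 2 := by
      by_contra! h4
      nlinarith [mul_lt_mul_of_pos_right h4 (sub_pos.2 h1)]
    nlinarith [sq_nonneg (chebyshevV c n)]

/-- The partial sums are the Chebyshev polynomials of the second kind and obey the same recursion,
so the closed form in `norm_le_of_heavyBall` can be checked by two-step induction. -/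
theorem sum_chebyshevV_succ_succ (c : ℝ) (n : ℕ) :
    ∑ k ∈ Finset.range (n + 2), chebyshevV c k
      = 2 * c * ∑ k ∈ Finset.range (n + 1), chebyshevV c k
        - ∑ k ∈ Finset.range n, chebyshevV c k := by
  induction n with
  | zero => simp [Finset.sum_range_succ, chebyshevV]
  | succ n ih =>
    have h1 := Finset.sum_range_succ (chebyshevV c) (n + 2)
    have h2 := Finset.sum_range_succ (chebyshevV c) (n + 1)
    have h3 := Finset.sum_range_succ (chebyshevV c) n
    have h4 : chebyshevV c (n + 2) = 2 * c * chebyshevV c (n + 1) - chebyshevV c n := rfl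
    linear_combination h1 + ih + h4 - 2 * c * h2 + h3

/-- A linear recursion with characteristic polynomial `z² - 2 c t z + t²`, where `c ∈ [0, 1]`, decays
at rate `t` up to a polynomial factor that does not deteriorate as `t → 1`. -/
theorem norm_le_of_heavyBall {F : Type*} [NormedAddCommGroup F] [NormedSpace ℝ F] {c t : ℝ}
    (hc0 : 0 ≤ c) (hc1 : c ≤ 1) (ht0 : 0 ≤ t) (ht1 : t ≤ 1) (z : ℕ → F)
    (h1 : z 1 = (2 * c * t - t ^ 2) • z 0)
    (h2 : ∀ r, z (r + 2) = (2 * c * t) • z (r + 1) - t ^ 2 • z r) (r : ℕ) :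
    ‖z r‖ ≤ 3 * Real.exp (-(1 - t) * r / 2) * ‖z 0‖ := by
  -- Dividing by `t ^ r` gives the Chebyshev recursion, and the prescribed `z 1` selects this
  -- combination. The sum may grow linearly in `r`, but it carries the weight `1 - t`, so nothing
  -- degenerates as `t → 1`.
  have key : ∀ r, z r = (t ^ r * ((1 - t) * ∑ k ∈ Finset.range r, chebyshevV c k
      + chebyshevV c r)) • z 0 := by
    intro r
    induction r using Nat.twoStepInduction with
    | zero => simp [chebyshevV]
    | one => rw [h1]; congr 1; simp [chebyshevV]; ring
    | more r ih1 ih2 =>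
      rw [h2, ih2, ih1]
      rw [smul_smul, smul_smul, ← sub_smul]
      congr 1
      rw [sum_chebyshevV_succ_succ]
      simp only [chebyshevV]
      ring
  have hs2 : Real.sqrt 2 ≤ 3 / 2 := by
    rw [Real.sqrt_le_left (by norm_num)]; norm_num
  have hsum : |∑ k ∈ Finset.range r, chebyshevV c k| ≤ 3 / 2 * r := by
    refine (Finset.abs_sum_le_sum_abs _ _).trans ?_
    refine (Finset.sum_le_sum fun k _ => (abs_chebyshevV_le hc0 hc1 k).trans hs2).trans ?_
    simp [mul_comm]
  have habs : |(1 - t) * ∑ k ∈ Finset.range r, chebyshevV c k + chebyshevV c r|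
      ≤ 3 / 2 * ((1 - t) * r + 1) := by
    refine (abs_add_le _ _).trans ?_
    rw [abs_mul, abs_of_nonneg (sub_nonneg.2 ht1)]
    have := mul_le_mul_of_nonneg_left hsum (sub_nonneg.2 ht1)
    have := (abs_chebyshevV_le hc0 hc1 r).trans hs2
    linarith
  have htr : t ^ r ≤ Real.exp (-(1 - t) * r / 2) * Real.exp (-(1 - t) * r / 2) := by
    rw [← Real.exp_add]
    calc t ^ r ≤ Real.exp (-(1 - t)) ^ r := by
          refine pow_le_pow_left₀ ht0 ?_ r
          have := Real.add_one_le_exp (-(1 - t)); linarith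
      _ = Real.exp (-(1 - t) * r / 2 + -(1 - t) * r / 2) := by
          rw [← Real.exp_nat_mul]; congr 1; ring
  -- Half of the exponential decay is spent on the linear factor, since e^(-x/2)(1+x) ≤ 2.
  have hpoly : Real.exp (-(1 - t) * r / 2) * ((1 - t) * r + 1) ≤ 2 := by
    have h := Real.add_one_le_exp ((1 - t) * r / 2)
    calc Real.exp (-(1 - t) * r / 2) * ((1 - t) * r + 1)
        ≤ Real.exp (-(1 - t) * r / 2) * (2 * Real.exp ((1 - t) * r / 2)) := by
          refine mul_le_mul_of_nonneg_left ?_ (Real.exp_pos _).le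
          linarith
      _ = 2 * (Real.exp (-(1 - t) * r / 2) * Real.exp ((1 - t) * r / 2)) := by ring
      _ = 2 := by
          rw [← Real.exp_add]
          have : -(1 - t) * r / 2 + (1 - t) * r / 2 = 0 := by ring
          rw [this, Real.exp_zero, mul_one]
  rw [key r, norm_smul, Real.norm_eq_abs, abs_mul, abs_of_nonneg (pow_nonneg ht0 r)]
  refine mul_le_mul_of_nonneg_right ?_ (norm_nonneg _)
  have hnn : 0 ≤ (1 - t) * (r : ℝ) + 1 := by
    have := mul_nonneg (sub_nonneg.2 ht1) (Nat.cast_nonneg (α := ℝ) r); linarith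
  set e := Real.exp (-(1 - t) * r / 2) with he
  have hepos : 0 < e := Real.exp_pos _
  calc t ^ r * |(1 - t) * ∑ k ∈ Finset.range r, chebyshevV c k + chebyshevV c r|
      ≤ (e * e) * (3 / 2 * ((1 - t) * r + 1)) := by gcongr
    _ = 3 / 2 * e * (e * ((1 - t) * r + 1)) := by ring
    _ ≤ 3 / 2 * e * 2 := by gcongr
    _ = 3 * e := by ring

/-- The rate in `norm_le_of_heavyBall` for the momentum used by FastMix. -/
theorem norm_le_of_fastMix_recursion {F : Type*} [NormedAddCommGroup F] [NormedSpace ℝ F]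
    {l l2 θ : ℝ} (hl0 : 0 ≤ l) (hl : l ≤ l2) (hl2 : l2 < 1)
    (hθ : θ = (1 - Real.sqrt (1 - l2 ^ 2)) / (1 + Real.sqrt (1 - l2 ^ 2))) (z : ℕ → F)
    (h1 : z 1 = ((1 + θ) * l - θ) • z 0)
    (h2 : ∀ r, z (r + 2) = ((1 + θ) * l) • z (r + 1) - θ • z r) (r : ℕ) :
    ‖z r‖ ≤ 3 * Real.exp (-Real.sqrt (1 - l2) * r / 4) * ‖z 0‖ := by
  set s := Real.sqrt (1 - l2 ^ 2) with hs
  have hl2' : 0 ≤ l2 := hl0.trans hl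
  have hs0 : 0 ≤ s := Real.sqrt_nonneg _
  have hs2 : s ^ 2 = 1 - l2 ^ 2 := Real.sq_sqrt (by nlinarith)
  have hs1 : s ≤ 1 := by nlinarith
  have hsχ : Real.sqrt (1 - l2) ≤ s := Real.sqrt_le_sqrt (by nlinarith)
  have h1s : 0 < 1 + s := by linarith
  -- `t` is the square root of the momentum. The acceleration comes from `1 - t ≥ s / 2 ≥ √(1 - l2)
  -- / 2`.
  set t := l2 / (1 + s) with ht
  have ht0 : 0 ≤ t := by positivity
  have htt : θ = t ^ 2 := by
    rw [hθ, ht, div_pow, div_eq_div_iff h1s.ne' (by positivity)]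
    have : l2 ^ 2 = (1 - s) * (1 + s) := by linarith
    rw [this]; ring
  have ht1 : s / 2 ≤ 1 - t := by
    rw [ht, le_sub_iff_add_le, ← le_sub_iff_add_le', div_le_iff₀ h1s]
    nlinarith
  -- Since `1 + θ = 2 / (1 + s)`, the right choice is `c = l / l2`. If `l2 = 0` then `l = t = 0` and
  -- any `c` works.
  obtain ⟨c, hc0, hc1, hc⟩ : ∃ c : ℝ, 0 ≤ c ∧ c ≤ 1 ∧ (1 + θ) * l = 2 * c * t := by
    rcases hl2'.eq_or_lt with h | h
    · have : l = 0 := le_antisymm (by linarith) hl0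
      exact ⟨0, le_rfl, zero_le_one, by simp [this]⟩
    · refine ⟨l / l2, by positivity, div_le_one_of_le₀ hl hl2', ?_⟩
      rw [hθ, ht]; field_simp; ring
  have := norm_le_of_heavyBall hc0 hc1 ht0 (by linarith) z (by rw [h1, hc, htt])
    (fun r => by rw [h2, hc, htt]) r
  refine this.trans (mul_le_mul_of_nonneg_right (mul_le_mul_of_nonneg_left
    (Real.exp_le_exp.2 ?_) (by norm_num)) (norm_nonneg _))
  have : (0 : ℝ) ≤ r := Nat.cast_nonneg r
  nlinarith

/-! ### Spectrum of the mixing matrix -/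

section Spectrum

variable {m : ℕ} {G : SimpleGraph (Fin m)} {W : Matrix (Fin m) (Fin m) ℝ}

theorem AdmissibleMixing.isHermitian (hW : AdmissibleMixing G W) : W.IsHermitian := hW.psd.1

theorem AdmissibleMixing.mem_span_of_mulVec_eq (hW : AdmissibleMixing G W) {v : Fin m → ℝ}
    (hv : W.mulVec v = v) : ∃ a : ℝ, v = fun _ => a := by
  have : v ∈ LinearMap.ker (Matrix.toLin' (1 - W)) := by
    rw [LinearMap.mem_ker, Matrix.toLin'_apply, Matrix.sub_mulVec, Matrix.one_mulVec, hv, sub_self]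
  rw [hW.ker_eq, Submodule.mem_span_singleton] at this
  obtain ⟨a, rfl⟩ := this
  exact ⟨a, by ext; simp⟩

theorem AdmissibleMixing.eigenvalues_le_one (hW : AdmissibleMixing G W) (l : Fin m) :
    hW.isHermitian.eigenvalues l ≤ 1 := by
  set v := hW.isHermitian.eigenvectorBasis l
  have h := hW.le_one.dotProduct_mulVec_nonneg v.ofLp
  have hn : (star v.ofLp) ⬝ᵥ v.ofLp = 1 := by
    have h1 : inner ℝ v v = (1 : ℝ) := by
      rw [real_inner_self_eq_norm_sq, hW.isHermitian.eigenvectorBasis.norm_eq_one]; norm_num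
    rw [EuclideanSpace.inner_eq_star_dotProduct] at h1
    rw [dotProduct_comm]; exact h1
  rw [Matrix.sub_mulVec, Matrix.one_mulVec, hW.isHermitian.mulVec_eigenvectorBasis,
    dotProduct_sub, dotProduct_smul, hn, smul_eq_mul, mul_one] at h
  linarith

/-- Otherwise the constant vector, fixed by the symmetric matrix `W`, would be orthogonal to every
eigenvector and hence zero. -/
theorem AdmissibleMixing.exists_eigenvalue_one (hW : AdmissibleMixing G W) (hm : 0 < m) :
    ∃ l, hW.isHermitian.eigenvalues l = 1 := by
  by_contra! h
  have hzero : ∀ l, inner ℝ (hW.isHermitian.eigenvectorBasis l)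
      (WithLp.toLp 2 (fun _ => 1 : Fin m → ℝ)) = (0 : ℝ) := by
    intro l
    have h1 : (hW.isHermitian.eigenvalues l) * inner ℝ (hW.isHermitian.eigenvectorBasis l)
        (WithLp.toLp 2 (fun _ => 1 : Fin m → ℝ)) = inner ℝ (hW.isHermitian.eigenvectorBasis l)
        (WithLp.toLp 2 (fun _ => 1 : Fin m → ℝ)) := by
      rw [EuclideanSpace.inner_eq_star_dotProduct]
      simp only [star_trivial]
      conv_rhs => rw [← hW.mulVec_one]
      rw [dotProduct_comm (W.mulVec _), Matrix.dotProduct_mulVec, ← Matrix.mulVec_transpose,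
        hW.symm.eq, dotProduct_comm, hW.isHermitian.mulVec_eigenvectorBasis, smul_dotProduct, smul_eq_mul]
    have h2 : (hW.isHermitian.eigenvalues l - 1) * inner ℝ (hW.isHermitian.eigenvectorBasis l)
        (WithLp.toLp 2 (fun _ => 1 : Fin m → ℝ)) = 0 := by rw [sub_mul, h1]; ring
    exact (mul_eq_zero.1 h2).resolve_left (sub_ne_zero.2 (h l))
  have h3 := hW.isHermitian.eigenvectorBasis.sum_sq_norm_inner_right
    (WithLp.toLp 2 (fun _ => 1 : Fin m → ℝ))
  simp only [hzero, norm_zero] at h3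
  have h4 : WithLp.toLp 2 (fun _ => 1 : Fin m → ℝ) = 0 := by
    rw [← norm_eq_zero]; simpa using h3.symm
  have h5 := congrArg (fun u : EuclideanSpace ℝ (Fin m) => u ⟨0, hm⟩) h4
  simp at h5

theorem AdmissibleMixing.eigenvector_const (hW : AdmissibleMixing G W) {l : Fin m}
    (hl : hW.isHermitian.eigenvalues l = 1) :
    ∃ a : ℝ, ∀ i, hW.isHermitian.eigenvectorBasis l i = a := by
  have h := hW.isHermitian.mulVec_eigenvectorBasis l
  rw [hl, one_smul] at h
  obtain ⟨a, ha⟩ := hW.mem_span_of_mulVec_eq h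
  exact ⟨a, fun i => congrFun ha i⟩

/-- Eigenvectors for the eigenvalue 1 are constant, and two nonzero constant vectors are never
orthogonal. -/
theorem AdmissibleMixing.eigenvalue_one_unique (hW : AdmissibleMixing G W) {k l : Fin m}
    (hk : hW.isHermitian.eigenvalues k = 1) (hl : hW.isHermitian.eigenvalues l = 1) : k = l := by
  by_contra hne
  obtain ⟨a, ha⟩ := hW.eigenvector_const hk
  obtain ⟨c, hc⟩ := hW.eigenvector_const hl
  have horth := hW.isHermitian.eigenvectorBasis.inner_eq_zero hne
  have hn1 := hW.isHermitian.eigenvectorBasis.norm_eq_one k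
  have hn2 := hW.isHermitian.eigenvectorBasis.norm_eq_one l
  have hm : 0 < m := k.pos
  have h1 : (m : ℝ) * (a * c) = 0 := by
    rw [PiLp.inner_apply] at horth
    simp only [ha, hc] at horth
    simpa [mul_comm] using horth
  rw [EuclideanSpace.norm_eq] at hn1 hn2
  simp only [ha, hc] at hn1 hn2
  have hm' : (m : ℝ) ≠ 0 := by positivity
  rcases mul_eq_zero.1 ((mul_eq_zero.1 h1).resolve_left hm') with h | h
  · simp [h] at hn1
  · simp [h] at hn2

/-- In the decreasing list the simple eigenvalue 1 occupies index 0, so the entry at index 1 is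
below 1 and dominates all the others. -/
theorem AdmissibleMixing.lambda2_bounds (hW : AdmissibleMixing G W) (hm : 0 < m) :
    0 ≤ lambda2 W ∧ lambda2 W < 1 ∧
      ∀ l, hW.isHermitian.eigenvalues l = 1 ∨ hW.isHermitian.eigenvalues l ≤ lambda2 W := by
  by_cases h1 : 1 < m
  -- This is the reindexing used inside `eigenvalues`, which is why `hval` is definitional.
  · set e : Fin (Fintype.card (Fin m)) ≃ Fin m :=
      Fintype.equivOfCardEq (Fintype.card_fin _) with he
    have hval : ∀ l, hW.isHermitian.eigenvalues l = hW.isHermitian.eigenvalues₀ (e.symm l) :=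
      fun l => rfl
    set i1 : Fin (Fintype.card (Fin m)) := ⟨1, lt_of_lt_of_eq h1 (Fintype.card_fin m).symm⟩
      with hi1
    set i0 : Fin (Fintype.card (Fin m)) := ⟨0, lt_of_lt_of_eq hm (Fintype.card_fin m).symm⟩
      with hi0
    have hlam : lambda2 W = hW.isHermitian.eigenvalues₀ i1 := by
      rw [lambda2, dif_pos ⟨hW.isHermitian, h1⟩]
    have hlam' : lambda2 W = hW.isHermitian.eigenvalues (e i1) := by
      rw [hlam, hval, Equiv.symm_apply_apply]
    have hle := hW.eigenvalues_le_one
    obtain ⟨k, hk⟩ := hW.exists_eigenvalue_one hm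
    have h0 : hW.isHermitian.eigenvalues (e i0) = 1 := by
      refine le_antisymm (hle _) ?_
      rw [← hk, hval, hval, Equiv.symm_apply_apply]
      exact hW.isHermitian.eigenvalues₀_antitone (Fin.mk_le_of_le_val (Nat.zero_le _))
    refine ⟨?_, ?_, fun l => ?_⟩
    · rw [hlam']; exact hW.psd.eigenvalues_nonneg _
    · refine lt_of_le_of_ne (hlam' ▸ hle _) fun h => ?_
      have := hW.eigenvalue_one_unique h0 (hlam' ▸ h)
      have := e.injective this
      simp [hi0, hi1] at this
    · by_cases hl : e.symm l = i0
      · left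
        rw [hval, hl, ← h0, hval, Equiv.symm_apply_apply]
      · right
        rw [hval, hlam]
        refine hW.isHermitian.eigenvalues₀_antitone ?_
        rw [Fin.le_def]
        have : (e.symm l : ℕ) ≠ 0 := fun h => hl (Fin.ext h)
        simp only [hi1]; omega
  · have hlam : lambda2 W = 0 := by rw [lambda2, dif_neg (fun h => h1 h.2)]
    obtain rfl : m = 1 := by omega
    refine ⟨hlam.ge, by rw [hlam]; norm_num, fun l => Or.inl ?_⟩
    obtain ⟨k, hk⟩ := hW.exists_eigenvalue_one hm
    rwa [Subsingleton.elim l k]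

theorem AdmissibleMixing.spectralGap_pos (hW : AdmissibleMixing G W) (hm : 0 < m) :
    0 < spectralGap W ∧ spectralGap W ≤ 1 := by
  have := hW.lambda2_bounds hm
  unfold spectralGap
  constructor <;> linarith [this.1, this.2.1]

theorem AdmissibleMixing.sum_col (hW : AdmissibleMixing G W) (j : Fin m) :
    ∑ i, W i j = 1 := by
  have h := congrFun hW.mulVec_one j
  simp only [Matrix.mulVec, dotProduct, mul_one] at h
  rw [← h]
  exact Finset.sum_congr rfl fun i _ => hW.symm.apply j i

theorem AdmissibleMixing.sum_row (hW : AdmissibleMixing G W) (i : Fin m) :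
    ∑ j, W i j = 1 := by
  have h := congrFun hW.mulVec_one i
  simpa only [Matrix.mulVec, dotProduct, mul_one] using h

end Spectrum

/-- The average of a family of vectors. -/
noncomputable def avg {m : ℕ} {F : Type*} [AddCommGroup F] [Module ℝ F] (φ : Fin m → F) : F :=
  (1 / (m : ℝ)) • ∑ i, φ i

/-- The squared distance of a family of vectors to consensus. -/
noncomputable def deviation {m d : ℕ} (φ : Fin m → EuclideanSpace ℝ (Fin d)) : ℝ :=
  ∑ i, ‖φ i - avg φ‖ ^ 2

/-! ### FastMix in the eigenbasis of the mixing matrix -/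

section FastMix

variable {m d : ℕ} {G : SimpleGraph (Fin m)} {W : Matrix (Fin m) (Fin m) ℝ}

theorem avg_const (hm : 0 < m) {F : Type*} [AddCommGroup F] [Module ℝ F] (c : F) :
    avg (fun _ : Fin m => c) = c := by
  have : (m : ℝ) ≠ 0 := by positivity
  rw [avg, Finset.sum_const, Finset.card_univ, Fintype.card_fin, ← Nat.cast_smul_eq_nsmul ℝ,
    smul_smul, one_div_mul_cancel this, one_smul]

theorem avg_add {F : Type*} [AddCommGroup F] [Module ℝ F] (φ ψ : Fin m → F) :
    avg (fun i => φ i + ψ i) = avg φ + avg ψ := by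
  simp only [avg, Finset.sum_add_distrib, smul_add]

theorem avg_sub {F : Type*} [AddCommGroup F] [Module ℝ F] (φ ψ : Fin m → F) :
    avg (fun i => φ i - ψ i) = avg φ - avg ψ := by
  simp only [avg, Finset.sum_sub_distrib, smul_sub]

theorem avg_smul {F : Type*} [AddCommGroup F] [Module ℝ F] (a : ℝ) (φ : Fin m → F) :
    avg (fun i => a • φ i) = a • avg φ := by
  simp only [avg, ← Finset.smul_sum, smul_comm a]

theorem sum_sub_avg (hm : 0 < m) {F : Type*} [AddCommGroup F] [Module ℝ F] (φ : Fin m → F) :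
    ∑ i, (φ i - avg φ) = 0 := by
  have : (m : ℝ) ≠ 0 := by positivity
  rw [Finset.sum_sub_distrib, Finset.sum_const, Finset.card_univ, Fintype.card_fin,
    ← Nat.cast_smul_eq_nsmul ℝ, avg, smul_smul, mul_one_div_cancel this, one_smul, sub_self]

theorem fastMixPair_succ_snd (φ : Fin m → EuclideanSpace ℝ (Fin d)) (r : ℕ) :
    (fastMixPair W φ (r + 1)).2 = (fastMixPair W φ r).1 := rfl

theorem avg_mix (hW : AdmissibleMixing G W) (z : Fin m → EuclideanSpace ℝ (Fin d)) :
    avg (fun i => ∑ j, W i j • z j) = avg z := by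
  unfold avg
  rw [Finset.sum_comm]
  simp_rw [← Finset.sum_smul, hW.sum_col, one_smul]

theorem avg_fastMix (hW : AdmissibleMixing G W) (φ : Fin m → EuclideanSpace ℝ (Fin d)) (R : ℕ) :
    avg (fastMix W R φ) = avg φ := by
  have h : ∀ r, avg (fastMixPair W φ r).1 = avg φ ∧ avg (fastMixPair W φ r).2 = avg φ := by
    intro r
    induction r with
    | zero => exact ⟨rfl, rfl⟩
    | succ r ih =>
      refine ⟨?_, ih.1⟩
      simp only [fastMixPair]
      rw [avg_sub, avg_smul, avg_smul, avg_mix hW, ih.1, ih.2, ← sub_smul]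
      simp
  exact (h R).1

/-- Rows of `W` sum to one and (1+θ) - θ = 1. This lets the mean be removed before passing to
eigencoefficients. -/
theorem fastMix_sub_const (hW : AdmissibleMixing G W) (φ : Fin m → EuclideanSpace ℝ (Fin d))
    (c : EuclideanSpace ℝ (Fin d)) (R : ℕ) (i : Fin m) :
    fastMix W R (fun i => φ i - c) i = fastMix W R φ i - c := by
  have h : ∀ r, (∀ i, (fastMixPair W (fun i => φ i - c) r).1 i = (fastMixPair W φ r).1 i - c) ∧
      ∀ i, (fastMixPair W (fun i => φ i - c) r).2 i = (fastMixPair W φ r).2 i - c := by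
    intro r
    induction r with
    | zero => exact ⟨fun _ => rfl, fun _ => rfl⟩
    | succ r ih =>
      refine ⟨fun i => ?_, ih.1⟩
      simp only [fastMixPair, ih.1, ih.2, smul_sub, Finset.sum_sub_distrib, ← Finset.sum_smul,
        hW.sum_row, one_smul, add_smul]
      abel
  exact (h R).1 i

/-- The coefficient of a family of vectors along an eigenvector of the mixing matrix. -/
noncomputable def eigenCoeff (hW : AdmissibleMixing G W) (l : Fin m)
    (φ : Fin m → EuclideanSpace ℝ (Fin d)) : EuclideanSpace ℝ (Fin d) :=
  ∑ i, hW.isHermitian.eigenvectorBasis l i • φ i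

/-- Parseval, applied in each of the `d` coordinates. -/
theorem sum_norm_sq_eigenCoeff (hW : AdmissibleMixing G W)
    (φ : Fin m → EuclideanSpace ℝ (Fin d)) :
    ∑ l, ‖eigenCoeff hW l φ‖ ^ 2 = ∑ i, ‖φ i‖ ^ 2 := by
  have h : ∀ k : Fin d, ∑ l, (eigenCoeff hW l φ k) ^ 2 = ∑ i, (φ i k) ^ 2 := by
    intro k
    have := hW.isHermitian.eigenvectorBasis.sum_sq_norm_inner_right
      (WithLp.toLp 2 (fun i => φ i k))
    rw [EuclideanSpace.norm_sq_eq] at this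
    simp only [Real.norm_eq_abs, sq_abs] at this
    rw [← this]
    refine Finset.sum_congr rfl fun l _ => ?_
    congr 1
    rw [PiLp.inner_apply, eigenCoeff]
    simp [mul_comm]
  simp_rw [EuclideanSpace.norm_sq_eq, Real.norm_eq_abs, sq_abs]
  rw [Finset.sum_comm, Finset.sum_comm (f := fun i k => (φ i k) ^ 2)]
  exact Finset.sum_congr rfl fun k _ => h k

theorem eigenCoeff_mix (hW : AdmissibleMixing G W) (l : Fin m)
    (z : Fin m → EuclideanSpace ℝ (Fin d)) :
    eigenCoeff hW l (fun i => ∑ j, W i j • z j)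
      = hW.isHermitian.eigenvalues l • eigenCoeff hW l z := by
  have h := hW.isHermitian.mulVec_eigenvectorBasis l
  unfold eigenCoeff
  simp_rw [Finset.smul_sum, smul_smul]
  rw [Finset.sum_comm]
  refine Finset.sum_congr rfl fun j _ => ?_
  rw [← Finset.sum_smul]
  congr 1
  have hj := congrFun h j
  simp only [Matrix.mulVec, dotProduct, Pi.smul_apply, smul_eq_mul] at hj
  rw [← hj]
  refine Finset.sum_congr rfl fun i _ => ?_
  rw [hW.symm.apply j i, mul_comm]

/-- Once the mean is removed, the coefficient along the constant eigenvector is zero and stays zero.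
Every other coefficient follows the scalar recursion with an eigenvalue in [0, λ₂], and Parseval
reassembles the deviation. -/
theorem deviation_fastMix_le (hW : AdmissibleMixing G W) (hm : 0 < m)
    (φ : Fin m → EuclideanSpace ℝ (Fin d)) (R : ℕ) :
    deviation (fastMix W R φ)
      ≤ 9 * Real.exp (-Real.sqrt (spectralGap W) * R / 2) * deviation φ := by
  obtain ⟨hl0, hl1, hl⟩ := hW.lambda2_bounds hm
  set ψ : Fin m → EuclideanSpace ℝ (Fin d) := fun i => φ i - avg φ with hψ
  have h1 : deviation (fastMix W R φ) = ∑ i, ‖fastMix W R ψ i‖ ^ 2 := by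
    unfold deviation
    rw [avg_fastMix hW]
    exact Finset.sum_congr rfl fun i _ => by rw [hψ, fastMix_sub_const hW]
  have h2 : deviation φ = ∑ i, ‖ψ i‖ ^ 2 := rfl
  rw [h1, h2, ← sum_norm_sq_eigenCoeff hW (fastMix W R ψ), ← sum_norm_sq_eigenCoeff hW ψ,
    Finset.mul_sum]
  refine Finset.sum_le_sum fun l _ => ?_
  have hrec : ∀ r, eigenCoeff hW l (fastMixPair W ψ (r + 1)).1
      = ((1 + mixMomentum W) * hW.isHermitian.eigenvalues l) • eigenCoeff hW l (fastMixPair W ψ r).1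
        - mixMomentum W • eigenCoeff hW l (fastMixPair W ψ r).2 := by
    intro r
    rw [mul_smul, ← eigenCoeff_mix]
    simp only [fastMixPair, eigenCoeff, smul_sub, Finset.sum_sub_distrib, Finset.smul_sum]
    congr 1 <;> refine Finset.sum_congr rfl fun i _ => ?_
    · rw [Finset.sum_congr rfl fun j _ => ?_]
      rw [smul_comm]
    · rw [smul_comm]
  rcases hl l with h | h
  · obtain ⟨a, ha⟩ := hW.eigenvector_const h
    have h0 : eigenCoeff hW l ψ = 0 := by
      unfold eigenCoeff
      simp_rw [ha]
      rw [← Finset.smul_sum, hψ, sum_sub_avg hm, smul_zero]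
    have hz : ∀ r, eigenCoeff hW l (fastMixPair W ψ r).1 = 0 ∧
        eigenCoeff hW l (fastMixPair W ψ r).2 = 0 := by
      intro r
      induction r with
      | zero => exact ⟨h0, h0⟩
      | succ r ih => exact ⟨by rw [hrec, ih.1, ih.2]; simp, ih.1⟩
    have : eigenCoeff hW l (fastMix W R ψ) = 0 := (hz R).1
    rw [this, h0]; simp
  · have hb := norm_le_of_fastMix_recursion (hW.psd.eigenvalues_nonneg l) h hl1
      (θ := mixMomentum W) rfl (fun r => eigenCoeff hW l (fastMixPair W ψ r).1)
      (by rw [hrec]; simp only [fastMixPair, sub_smul]) (fun r => by rw [hrec, fastMixPair_succ_snd]) R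
    have hb' : ‖eigenCoeff hW l (fastMix W R ψ)‖
        ≤ 3 * Real.exp (-Real.sqrt (spectralGap W) * R / 4) * ‖eigenCoeff hW l ψ‖ := hb
    calc ‖eigenCoeff hW l (fastMix W R ψ)‖ ^ 2
        ≤ (3 * Real.exp (-Real.sqrt (spectralGap W) * R / 4) * ‖eigenCoeff hW l ψ‖) ^ 2 := by
          gcongr
      _ = 9 * Real.exp (-Real.sqrt (spectralGap W) * R / 2) * ‖eigenCoeff hW l ψ‖ ^ 2 := by
          rw [mul_pow, mul_pow, ← Real.exp_nat_mul]
          norm_num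
          left; ring_nf

end FastMix

/-! ### Second moments of sums of independent vectors -/

section SecondMoment

variable {d : ℕ}

theorem memLp_two_const_add_sum {Ω ι : Type*} [MeasurableSpace Ω] {P : Measure Ω}
    [IsFiniteMeasure P] {X : ι → Ω → EuclideanSpace ℝ (Fin d)} (hX : ∀ i, MemLp (X i) 2 P)
    (J : Finset ι) (c : EuclideanSpace ℝ (Fin d)) :
    MemLp (fun w => c + ∑ i ∈ J, X i w) 2 P :=
  (memLp_const c).add (memLp_finsetSum J fun i _ => hX i)

/-- Bias plus variance, by adding one vector at a time: the cross term with the new vector factors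
by independence. The offset `c` later carries the part of the error that is known from the past. -/
theorem integral_norm_sq_add_sum_of_iIndepFun {Ω ι : Type*} [MeasurableSpace Ω]
    {P : Measure Ω} [IsProbabilityMeasure P] {X : ι → Ω → EuclideanSpace ℝ (Fin d)}
    (hind : iIndepFun X P) (hX : ∀ i, MemLp (X i) 2 P) (J : Finset ι)
    (c : EuclideanSpace ℝ (Fin d)) :
    ∫ w, ‖c + ∑ i ∈ J, X i w‖ ^ 2 ∂P = ‖c + ∑ i ∈ J, ∫ w, X i w ∂P‖ ^ 2
      + ∑ i ∈ J, (∫ w, ‖X i w‖ ^ 2 ∂P - ‖∫ w, X i w ∂P‖ ^ 2) := by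
  classical
  have hint : ∀ i, Integrable (X i) P := fun i => (hX i).integrable one_le_two
  induction J using Finset.induction_on with
  | empty => simp
  | insert k J hk ih =>
    have hsum := memLp_two_const_add_sum hX J c
    have hY : Integrable (fun w => c + ∑ i ∈ J, X i w) P := hsum.integrable one_le_two
    have hindep : IndepFun (fun w => c + ∑ i ∈ J, X i w) (X k) P := by
      have h := hind.indepFun_finsetSum_of_notMem₀ (fun i => (hint i).aemeasurable) hk
      have h2 := h.comp (φ := fun v => c + v) (ψ := id) (by fun_prop) measurable_id
      have h3 : (fun w => c + ∑ i ∈ J, X i w) = (fun v => c + v) ∘ ∑ j ∈ J, X j := by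
        ext1 w; simp [Finset.sum_apply]
      rw [h3]
      exact h2
    have hin := hindep.integral_bilin hY (hint k) (innerSL ℝ)
    have hinner : Integrable (fun w => (inner ℝ (c + ∑ i ∈ J, X i w) (X k w) : ℝ)) P :=
      hindep.integrable_bilin hY (hint k) (innerSL ℝ)
    have hmean : ∫ w, (c + ∑ i ∈ J, X i w) ∂P = c + ∑ i ∈ J, ∫ w, X i w ∂P := by
      rw [integral_add (integrable_const c) (integrable_finsetSum _ fun i _ => hint i),
        integral_finsetSum _ fun i _ => hint i]
      simp
    have h1 : ∀ w, ‖c + ∑ i ∈ insert k J, X i w‖ ^ 2 = ‖c + ∑ i ∈ J, X i w‖ ^ 2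
        + 2 * inner ℝ (c + ∑ i ∈ J, X i w) (X k w) + ‖X k w‖ ^ 2 := by
      intro w
      rw [Finset.sum_insert hk, add_comm (X k w), ← add_assoc, norm_add_sq_real]
    simp_rw [h1]
    have hsq : Integrable (fun w => ‖c + ∑ i ∈ J, X i w‖ ^ 2) P :=
      hsum.integrable_norm_pow (by norm_num)
    have hadd : Integrable (fun w => ‖c + ∑ i ∈ J, X i w‖ ^ 2
        + 2 * (inner ℝ (c + ∑ i ∈ J, X i w) (X k w) : ℝ)) P := hsq.add (hinner.const_mul 2)
    rw [integral_add hadd ((hX k).integrable_norm_pow (by norm_num)),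
      integral_add hsq (hinner.const_mul 2),
      integral_const_mul, ih, Finset.sum_insert hk, Finset.sum_insert hk,
      add_comm (∫ w, X k w ∂P) (∑ i ∈ J, ∫ w, X i w ∂P), ← add_assoc c,
      norm_add_sq_real (c + ∑ i ∈ J, ∫ w, X i w ∂P) (∫ w, X k w ∂P)]
    have hin' : ∫ w, (inner ℝ (c + ∑ i ∈ J, X i w) (X k w) : ℝ) ∂P
        = inner ℝ (c + ∑ i ∈ J, ∫ w, X i w ∂P) (∫ w, X k w ∂P) := by
      rw [← hmean]; exact hin
    rw [hin']
    ring

theorem integral_norm_sub_integral_sq {Ω : Type*} [MeasurableSpace Ω] {P : Measure Ω}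
    [IsProbabilityMeasure P] {X : Ω → EuclideanSpace ℝ (Fin d)} (hX : MemLp X 2 P) :
    ∫ w, ‖X w - ∫ w', X w' ∂P‖ ^ 2 ∂P = ∫ w, ‖X w‖ ^ 2 ∂P - ‖∫ w, X w ∂P‖ ^ 2 := by
  set M := ∫ w, X w ∂P with hM
  have hint : Integrable X P := hX.integrable one_le_two
  simp_rw [norm_sub_sq_real]
  have h1 : Integrable (fun w => ‖X w‖ ^ 2) P := hX.integrable_norm_pow (by norm_num)
  have h2 : Integrable (fun w => 2 * (inner ℝ (X w) M : ℝ)) P := (hint.inner_const M).const_mul 2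
  have h12 : Integrable (fun w => ‖X w‖ ^ 2 - 2 * (inner ℝ (X w) M : ℝ)) P := h1.sub h2
  rw [integral_add h12 (integrable_const _), integral_sub h1 h2, integral_const_mul]
  have h3 : ∫ w, (inner ℝ (X w) M : ℝ) ∂P = inner ℝ M M := by
    simp_rw [real_inner_comm M]
    exact integral_inner hint M
  rw [h3, real_inner_self_eq_norm_sq]
  simp
  ring

theorem norm_integral_sq_le {Ω : Type*} [MeasurableSpace Ω] {P : Measure Ω}
    [IsProbabilityMeasure P] {X : Ω → EuclideanSpace ℝ (Fin d)} (hX : MemLp X 2 P) :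
    ‖∫ w, X w ∂P‖ ^ 2 ≤ ∫ w, ‖X w‖ ^ 2 ∂P := by
  have h := integral_norm_sub_integral_sq hX
  have h2 : 0 ≤ ∫ w, ‖X w - ∫ w', X w' ∂P‖ ^ 2 ∂P := integral_nonneg fun _ => by positivity
  linarith

variable {ι : Type*} [Fintype ι] {α : ι → Type*} [∀ i, MeasurableSpace (α i)]
  {μ : ∀ i, Measure (α i)} [∀ i, IsProbabilityMeasure (μ i)]
  {Z : ∀ i, α i → EuclideanSpace ℝ (Fin d)}

theorem memLp_comp_eval (hZ : ∀ i, MemLp (Z i) 2 (μ i)) (i : ι) :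
    MemLp (fun a : ∀ i, α i => Z i (a i)) 2 (Measure.pi μ) :=
  (hZ i).comp_measurePreserving (measurePreserving_eval μ i)

theorem integral_norm_sq_add_sum_pi (hZ : ∀ i, MemLp (Z i) 2 (μ i)) (J : Finset ι)
    (c : EuclideanSpace ℝ (Fin d)) :
    ∫ a, ‖c + ∑ i ∈ J, Z i (a i)‖ ^ 2 ∂(Measure.pi μ) = ‖c + ∑ i ∈ J, ∫ a, Z i a ∂(μ i)‖ ^ 2
      + ∑ i ∈ J, (∫ a, ‖Z i a‖ ^ 2 ∂(μ i) - ‖∫ a, Z i a ∂(μ i)‖ ^ 2) := by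
  have h := integral_norm_sq_add_sum_of_iIndepFun
    (iIndepFun_pi (X := Z) fun i => (hZ i).aestronglyMeasurable.aemeasurable)
    (memLp_comp_eval hZ) J c
  rw [h]
  have h1 : ∀ i, ∫ a : (∀ i, α i), Z i (a i) ∂(Measure.pi μ) = ∫ a, Z i a ∂(μ i) := fun i =>
    integral_comp_eval (hZ i).aestronglyMeasurable
  have h2 : ∀ i, ∫ a : (∀ i, α i), ‖Z i (a i)‖ ^ 2 ∂(Measure.pi μ) = ∫ a, ‖Z i a‖ ^ 2 ∂(μ i) :=
    fun i => integral_comp_eval (f := fun a => ‖Z i a‖ ^ 2)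
      ((hZ i).aestronglyMeasurable.norm.pow 2)
  simp_rw [h1, h2]

/-- The `lintegral` form composes with Tonelli on the product of coins and samples without
integrability side conditions. -/
theorem lintegral_norm_sq_add_sum_pi (hZ : ∀ i, MemLp (Z i) 2 (μ i)) (J : Finset ι)
    (c : EuclideanSpace ℝ (Fin d)) :
    ∫⁻ a, ENNReal.ofReal (‖c + ∑ i ∈ J, Z i (a i)‖ ^ 2) ∂(Measure.pi μ)
      = ENNReal.ofReal (‖c + ∑ i ∈ J, ∫ a, Z i a ∂(μ i)‖ ^ 2
        + ∑ i ∈ J, (∫ a, ‖Z i a‖ ^ 2 ∂(μ i) - ‖∫ a, Z i a ∂(μ i)‖ ^ 2)) := by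
  rw [← integral_norm_sq_add_sum_pi hZ, ofReal_integral_eq_lintegral_ofReal]
  · exact (memLp_two_const_add_sum (memLp_comp_eval hZ) J c).integrable_norm_pow (by norm_num)
  · exact Filter.Eventually.of_forall fun _ => by positivity

/-- Mean and variance of a sum of `n` independent copies. -/
theorem integral_sum_pi_const {A : Type*} [MeasurableSpace A] {ν : Measure A}
    [IsProbabilityMeasure ν] {h : A → EuclideanSpace ℝ (Fin d)} (hh : MemLp h 2 ν) (n : ℕ) :
    MemLp (fun a : Fin n → A => ∑ j, h (a j)) 2 (Measure.pi fun _ => ν) ∧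
    ∫ a : Fin n → A, ∑ j, h (a j) ∂(Measure.pi fun _ => ν) = (n : ℝ) • ∫ a, h a ∂ν ∧
    ∫ a : Fin n → A, ‖∑ j, h (a j)‖ ^ 2 ∂(Measure.pi fun _ => ν)
      - ‖∫ a : Fin n → A, ∑ j, h (a j) ∂(Measure.pi fun _ => ν)‖ ^ 2
      = n * (∫ a, ‖h a‖ ^ 2 ∂ν - ‖∫ a, h a ∂ν‖ ^ 2) := by
  have hm := memLp_comp_eval (ι := Fin n) (μ := fun _ => ν) (Z := fun _ => h) fun _ => hh
  have hmean : ∫ a : Fin n → A, ∑ j, h (a j) ∂(Measure.pi fun _ => ν)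
      = (n : ℝ) • ∫ a, h a ∂ν := by
    rw [integral_finsetSum _ fun j _ => (hm j).integrable one_le_two]
    have h1 : ∀ j : Fin n, ∫ a : Fin n → A, h (a j) ∂(Measure.pi fun _ => ν) = ∫ a, h a ∂ν :=
      fun j => integral_comp_eval (μ := fun _ : Fin n => ν) hh.aestronglyMeasurable
    simp_rw [h1]
    simp [← Nat.cast_smul_eq_nsmul ℝ]
  refine ⟨memLp_finsetSum _ fun j _ => hm j, hmean, ?_⟩
  have h2 := integral_norm_sq_add_sum_pi (ι := Fin n) (μ := fun _ => ν) (Z := fun _ => h)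
    (fun _ => hh) Finset.univ 0
  simp only [zero_add] at h2
  rw [h2, hmean]
  simp [← Nat.cast_smul_eq_nsmul ℝ, mul_sub]

end SecondMoment

/-! ### The Bernoulli coins -/

theorem lintegral_bernoulliMeasure_prod {A : Type*} [MeasurableSpace A] (ν : Measure A)
    [SFinite ν] (p : unitInterval) {F : Bool × A → ENNReal} (hF : Measurable F) :
    ∫⁻ z, F z ∂((bernoulliMeasure true false p).prod ν)
      = ENNReal.ofReal p * ∫⁻ a, F (true, a) ∂ν
        + ENNReal.ofReal (1 - p) * ∫⁻ a, F (false, a) ∂ν := by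
  rw [lintegral_prod _ hF.aemeasurable, bernoulliMeasure_def, lintegral_add_measure,
    lintegral_smul_measure, lintegral_smul_measure, lintegral_dirac, lintegral_dirac]
  have h1 : ∀ x : unitInterval, ((unitInterval.toNNReal x : NNReal) : ENNReal)
      = ENNReal.ofReal (x : ℝ) := fun x => by
    rw [ENNReal.ofReal]
    congr 1
    ext; simp [Real.coe_toNNReal _ x.2.1]
  simp only [ENNReal.smul_def, smul_eq_mul, h1, unitInterval.coe_symm_eq]

theorem integral_pi_bernoulliMeasure {m : ℕ} (q : unitInterval) (F : Bool → ℝ) (i : Fin m) :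
    ∫ ω : Fin m → Bool, F (ω i) ∂(Measure.pi fun _ => bernoulliMeasure true false q)
      = q * F true + (1 - q) * F false := by
  rw [integral_comp_eval (μ := fun _ : Fin m => bernoulliMeasure true false q) (f := F)
    (measurable_of_finite F).aestronglyMeasurable, integral_bernoulliMeasure]
  simp

/-! ### Measurability of the algorithm -/

section Measurability

variable {m d : ℕ} {Ξ : Fin m → Type*} [∀ i, MeasurableSpace (Ξ i)] {D : ∀ i, Measure (Ξ i)}
  {f : Fin m → EuclideanSpace ℝ (Fin d) → ℝ}
  {g : ∀ i, EuclideanSpace ℝ (Fin d) → Ξ i → EuclideanSpace ℝ (Fin d)} {σ : Fin m → ℝ}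
  {B : Fin m → ℕ} {b : ℕ} {A : Type*} [MeasurableSpace A]

theorem HeterogeneousVariance.measurable_apply (hg : HeterogeneousVariance D f g σ) (i : Fin m)
    {u : A → EuclideanSpace ℝ (Fin d)} {v : A → Ξ i} (hu : Measurable u) (hv : Measurable v) :
    Measurable fun a => g i (u a) (v a) :=
  (hg.measurable i).comp (hu.prodMk hv)

theorem measurable_largeBatchGrad (hg : HeterogeneousVariance D f g σ) {ρ : A → Draw Ξ B b}
    (hρ : Measurable ρ) (i : Fin m) {u : A → EuclideanSpace ℝ (Fin d)} (hu : Measurable u) :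
    Measurable fun a => largeBatchGrad g (ρ a) i (u a) := by
  unfold largeBatchGrad
  refine Measurable.fun_const_smul (Finset.measurable_fun_sum _ fun j _ => ?_) _
  exact hg.measurable_apply i hu ((measurable_pi_apply j).comp
    ((measurable_pi_apply i).comp (measurable_fst.comp (measurable_snd.comp
      (measurable_snd.comp hρ)))))

theorem measurable_fastMix (W : Matrix (Fin m) (Fin m) ℝ) (R : ℕ)
    {φ : A → Fin m → EuclideanSpace ℝ (Fin d)} (hφ : ∀ i, Measurable fun a => φ a i)
    (i : Fin m) : Measurable fun a => fastMix W R (φ a) i := by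
  have h : ∀ r, (∀ i, Measurable fun a => (fastMixPair W (φ a) r).1 i) ∧
      ∀ i, Measurable fun a => (fastMixPair W (φ a) r).2 i := by
    intro r
    induction r with
    | zero => exact ⟨hφ, hφ⟩
    | succ r ih =>
      refine ⟨fun i => ?_, ih.1⟩
      refine Measurable.sub (Measurable.fun_const_smul ?_ _) ((ih.2 i).fun_const_smul _)
      exact Finset.measurable_fun_sum _ fun j _ => (ih.1 j).fun_const_smul _
  exact (h R).1 i

/-- All the variables of a random state are measurable. -/
structure MeasurableState (S : A → State m d) : Prop where
  xPrev : ∀ i, Measurable fun a => (S a).xPrev i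
  x : ∀ i, Measurable fun a => (S a).x i
  y : ∀ i, Measurable fun a => (S a).y i
  s : ∀ i, Measurable fun a => (S a).s i

theorem measurableState_initState (hg : HeterogeneousVariance D f g σ)
    (W : Matrix (Fin m) (Fin m) ℝ) (η : ℝ) (x0 : EuclideanSpace ℝ (Fin d)) (R : ℕ)
    {ρ : A → Draw Ξ B b} (hρ : Measurable ρ) :
    MeasurableState fun a => initState g W η x0 R (ρ a) := by
  have hy : ∀ i, Measurable fun a => largeBatchGrad g (ρ a) i x0 := fun i =>
    measurable_largeBatchGrad hg hρ i measurable_const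
  have hs := fun i => measurable_fastMix W R hy i
  exact ⟨fun i => measurable_const, fun i => measurable_fastMix W R
    (fun i => measurable_const.sub ((hs i).fun_const_smul _)) i, hy, hs⟩

theorem measurableState_step (hg : HeterogeneousVariance D f g σ)
    (W : Matrix (Fin m) (Fin m) ℝ) (η q : ℝ) (R : ℕ)
    {ρ : A → Draw Ξ B b} (hρ : Measurable ρ) {S : A → State m d} (hS : MeasurableState S) :
    MeasurableState fun a => step g W η q R (ρ a) (S a) := by
  have hy : ∀ i, Measurable fun a => (step g W η q R (ρ a) (S a)).y i := by
    intro i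
    refine Measurable.ite ?_ (measurable_largeBatchGrad hg hρ i (hS.x i))
      (Measurable.ite ?_ ((hS.y i).add (Measurable.fun_const_smul ?_ _)) (hS.y i))
    · exact (measurableSet_singleton true).preimage (measurable_fst.comp hρ)
    · exact (measurableSet_singleton true).preimage ((measurable_pi_apply i).comp
        (measurable_fst.comp (measurable_snd.comp hρ)))
    · have hξ : ∀ j, Measurable fun a => (ρ a).2.2.2 i j := fun j => (measurable_pi_apply j).comp
        ((measurable_pi_apply i).comp (measurable_snd.comp (measurable_snd.comp
          (measurable_snd.comp hρ))))
      exact Finset.measurable_fun_sum _ fun j _ =>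
        (hg.measurable_apply i (hS.x i) (hξ j)).sub (hg.measurable_apply i (hS.xPrev i) (hξ j))
  have hs : ∀ i, Measurable fun a => (step g W η q R (ρ a) (S a)).s i := fun i =>
    measurable_fastMix W R (fun i => ((hS.s i).add (hy i)).sub (hS.y i)) i
  exact ⟨hS.x, fun i => measurable_fastMix W R
    (fun i => (hS.x i).sub ((hs i).fun_const_smul _)) i, hy, hs⟩

end Measurability

/-! ### One step of the gradient estimators -/

section OneStep

variable {m d : ℕ} {Ξ : Fin m → Type*} [∀ i, MeasurableSpace (Ξ i)]
  {D : ∀ i, Measure (Ξ i)} [∀ i, IsProbabilityMeasure (D i)]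

/-- The bias-variance identity is used twice: over the samples with the coins frozen, then over the
coins. The two variance terms are the sampling noise and the noise of skipping. -/
theorem lintegral_minibatch_eq {h : ∀ i, Ξ i → EuclideanSpace ℝ (Fin d)}
    (hm : ∀ i, Measurable (h i)) (hh : ∀ i, MemLp (h i) 2 (D i)) (b : ℕ)
    (q : unitInterval) (a : ℝ) (J : Finset (Fin m)) (c : EuclideanSpace ℝ (Fin d)) :
    ∫⁻ z, ENNReal.ofReal (‖c + ∑ i ∈ J, (if z.1 i then a • ∑ j, h i (z.2 i j) else 0)‖ ^ 2)
      ∂((Measure.pi fun _ : Fin m => bernoulliMeasure true false q).prod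
        (Measure.pi fun i => Measure.pi fun _ : Fin b => D i))
      = ENNReal.ofReal (‖c + ∑ i ∈ J, (q * a * b : ℝ) • ∫ ξ, h i ξ ∂(D i)‖ ^ 2
        + ∑ i ∈ J, (q * a ^ 2 * b * (∫ ξ, ‖h i ξ‖ ^ 2 ∂(D i) - ‖∫ ξ, h i ξ ∂(D i)‖ ^ 2)
          + q * (1 - q) * (a * b) ^ 2 * ‖∫ ξ, h i ξ ∂(D i)‖ ^ 2)) := by
  have hmeas : Measurable fun z : (Fin m → Bool) × (∀ i, Fin b → Ξ i) =>
      ENNReal.ofReal (‖c + ∑ i ∈ J, (if z.1 i then a • ∑ j, h i (z.2 i j) else 0)‖ ^ 2) := by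
    refine ENNReal.measurable_ofReal.comp (Measurable.pow_const (Measurable.norm ?_) 2)
    refine measurable_const.add (Finset.measurable_fun_sum _ fun i _ => ?_)
    refine Measurable.ite ?_ ?_ measurable_const
    · exact (measurableSet_singleton true).preimage ((measurable_pi_apply i).comp measurable_fst)
    · refine Measurable.fun_const_smul (Finset.measurable_fun_sum _ fun j _ => ?_) a
      exact (hm i).comp ((measurable_pi_apply j).comp
        ((measurable_pi_apply i).comp measurable_snd))
  rw [lintegral_prod _ hmeas.aemeasurable]
  set M : ∀ i, EuclideanSpace ℝ (Fin d) := fun i => ∫ ξ, h i ξ ∂(D i) with hM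
  set V : Fin m → ℝ := fun i => ∫ ξ, ‖h i ξ‖ ^ 2 ∂(D i) - ‖M i‖ ^ 2 with hV
  have hV0 : ∀ i, 0 ≤ V i := fun i => sub_nonneg.2 (norm_integral_sq_le (hh i))
  set w : Bool → ℝ := fun t => if t then a else 0 with hw
  have hinner : ∀ ω : Fin m → Bool,
      ∫⁻ ξ, ENNReal.ofReal (‖c + ∑ i ∈ J, (if ω i then a • ∑ j, h i (ξ i j) else 0)‖ ^ 2)
        ∂(Measure.pi fun i => Measure.pi fun _ : Fin b => D i)
      = ENNReal.ofReal (‖c + ∑ i ∈ J, (w (ω i) * b) • M i‖ ^ 2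
          + ∑ i ∈ J, w (ω i) ^ 2 * (b * V i)) := by
    intro ω
    have hs := fun i => integral_sum_pi_const (hh i) b
    have h1 := lintegral_norm_sq_add_sum_pi
      (μ := fun i => Measure.pi fun _ : Fin b => D i)
      (Z := fun i ξ => w (ω i) • ∑ j, h i (ξ j)) (fun i => (hs i).1.const_smul (w (ω i))) J c
    have h2 : ∀ (ξ : ∀ i, Fin b → Ξ i) i, (if ω i then a • ∑ j, h i (ξ i j) else 0)
        = w (ω i) • ∑ j, h i (ξ i j) := by
      intro ξ i
      by_cases hωi : ω i <;> simp [hw, hωi]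
    simp_rw [h2]
    rw [h1]
    congr 1
    congr 1
    · congr 3
      refine Finset.sum_congr rfl fun i _ => ?_
      rw [integral_smul, (hs i).2.1, smul_smul]
    · refine Finset.sum_congr rfl fun i _ => ?_
      rw [← (hs i).2.2, integral_smul]
      simp_rw [norm_smul, mul_pow]
      rw [integral_const_mul, Real.norm_eq_abs, sq_abs]
      ring
  simp_rw [hinner]
  have hfin : ∀ F : (Fin m → Bool) → ℝ, Integrable F
      (Measure.pi fun _ : Fin m => bernoulliMeasure true false q) := fun F => Integrable.of_finite
  rw [← ofReal_integral_eq_lintegral_ofReal (hfin _)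
    (Filter.Eventually.of_forall fun ω => add_nonneg (by positivity)
      (Finset.sum_nonneg fun i _ => mul_nonneg (by positivity)
        (mul_nonneg (Nat.cast_nonneg _) (hV0 i)))),
    integral_add (hfin _) (hfin _), integral_finsetSum _ fun i _ => hfin _]
  have h3 := integral_norm_sq_add_sum_pi (μ := fun _ : Fin m => bernoulliMeasure true false q)
    (Z := fun i t => (w t * b) • M i) (fun i => MemLp.of_discrete) J c
  rw [h3]
  have h4 : ∀ i, ∫ t, (w t * b) • M i ∂(bernoulliMeasure true false q)
      = (q * a * b : ℝ) • M i := fun i => by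
    rw [integral_bernoulliMeasure]
    simp [hw, smul_smul, mul_assoc]
  have h5 : ∀ i, ∫ t, ‖(w t * b) • M i‖ ^ 2 ∂(bernoulliMeasure true false q)
      = q * (a * b) ^ 2 * ‖M i‖ ^ 2 := fun i => by
    rw [integral_bernoulliMeasure]
    simp [hw, norm_smul, mul_pow, mul_assoc]
  have h6 : ∀ i, ∫ ω : Fin m → Bool, w (ω i) ^ 2 * (b * V i)
      ∂(Measure.pi fun _ : Fin m => bernoulliMeasure true false q) = q * (a ^ 2 * (b * V i)) :=
    fun i => by
      rw [integral_pi_bernoulliMeasure q (fun t => w t ^ 2 * (b * V i)) i]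
      simp [hw]
  simp_rw [h4, h5, h6]
  congr 1
  rw [add_assoc, ← Finset.sum_add_distrib]
  congr 1
  refine Finset.sum_congr rfl fun i _ => ?_
  rw [norm_smul, mul_pow (‖_‖), Real.norm_eq_abs, sq_abs]
  ring

/-- The batch errors are centred and independent across nodes, so cross terms vanish and only the
variances of the batch means add up. -/
theorem lintegral_largeBatch_le {h : ∀ i, Ξ i → EuclideanSpace ℝ (Fin d)}
    (hh : ∀ i, MemLp (h i) 2 (D i)) {σ : Fin m → ℝ}
    (hσ : ∀ i, ∫ ξ, ‖h i ξ - ∫ ξ', h i ξ' ∂(D i)‖ ^ 2 ∂(D i) ≤ σ i ^ 2) {B : Fin m → ℕ}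
    (hB : ∀ i, 1 ≤ B i) (J : Finset (Fin m)) :
    ∫⁻ z, ENNReal.ofReal (‖∑ i ∈ J, ((1 / (B i : ℝ)) • ∑ j, h i (z i j)
        - ∫ ξ, h i ξ ∂(D i))‖ ^ 2)
      ∂(Measure.pi fun i => Measure.pi fun _ : Fin (B i) => D i)
      ≤ ENNReal.ofReal (∑ i ∈ J, σ i ^ 2 / B i) := by
  have hs := fun i => integral_sum_pi_const (hh i) (B i)
  set M : ∀ i, EuclideanSpace ℝ (Fin d) := fun i => ∫ ξ, h i ξ ∂(D i) with hM
  set Y : ∀ i, (Fin (B i) → Ξ i) → EuclideanSpace ℝ (Fin d) :=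
    fun i ξ => (1 / (B i : ℝ)) • ∑ j, h i (ξ j) with hY
  have hYm : ∀ i, MemLp (Y i) 2 (Measure.pi fun _ : Fin (B i) => D i) :=
    fun i => (hs i).1.const_smul (1 / (B i : ℝ))
  have hB0 : ∀ i, (B i : ℝ) ≠ 0 := fun i => by have := hB i; positivity
  have hYmean : ∀ i, ∫ ξ, Y i ξ ∂(Measure.pi fun _ : Fin (B i) => D i) = M i := fun i => by
    rw [hY, integral_smul, (hs i).2.1, smul_smul, one_div_mul_cancel (hB0 i), one_smul]
  have hZ := lintegral_norm_sq_add_sum_pi (μ := fun i => Measure.pi fun _ : Fin (B i) => D i)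
    (Z := fun i ξ => Y i ξ - M i) (fun i => (hYm i).sub (memLp_const (M i))) J 0
  simp only [zero_add] at hZ
  refine hZ.trans_le (ENNReal.ofReal_le_ofReal ?_)
  have h0 : ∀ i, ∫ ξ, (Y i ξ - M i) ∂(Measure.pi fun _ : Fin (B i) => D i) = 0 := fun i => by
    rw [integral_sub ((hYm i).integrable one_le_two) (integrable_const _), hYmean]
    simp
  simp_rw [h0]
  simp only [Finset.sum_const_zero, norm_zero, ne_eq, OfNat.ofNat_ne_zero, not_false_eq_true,
    zero_pow, zero_add, sub_zero]
  refine Finset.sum_le_sum fun i _ => ?_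
  have h1 := integral_norm_sub_integral_sq (hYm i)
  rw [hYmean] at h1
  have h2 : ∫ ξ, ‖Y i ξ‖ ^ 2 ∂(Measure.pi fun _ : Fin (B i) => D i)
      = (1 / (B i : ℝ)) ^ 2
        * ∫ ξ : Fin (B i) → Ξ i, ‖∑ j, h i (ξ j)‖ ^ 2 ∂(Measure.pi fun _ => D i) := by
    simp_rw [hY, norm_smul, mul_pow]
    rw [integral_const_mul, Real.norm_eq_abs, sq_abs]
  have h3 : ‖M i‖ ^ 2 = (1 / (B i : ℝ)) ^ 2
      * ‖∫ ξ : Fin (B i) → Ξ i, ∑ j, h i (ξ j) ∂(Measure.pi fun _ => D i)‖ ^ 2 := by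
    rw [← hYmean i, hY, integral_smul, norm_smul, mul_pow, Real.norm_eq_abs, sq_abs]
  have h4 := integral_norm_sub_integral_sq (hh i)
  have h5 := hσ i
  rw [h1, h2, h3, ← mul_sub, (hs i).2.2, ← h4]
  calc (1 / (B i : ℝ)) ^ 2 * (B i * ∫ ξ, ‖h i ξ - ∫ ξ', h i ξ' ∂(D i)‖ ^ 2 ∂(D i))
      = (∫ ξ, ‖h i ξ - ∫ ξ', h i ξ' ∂(D i)‖ ^ 2 ∂(D i)) / B i := by
        have := hB0 i
        field_simp
    _ ≤ σ i ^ 2 / B i := by gcongr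

/-- Mean-squared error of (partial sums of) the gradient estimators after one step from a given
state. -/
theorem lintegral_sum_error_step_le {f : Fin m → EuclideanSpace ℝ (Fin d) → ℝ}
    {g : ∀ i, EuclideanSpace ℝ (Fin d) → Ξ i → EuclideanSpace ℝ (Fin d)} {σ : Fin m → ℝ}
    (hg : HeterogeneousVariance D f g σ) {B : Fin m → ℕ} (hB : ∀ i, 1 ≤ B i) {b : ℕ}
    (p q : unitInterval) (hb : 0 < b) (hq : 0 < (q : ℝ)) (hqb : 1 - (q : ℝ) ≤ 1 / b)
    (W : Matrix (Fin m) (Fin m) ℝ) (η : ℝ) (R : ℕ) (S : State m d) (J : Finset (Fin m)) :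
    ∫⁻ ρ, ENNReal.ofReal (‖∑ i ∈ J, ((step (B := B) (b := b) g W η q R ρ S).y i
        - gradient (f i) (S.x i))‖ ^ 2) ∂(drawLaw D B b p q)
      ≤ ENNReal.ofReal (p * ∑ i ∈ J, σ i ^ 2 / B i
        + (1 - p) * (‖∑ i ∈ J, (S.y i - gradient (f i) (S.xPrev i))‖ ^ 2
          + ∑ i ∈ J, 1 / ((b : ℝ) * q) * ∫ ξ, ‖g i (S.x i) ξ - g i (S.xPrev i) ξ‖ ^ 2 ∂(D i))) := by
  have hb' : (0 : ℝ) < b := by exact_mod_cast hb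
  have hgm : ∀ i x, Measurable (g i x) := fun i x =>
    hg.measurable_apply i measurable_const measurable_id
  have hmeas : Measurable fun ρ : Draw Ξ B b =>
      ENNReal.ofReal (‖∑ i ∈ J, ((step (B := B) (b := b) g W η q R ρ S).y i
        - gradient (f i) (S.x i))‖ ^ 2) := by
    refine ENNReal.measurable_ofReal.comp (Measurable.pow_const (Measurable.norm ?_) 2)
    exact Finset.measurable_fun_sum _ fun i _ => ((measurableState_step hg W η q R measurable_id
      (S := fun _ => S) ⟨fun _ => measurable_const, fun _ => measurable_const,
        fun _ => measurable_const, fun _ => measurable_const⟩).y i).sub measurable_const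
  have hp0 : 0 ≤ (p : ℝ) := p.2.1
  have hp1 : 0 ≤ 1 - (p : ℝ) := sub_nonneg.2 p.2.2
  rw [drawLaw, lintegral_bernoulliMeasure_prod _ p hmeas]
  have hnn1 : 0 ≤ ∑ i ∈ J, σ i ^ 2 / (B i : ℝ) := Finset.sum_nonneg fun i _ => by positivity
  have hnn2 : 0 ≤ ∑ i ∈ J, 1 / ((b : ℝ) * q) * ∫ ξ, ‖g i (S.x i) ξ - g i (S.xPrev i) ξ‖ ^ 2 ∂(D i) :=
    Finset.sum_nonneg fun i _ => mul_nonneg (by positivity)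
      (integral_nonneg fun _ => by positivity)
  rw [ENNReal.ofReal_add (by positivity) (by positivity), ENNReal.ofReal_mul hp0,
    ENNReal.ofReal_mul hp1]
  gcongr ?_ + ?_
  · gcongr
    have hlarge := lintegral_largeBatch_le (h := fun i => g i (S.x i))
      (fun i => hg.memLp i (S.x i)) (σ := σ)
      (fun i => by rw [hg.unbiased]; exact hg.variance_le i (S.x i)) hB J
    simp_rw [hg.unbiased] at hlarge
    refine le_trans (le_of_eq ?_) hlarge
    have hmp : MeasurePreserving
        (fun z : (Fin m → Bool) × (∀ i, Fin (B i) → Ξ i) × (∀ i, Fin b → Ξ i) => z.2.1)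
        ((Measure.pi fun _ : Fin m => bernoulliMeasure true false q).prod
          ((Measure.pi fun i => Measure.pi fun _ : Fin (B i) => D i).prod
            (Measure.pi fun i => Measure.pi fun _ : Fin b => D i)))
        (Measure.pi fun i => Measure.pi fun _ : Fin (B i) => D i) :=
      measurePreserving_fst.comp measurePreserving_snd
    rw [← hmp.lintegral_comp]
    · rfl
    · refine ENNReal.measurable_ofReal.comp (Measurable.pow_const (Measurable.norm ?_) 2)
      refine Finset.measurable_fun_sum _ fun i _ => Measurable.sub ?_ measurable_const
      exact Measurable.fun_const_smul (Finset.measurable_fun_sum _ fun j _ =>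
        (hgm i _).comp (by fun_prop)) _
  · gcongr
    set h : ∀ i, Ξ i → EuclideanSpace ℝ (Fin d) :=
      fun i ξ => g i (S.x i) ξ - g i (S.xPrev i) ξ with hh
    have hhm : ∀ i, Measurable (h i) := fun i => (hgm i _).sub (hgm i _)
    have hhL : ∀ i, MemLp (h i) 2 (D i) := fun i => (hg.memLp i _).sub (hg.memLp i _)
    have hmean : ∀ i, ∫ ξ, h i ξ ∂(D i) = gradient (f i) (S.x i) - gradient (f i) (S.xPrev i) :=
      fun i => by
        rw [hh, integral_sub ((hg.memLp i _).integrable one_le_two)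
          ((hg.memLp i _).integrable one_le_two), hg.unbiased, hg.unbiased]
    set a : ℝ := 1 / ((b : ℝ) * q) with ha
    have hmini := lintegral_minibatch_eq hhm hhL b q a J
      (∑ i ∈ J, (S.y i - gradient (f i) (S.x i)))
    have hqab : (q : ℝ) * a * b = 1 := by rw [ha]; field_simp
    have hmp : MeasurePreserving
        (fun z : (Fin m → Bool) × (∀ i, Fin (B i) → Ξ i) × (∀ i, Fin b → Ξ i) => (z.1, z.2.2))
        ((Measure.pi fun _ : Fin m => bernoulliMeasure true false q).prod
          ((Measure.pi fun i => Measure.pi fun _ : Fin (B i) => D i).prod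
            (Measure.pi fun i => Measure.pi fun _ : Fin b => D i)))
        ((Measure.pi fun _ : Fin m => bernoulliMeasure true false q).prod
          (Measure.pi fun i => Measure.pi fun _ : Fin b => D i)) :=
      (MeasurePreserving.id _).prod measurePreserving_snd
    rw [← hmp.lintegral_comp] at hmini
    · have heq : ∀ z : (Fin m → Bool) × (∀ i, Fin (B i) → Ξ i) × (∀ i, Fin b → Ξ i),
          ∑ i ∈ J, ((step (B := B) (b := b) g W η q R (false, z) S).y i - gradient (f i) (S.x i))
          = ∑ i ∈ J, (S.y i - gradient (f i) (S.x i))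
            + ∑ i ∈ J, (if z.1 i then a • ∑ j, h i (z.2.2 i j) else 0) := by
        intro z
        rw [← Finset.sum_add_distrib]
        refine Finset.sum_congr rfl fun i _ => ?_
        by_cases hz : z.1 i
        · simp only [step, Bool.false_eq_true, if_false, hz, if_true, hh, ha]; abel
        · simp only [step, Bool.false_eq_true, if_false, hz, add_zero]
      simp_rw [heq]
      refine hmini.trans_le (ENNReal.ofReal_le_ofReal ?_)
      gcongr ?_ + ?_
      -- Since `q * a * b = 1` the correction is unbiased, and the mean of the new error is the old
      -- error.
      · refine le_of_eq ?_
        rw [← Finset.sum_add_distrib]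
        congr 2
        refine Finset.sum_congr rfl fun i _ => ?_
        rw [hqab, one_smul, hmean]; abel
      · refine Finset.sum_le_sum fun i _ => ?_
        set V : ℝ := ∫ ξ, ‖h i ξ‖ ^ 2 ∂(D i) with hV
        set N : ℝ := ‖∫ ξ, h i ξ ∂(D i)‖ ^ 2 with hN
        have hN0 : 0 ≤ N := by positivity
        -- The sampling variance contributes `a * (V - N)` and the coins `(1 - q) * b * a * N`. As
        -- `1 - q ≤ 1 / b`, the latter is at most `a * N`, so skipping costs nothing beyond `a * V`.
        have e1 : (q : ℝ) * a ^ 2 * b = a := by linear_combination a * hqab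
        have e2 : (q : ℝ) * (1 - q) * (a * b) ^ 2 = (1 - q) * b * a := by
          linear_combination (1 - (q : ℝ)) * b * e1
        have e3 : (1 - (q : ℝ)) * b ≤ 1 := by
          rwa [le_div_iff₀ hb'] at hqb
        have ha0 : 0 ≤ a := by rw [ha]; positivity
        rw [e1, e2]
        nlinarith [mul_nonneg ha0 hN0]
    · refine ENNReal.measurable_ofReal.comp (Measurable.pow_const (Measurable.norm ?_) 2)
      refine measurable_const.add (Finset.measurable_fun_sum _ fun i _ => ?_)
      refine Measurable.ite ?_ ?_ measurable_const
      · exact (measurableSet_singleton true).preimage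
          ((measurable_pi_apply i).comp measurable_fst)
      · exact Measurable.fun_const_smul (Finset.measurable_fun_sum _ fun j _ =>
          (hhm i).comp (by fun_prop)) a

theorem lintegral_sum_error_initState_le {f : Fin m → EuclideanSpace ℝ (Fin d) → ℝ}
    {g : ∀ i, EuclideanSpace ℝ (Fin d) → Ξ i → EuclideanSpace ℝ (Fin d)} {σ : Fin m → ℝ}
    (hg : HeterogeneousVariance D f g σ) {B : Fin m → ℕ} (hB : ∀ i, 1 ≤ B i) {b : ℕ}
    (p q : unitInterval) (x0 : EuclideanSpace ℝ (Fin d)) (J : Finset (Fin m)) :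
    ∫⁻ ρ : Draw Ξ B b, ENNReal.ofReal (‖∑ i ∈ J, (largeBatchGrad g ρ i x0
        - gradient (f i) x0)‖ ^ 2) ∂(drawLaw D B b p q)
      ≤ ENNReal.ofReal (∑ i ∈ J, σ i ^ 2 / B i) := by
  have hlarge := lintegral_largeBatch_le (h := fun i => g i x0)
    (fun i => hg.memLp i x0) (σ := σ)
    (fun i => by rw [hg.unbiased]; exact hg.variance_le i x0) hB J
  simp_rw [hg.unbiased] at hlarge
  refine le_trans (le_of_eq ?_) hlarge
  have hmp : MeasurePreserving (fun ρ : Draw Ξ B b => ρ.2.2.1) (drawLaw D B b p q)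
      (Measure.pi fun i => Measure.pi fun _ : Fin (B i) => D i) :=
    measurePreserving_fst.comp (measurePreserving_snd.comp measurePreserving_snd)
  rw [← hmp.lintegral_comp]
  · rfl
  · refine ENNReal.measurable_ofReal.comp (Measurable.pow_const (Measurable.norm ?_) 2)
    refine Finset.measurable_fun_sum _ fun i _ => Measurable.sub ?_ measurable_const
    exact Measurable.fun_const_smul (Finset.measurable_fun_sum _ fun j _ =>
      hg.measurable_apply i measurable_const (by fun_prop)) _

end OneStep

/-! ### Averages and deviations -/

section Deviation

variable {m d : ℕ}

theorem norm_add_sq_le_two {F : Type*} [SeminormedAddCommGroup F] (a b : F) :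
    ‖a + b‖ ^ 2 ≤ 2 * ‖a‖ ^ 2 + 2 * ‖b‖ ^ 2 := by
  have h := norm_add_le a b
  nlinarith [norm_nonneg (a + b), sq_nonneg (‖a‖ - ‖b‖), norm_nonneg a, norm_nonneg b]

theorem norm_add_add_sq_le_three {F : Type*} [SeminormedAddCommGroup F] (a b c : F) :
    ‖a + b + c‖ ^ 2 ≤ 3 * (‖a‖ ^ 2 + ‖b‖ ^ 2 + ‖c‖ ^ 2) := by
  have h := norm_add₃_le (a := a) (b := b) (c := c)
  have h2 : ‖a + b + c‖ ^ 2 ≤ (‖a‖ + ‖b‖ + ‖c‖) ^ 2 := by gcongr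
  nlinarith [sq_nonneg (‖a‖ - ‖b‖), sq_nonneg (‖a‖ - ‖c‖), sq_nonneg (‖b‖ - ‖c‖)]

theorem norm_sum_sq_le (φ : Fin m → EuclideanSpace ℝ (Fin d)) :
    ‖∑ i, φ i‖ ^ 2 ≤ m * ∑ i, ‖φ i‖ ^ 2 := by
  have h1 : ‖∑ i, φ i‖ ^ 2 ≤ (∑ i, ‖φ i‖) ^ 2 := by
    gcongr; exact norm_sum_le _ _
  have h2 := sq_sum_le_card_mul_sum_sq (s := Finset.univ) (f := fun i => ‖φ i‖)
  simp only [Finset.card_univ, Fintype.card_fin] at h2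
  exact h1.trans h2

theorem norm_avg_sq (φ : Fin m → EuclideanSpace ℝ (Fin d)) :
    ‖avg φ‖ ^ 2 = 1 / (m : ℝ) ^ 2 * ‖∑ i, φ i‖ ^ 2 := by
  rw [avg, norm_smul, mul_pow, Real.norm_eq_abs, sq_abs, one_div_pow]

theorem norm_avg_sq_le (φ : Fin m → EuclideanSpace ℝ (Fin d)) :
    ‖avg φ‖ ^ 2 ≤ 1 / (m : ℝ) * ∑ i, ‖φ i‖ ^ 2 := by
  rcases Nat.eq_zero_or_pos m with rfl | hm
  · simp [avg]
  · rw [norm_avg_sq]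
    have := norm_sum_sq_le φ
    have hm' : (0 : ℝ) < m := by exact_mod_cast hm
    calc 1 / (m : ℝ) ^ 2 * ‖∑ i, φ i‖ ^ 2 ≤ 1 / (m : ℝ) ^ 2 * (m * ∑ i, ‖φ i‖ ^ 2) := by gcongr
      _ = 1 / (m : ℝ) * ∑ i, ‖φ i‖ ^ 2 := by field_simp

theorem deviation_nonneg (φ : Fin m → EuclideanSpace ℝ (Fin d)) : 0 ≤ deviation φ :=
  Finset.sum_nonneg fun _ _ => by positivity

theorem norm_sub_avg_sq_le (φ : Fin m → EuclideanSpace ℝ (Fin d)) (i : Fin m) :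
    ‖φ i - avg φ‖ ^ 2 ≤ deviation φ :=
  Finset.single_le_sum (f := fun i => ‖φ i - avg φ‖ ^ 2) (fun _ _ => by positivity)
    (Finset.mem_univ i)

theorem deviation_add_le (φ ψ : Fin m → EuclideanSpace ℝ (Fin d)) :
    deviation (fun i => φ i + ψ i) ≤ 2 * deviation φ + 2 * deviation ψ := by
  unfold deviation
  rw [avg_add, Finset.mul_sum, Finset.mul_sum, ← Finset.sum_add_distrib]
  refine Finset.sum_le_sum fun i _ => ?_
  rw [add_sub_add_comm]
  exact norm_add_sq_le_two _ _

theorem deviation_smul (a : ℝ) (φ : Fin m → EuclideanSpace ℝ (Fin d)) :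
    deviation (fun i => a • φ i) = a ^ 2 * deviation φ := by
  unfold deviation
  rw [avg_smul, Finset.mul_sum]
  refine Finset.sum_congr rfl fun i _ => ?_
  rw [← smul_sub, norm_smul, mul_pow, Real.norm_eq_abs, sq_abs]

theorem deviation_le_sum_sq (hm : 0 < m) (φ : Fin m → EuclideanSpace ℝ (Fin d)) :
    deviation φ ≤ ∑ i, ‖φ i‖ ^ 2 := by
  have hm' : (0 : ℝ) < m := by exact_mod_cast hm
  have h1 : deviation φ = ∑ i, ‖φ i‖ ^ 2 - m * ‖avg φ‖ ^ 2 := by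
    unfold deviation
    simp_rw [norm_sub_sq_real, Finset.sum_add_distrib, Finset.sum_sub_distrib, ← Finset.mul_sum,
      ← sum_inner]
    have : ∑ i, φ i = (m : ℝ) • avg φ := by
      rw [avg, smul_smul, mul_one_div_cancel hm'.ne', one_smul]
    rw [this, real_inner_smul_left, real_inner_self_eq_norm_sq]
    simp
    ring
  rw [h1]
  have : 0 ≤ (m : ℝ) * ‖avg φ‖ ^ 2 := by positivity
  linarith

theorem deviation_const (hm : 0 < m) (c : EuclideanSpace ℝ (Fin d)) :
    deviation (fun _ : Fin m => c) = 0 := by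
  unfold deviation
  rw [avg_const hm]
  simp

end Deviation

/-! ### Smoothness -/

section Smoothness

variable {m d : ℕ} {Ξ : Fin m → Type*} [∀ i, MeasurableSpace (Ξ i)]
  {D : ∀ i, Measure (Ξ i)} {f : Fin m → EuclideanSpace ℝ (Fin d) → ℝ}
  {g : ∀ i, EuclideanSpace ℝ (Fin d) → Ξ i → EuclideanSpace ℝ (Fin d)} {σ : Fin m → ℝ} {L : ℝ}

/-- One node may carry the whole average, hence the factor `m`. The accuracy of FastMix compensates
for it later. -/
theorem MeanSquaredSmooth.integral_le (hL : MeanSquaredSmooth D g L)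
    (i : Fin m) (x y : EuclideanSpace ℝ (Fin d)) :
    ∫ ξ, ‖g i x ξ - g i y ξ‖ ^ 2 ∂(D i) ≤ m * L ^ 2 * ‖x - y‖ ^ 2 := by
  have hm : (0 : ℝ) < m := by exact_mod_cast i.pos
  have h := hL.smooth x y
  have h1 : ∫ ξ, ‖g i x ξ - g i y ξ‖ ^ 2 ∂(D i) ≤ ∑ i, ∫ ξ, ‖g i x ξ - g i y ξ‖ ^ 2 ∂(D i) :=
    Finset.single_le_sum (f := fun i => ∫ ξ, ‖g i x ξ - g i y ξ‖ ^ 2 ∂(D i))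
      (fun _ _ => integral_nonneg fun _ => by positivity) (Finset.mem_univ i)
  rw [one_div, inv_mul_le_iff₀ hm] at h
  linarith

/-- Go from `x i` to `y i` through the two averages. On the middle leg all nodes share the same pair
of points, so averaged smoothness applies as it stands; the crude single-node constant is used only
on the outer legs, which are consensus errors. -/
theorem sum_integral_norm_sub_sq_le
    (hg : HeterogeneousVariance D f g σ) (hL : MeanSquaredSmooth D g L) (hm : 0 < m)
    (x y : Fin m → EuclideanSpace ℝ (Fin d)) :
    ∑ i, ∫ ξ, ‖g i (x i) ξ - g i (y i) ξ‖ ^ 2 ∂(D i)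
      ≤ 3 * m * L ^ 2 * (deviation x + deviation y + ‖avg x - avg y‖ ^ 2) := by
  have hm' : (0 : ℝ) < m := by exact_mod_cast hm
  have hint : ∀ i (u v : EuclideanSpace ℝ (Fin d)),
      Integrable (fun ξ => ‖g i u ξ - g i v ξ‖ ^ 2) (D i) := fun i u v =>
    ((hg.memLp i u).sub (hg.memLp i v)).integrable_norm_pow (p := 2) (by norm_num)
  have h1 : ∀ i, ∫ ξ, ‖g i (x i) ξ - g i (y i) ξ‖ ^ 2 ∂(D i)
      ≤ 3 * (m * L ^ 2 * ‖x i - avg x‖ ^ 2 + m * L ^ 2 * ‖y i - avg y‖ ^ 2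
        + ∫ ξ, ‖g i (avg x) ξ - g i (avg y) ξ‖ ^ 2 ∂(D i)) := by
    intro i
    have e : ∫ ξ, ‖g i (x i) ξ - g i (y i) ξ‖ ^ 2 ∂(D i)
        ≤ ∫ ξ, 3 * (‖g i (x i) ξ - g i (avg x) ξ‖ ^ 2 + ‖g i (avg y) ξ - g i (y i) ξ‖ ^ 2
          + ‖g i (avg x) ξ - g i (avg y) ξ‖ ^ 2) ∂(D i) := by
      refine integral_mono (hint i _ _)
        ((((hint i _ _).add (hint i _ _)).add (hint i _ _)).const_mul 3) fun ξ => ?_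
      have := norm_add_add_sq_le_three (g i (x i) ξ - g i (avg x) ξ)
        (g i (avg y) ξ - g i (y i) ξ) (g i (avg x) ξ - g i (avg y) ξ)
      rwa [show g i (x i) ξ - g i (avg x) ξ + (g i (avg y) ξ - g i (y i) ξ)
        + (g i (avg x) ξ - g i (avg y) ξ) = g i (x i) ξ - g i (y i) ξ by abel] at this
    refine e.trans ?_
    have hadd : Integrable (fun ξ => ‖g i (x i) ξ - g i (avg x) ξ‖ ^ 2
        + ‖g i (avg y) ξ - g i (y i) ξ‖ ^ 2) (D i) := (hint i _ _).add (hint i _ _)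
    rw [integral_const_mul, integral_add hadd (hint i _ _), integral_add (hint i _ _) (hint i _ _)]
    have e1 := hL.integral_le i (x i) (avg x)
    have e2 := hL.integral_le i (avg y) (y i)
    rw [norm_sub_rev (avg y)] at e2
    linarith
  refine (Finset.sum_le_sum fun i _ => h1 i).trans ?_
  rw [← Finset.mul_sum, Finset.sum_add_distrib, Finset.sum_add_distrib, ← Finset.mul_sum,
    ← Finset.mul_sum]
  have h2 := hL.smooth (avg x) (avg y)
  rw [one_div, inv_mul_le_iff₀ hm'] at h2
  unfold deviation
  linarith

variable [∀ i, IsProbabilityMeasure (D i)]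

theorem HeterogeneousVariance.norm_gradient_sub_sq_le (hg : HeterogeneousVariance D f g σ)
    (i : Fin m) (x y : EuclideanSpace ℝ (Fin d)) :
    ‖gradient (f i) x - gradient (f i) y‖ ^ 2 ≤ ∫ ξ, ‖g i x ξ - g i y ξ‖ ^ 2 ∂(D i) := by
  have h := norm_integral_sq_le ((hg.memLp i x).sub (hg.memLp i y))
  have h2 : ∫ ξ, (g i x - g i y) ξ ∂(D i) = gradient (f i) x - gradient (f i) y := by
    rw [integral_sub' ((hg.memLp i x).integrable one_le_two)
      ((hg.memLp i y).integrable one_le_two), hg.unbiased, hg.unbiased]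
  rw [h2] at h
  exact h

theorem norm_gradient_sub_sq_le (hg : HeterogeneousVariance D f g σ)
    (hL : MeanSquaredSmooth D g L) (i : Fin m) (x y : EuclideanSpace ℝ (Fin d)) :
    ‖gradient (f i) x - gradient (f i) y‖ ^ 2 ≤ m * L ^ 2 * ‖x - y‖ ^ 2 :=
  (hg.norm_gradient_sub_sq_le i x y).trans (hL.integral_le i x y)

theorem norm_gradient_sub_le (hg : HeterogeneousVariance D f g σ)
    (hL : MeanSquaredSmooth D g L) (i : Fin m) (x y : EuclideanSpace ℝ (Fin d)) :
    ‖gradient (f i) x - gradient (f i) y‖ ≤ Real.sqrt (m * L ^ 2) * ‖x - y‖ := by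
  refine le_of_sq_le_sq ?_ (by positivity)
  rw [mul_pow, Real.sq_sqrt (by positivity)]
  exact norm_gradient_sub_sq_le hg hL i x y

theorem continuous_gradient (hg : HeterogeneousVariance D f g σ)
    (hL : MeanSquaredSmooth D g L) (i : Fin m) : Continuous (gradient (f i)) := by
  refine (LipschitzWith.of_dist_le_mul (K := Real.toNNReal (Real.sqrt (m * L ^ 2)))
    fun x y => ?_).continuous
  rw [dist_eq_norm, dist_eq_norm, Real.coe_toNNReal _ (Real.sqrt_nonneg _)]
  exact norm_gradient_sub_le hg hL i x y

theorem hasGradientAt_avgFun (hf : ∀ i, Differentiable ℝ (f i)) (x : EuclideanSpace ℝ (Fin d)) :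
    HasGradientAt (avgFun f) (avg fun i => gradient (f i) x) x := by
  rw [hasGradientAt_iff_hasFDerivAt]
  have h : HasFDerivAt (fun x => ∑ i, f i x)
      (∑ i, (InnerProductSpace.toDual ℝ _) (gradient (f i) x)) x :=
    HasFDerivAt.fun_sum fun i _ => ((hf i) x).hasGradientAt.hasFDerivAt
  have h2 := h.const_mul (1 / (m : ℝ))
  have h3 : InnerProductSpace.toDual ℝ (EuclideanSpace ℝ (Fin d)) (avg fun i => gradient (f i) x)
      = (1 / (m : ℝ)) • ∑ i, (InnerProductSpace.toDual ℝ _) (gradient (f i) x) := by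
    simp [avg]
  rw [h3]
  exact h2

theorem gradient_avgFun (hf : ∀ i, Differentiable ℝ (f i)) (x : EuclideanSpace ℝ (Fin d)) :
    gradient (avgFun f) x = avg fun i => gradient (f i) x :=
  (hasGradientAt_avgFun hf x).gradient

/-- Jensen over the nodes and over the samples: the average objective keeps the constant `L`, with
no factor `√m`. -/
theorem norm_gradient_avgFun_sub_sq_le (hf : ∀ i, Differentiable ℝ (f i))
    (hg : HeterogeneousVariance D f g σ) (hL : MeanSquaredSmooth D g L)
    (x y : EuclideanSpace ℝ (Fin d)) :
    ‖gradient (avgFun f) x - gradient (avgFun f) y‖ ^ 2 ≤ L ^ 2 * ‖x - y‖ ^ 2 := by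
  rw [gradient_avgFun hf, gradient_avgFun hf, ← avg_sub]
  refine (norm_avg_sq_le _).trans (le_trans ?_ (hL.smooth x y))
  gcongr with i
  exact hg.norm_gradient_sub_sq_le i x y

theorem norm_gradient_avgFun_sub_le (hf : ∀ i, Differentiable ℝ (f i))
    (hg : HeterogeneousVariance D f g σ) (hL : MeanSquaredSmooth D g L)
    (x y : EuclideanSpace ℝ (Fin d)) :
    ‖gradient (avgFun f) x - gradient (avgFun f) y‖ ≤ L * ‖x - y‖ := by
  refine le_of_sq_le_sq ?_ (mul_nonneg hL.const_pos.le (norm_nonneg _))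
  rw [mul_pow]
  exact norm_gradient_avgFun_sub_sq_le hf hg hL x y

/-- The descent lemma for a function with Lipschitz gradient. -/
theorem descent_of_lipschitz_gradient {F : EuclideanSpace ℝ (Fin d) → ℝ}
    (hF : ∀ x, HasGradientAt F (gradient F x) x)
    (hlip : ∀ x y, ‖gradient F x - gradient F y‖ ≤ L * ‖x - y‖)
    (x v : EuclideanSpace ℝ (Fin d)) :
    F (x + v) ≤ F x + inner ℝ (gradient F x) v + L / 2 * ‖v‖ ^ 2 := by
  -- `F` along the segment minus its quadratic model; Cauchy–Schwarz and the Lipschitz bound make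
  -- the derivative nonpositive.
  set φ : ℝ → ℝ := fun t => F (x + t • v) - t * inner ℝ (gradient F x) v
    - L / 2 * t ^ 2 * ‖v‖ ^ 2 with hφ
  have hderiv : ∀ t, HasDerivAt φ (inner ℝ (gradient F (x + t • v)) v
      - inner ℝ (gradient F x) v - L * t * ‖v‖ ^ 2) t := by
    intro t
    have h1 : HasDerivAt (fun t : ℝ => x + t • v) v t := by
      simpa using ((hasDerivAt_id t).smul_const v).const_add x
    have h2 := (hF (x + t • v)).hasFDerivAt.comp_hasDerivAt t h1
    have h3 := (hasDerivAt_id t).mul_const (inner ℝ (gradient F x) v)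
    have h4 := (((hasDerivAt_id t).pow 2).const_mul (L / 2)).mul_const (‖v‖ ^ 2)
    refine ((h2.sub h3).sub h4).congr_deriv ?_
    simp
    left
    ring
  have hanti : AntitoneOn φ (Set.Icc 0 1) := by
    refine antitoneOn_of_deriv_nonpos (convex_Icc 0 1)
      (fun t _ => (hderiv t).continuousAt.continuousWithinAt)
      (fun t _ => (hderiv t).differentiableAt.differentiableWithinAt) fun t ht => ?_
    rw [interior_Icc] at ht
    rw [(hderiv t).deriv, ← inner_sub_left]
    have h1 := real_inner_le_norm (gradient F (x + t • v) - gradient F x) v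
    have h2 := hlip (x + t • v) x
    rw [add_sub_cancel_left, norm_smul, Real.norm_eq_abs, abs_of_pos ht.1] at h2
    have h3 := mul_le_mul_of_nonneg_right h2 (norm_nonneg v)
    nlinarith
  have h := hanti (Set.left_mem_Icc.2 zero_le_one) (Set.right_mem_Icc.2 zero_le_one) zero_le_one
  simp only [hφ, one_smul, zero_smul, add_zero] at h
  linarith

/-- The inner product in the descent lemma is polarised, so that a negative multiple of `‖s‖ ^ 2`
survives to offset the variance. -/
theorem avgFun_step_le (hf : ∀ i, Differentiable ℝ (f i))
    (hg : HeterogeneousVariance D f g σ) (hL : MeanSquaredSmooth D g L) (η : ℝ)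
    (x s : EuclideanSpace ℝ (Fin d)) :
    avgFun f (x - η • s) ≤ avgFun f x - η / 2 * ‖gradient (avgFun f) x‖ ^ 2
      - (η / 2 - L * η ^ 2 / 2) * ‖s‖ ^ 2 + η / 2 * ‖s - gradient (avgFun f) x‖ ^ 2 := by
  have h := descent_of_lipschitz_gradient
    (fun x => (hasGradientAt_avgFun hf x).differentiableAt.hasGradientAt)
    (norm_gradient_avgFun_sub_le hf hg hL) x (-(η • s))
  rw [← sub_eq_add_neg, inner_neg_right, real_inner_smul_right, norm_neg, norm_smul, mul_pow,
    Real.norm_eq_abs, sq_abs] at h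
  rw [norm_sub_sq_real, real_inner_comm]
  linarith

/-- Estimation error at the local points plus displacement of those points from their mean.
Averaging over nodes cancels the factor `m` of the single-node constant. -/
theorem norm_avg_sub_gradient_sq_le (hf : ∀ i, Differentiable ℝ (f i))
    (hg : HeterogeneousVariance D f g σ) (hL : MeanSquaredSmooth D g L) (hm : 0 < m)
    (x y : Fin m → EuclideanSpace ℝ (Fin d)) :
    ‖avg y - gradient (avgFun f) (avg x)‖ ^ 2
      ≤ 2 / (m : ℝ) ^ 2 * ‖∑ i, (y i - gradient (f i) (x i))‖ ^ 2
        + 2 * L ^ 2 * deviation x := by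
  have hm' : (0 : ℝ) < m := by exact_mod_cast hm
  have h1 : avg y - gradient (avgFun f) (avg x) = avg (fun i => y i - gradient (f i) (x i))
      + avg (fun i => gradient (f i) (x i) - gradient (f i) (avg x)) := by
    rw [gradient_avgFun hf, avg_sub, avg_sub]; abel
  have h2 := norm_avg_sq_le (fun i => gradient (f i) (x i) - gradient (f i) (avg x))
  have h3 : 1 / (m : ℝ) * ∑ i, ‖gradient (f i) (x i) - gradient (f i) (avg x)‖ ^ 2
      ≤ 1 / (m : ℝ) * ∑ i, m * L ^ 2 * ‖x i - avg x‖ ^ 2 := by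
    gcongr with i
    exact norm_gradient_sub_sq_le hg hL i _ _
  have h4 : 1 / (m : ℝ) * ∑ i, m * L ^ 2 * ‖x i - avg x‖ ^ 2 = L ^ 2 * deviation x := by
    rw [← Finset.mul_sum, deviation]; field_simp
  rw [h1]
  refine (norm_add_sq_le_two _ _).trans ?_
  rw [norm_avg_sq]
  have h5 : 2 * (1 / (m : ℝ) ^ 2 * ‖∑ i, (y i - gradient (f i) (x i))‖ ^ 2)
    = 2 / (m : ℝ) ^ 2 * ‖∑ i, (y i - gradient (f i) (x i))‖ ^ 2 := by ring
  linarith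

end Smoothness

/-! ### The random states of a run -/

section Run

variable {m d : ℕ} {Ξ : Fin m → Type*}
  {f : Fin m → EuclideanSpace ℝ (Fin d) → ℝ}
  {g : ∀ i, EuclideanSpace ℝ (Fin d) → Ξ i → EuclideanSpace ℝ (Fin d)} {σ : Fin m → ℝ} {L : ℝ}
  {G : SimpleGraph (Fin m)} {W : Matrix (Fin m) (Fin m) ℝ} {B : Fin m → ℕ} {b : ℕ}
  {p q : unitInterval}

theorem stateAfter_congr {η q : ℝ} {x0 : EuclideanSpace ℝ (Fin d)} {R : ℕ → ℕ}
    {r r' : ℕ → Draw Ξ B b} (t : ℕ) (h : ∀ s ≤ t, r s = r' s) :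
    stateAfter g W η q x0 R r t = stateAfter g W η q x0 R r' t := by
  induction t with
  | zero => simp only [stateAfter, h 0 le_rfl]
  | succ t ih =>
    simp only [stateAfter, h (t + 1) le_rfl, ih fun s hs => h s (hs.trans t.le_succ)]

variable [∀ i, MeasurableSpace (Ξ i)] {D : ∀ i, Measure (Ξ i)}

theorem measurableState_stateAfter (hg : HeterogeneousVariance D f g σ) (η q : ℝ)
    (x0 : EuclideanSpace ℝ (Fin d)) (R : ℕ → ℕ) {A : Type*} [MeasurableSpace A]
    {r : ℕ → A → Draw Ξ B b} (hr : ∀ t, Measurable (r t)) (t : ℕ) :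
    MeasurableState fun a => stateAfter g W η q x0 R (fun t => r t a) t := by
  induction t with
  | zero => exact measurableState_initState hg W η x0 (R 0) (hr 0)
  | succ t ih => exact measurableState_step hg W η q (R (t + 1)) (hr (t + 1)) ih

/-- The variables of a state as a tuple. -/
abbrev StateTuple (m d : ℕ) :=
  (Fin m → EuclideanSpace ℝ (Fin d)) × (Fin m → EuclideanSpace ℝ (Fin d)) ×
    (Fin m → EuclideanSpace ℝ (Fin d)) × (Fin m → EuclideanSpace ℝ (Fin d))

/-- The tuple of a state. -/
def State.toTuple (S : State m d) : StateTuple m d := (S.xPrev, S.x, S.y, S.s)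

/-- The state with a given tuple of variables. -/
def State.ofTuple (z : StateTuple m d) : State m d := ⟨z.1, z.2.1, z.2.2.1, z.2.2.2⟩

theorem measurableState_ofTuple {A : Type*} [MeasurableSpace A] {u : A → StateTuple m d}
    (hu : Measurable u) : MeasurableState fun a => State.ofTuple (u a) :=
  ⟨fun i => (measurable_pi_apply i).comp (measurable_fst.comp hu),
   fun i => (measurable_pi_apply i).comp (measurable_fst.comp (measurable_snd.comp hu)),
   fun i => (measurable_pi_apply i).comp (measurable_fst.comp (measurable_snd.comp
     (measurable_snd.comp hu))),
   fun i => (measurable_pi_apply i).comp (measurable_snd.comp (measurable_snd.comp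
     (measurable_snd.comp hu)))⟩

theorem MeasurableState.measurable_toTuple {A : Type*} [MeasurableSpace A] {S : A → State m d}
    (hS : MeasurableState S) : Measurable fun a => (S a).toTuple :=
  (measurable_pi_lambda _ hS.xPrev).prodMk ((measurable_pi_lambda _ hS.x).prodMk
    ((measurable_pi_lambda _ hS.y).prodMk (measurable_pi_lambda _ hS.s)))

variable {Ω : Type*} [MeasurableSpace Ω] {P : Measure Ω} {r : ℕ → Ω → Draw Ξ B b}

/-- The standing assumptions on the problem, the network, the batches and the draws. -/
structure ValidRun (D : ∀ i, Measure (Ξ i)) (f : Fin m → EuclideanSpace ℝ (Fin d) → ℝ)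
    (g : ∀ i, EuclideanSpace ℝ (Fin d) → Ξ i → EuclideanSpace ℝ (Fin d)) (σ : Fin m → ℝ)
    (L : ℝ) (G : SimpleGraph (Fin m)) (W : Matrix (Fin m) (Fin m) ℝ) (p q : unitInterval)
    (P : Measure Ω) (r : ℕ → Ω → Draw Ξ B b) : Prop where
  pos : 0 < m
  diff : ∀ i, Differentiable ℝ (f i)
  var : HeterogeneousVariance D f g σ
  smooth : MeanSquaredSmooth D g L
  mixing : AdmissibleMixing G W
  largeBatch_pos : ∀ i, 1 ≤ B i
  miniBatch_pos : 0 < b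
  prob_pos : 0 < (q : ℝ)
  one_sub_prob_le : 1 - (q : ℝ) ≤ 1 / b
  measurable_draw : ∀ t, Measurable (r t)
  draw_law : ∀ t, P.map (r t) = drawLaw D B b p q
  draw_indep : iIndepFun r P

/-- The state of a run after iteration `t`. -/
noncomputable def runState (g : ∀ i, EuclideanSpace ℝ (Fin d) → Ξ i → EuclideanSpace ℝ (Fin d))
    (W : Matrix (Fin m) (Fin m) ℝ) (η : ℝ) (q : unitInterval) (x0 : EuclideanSpace ℝ (Fin d))
    (R : ℕ → ℕ) (r : ℕ → Ω → Draw Ξ B b) (t : ℕ) (w : Ω) : State m d :=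
  stateAfter g W η q x0 R (fun t => r t w) t

variable {η : ℝ} {x0 : EuclideanSpace ℝ (Fin d)} {R : ℕ → ℕ}

theorem ValidRun.measurableState (h : ValidRun D f g σ L G W p q P r) (t : ℕ) :
    MeasurableState (runState g W η q x0 R r t) :=
  measurableState_stateAfter h.var η q x0 R h.measurable_draw t

/-- The state after iteration `t` is a measurable function of the draws `0, …, t`. -/
theorem ValidRun.indepFun_runState (h : ValidRun D f g σ L G W p q P r) (t : ℕ) :
    IndepFun (fun w => (runState g W η q x0 R r t w).toTuple) (r (t + 1)) P := by
  classical
  have h1 := h.draw_indep.indepFun_finset (Finset.range (t + 1)) {t + 1}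
    (by simp) h.measurable_draw
  -- A finite history is padded to a full sequence by repeating its first draw; the padding is never
  -- read, by `stateAfter_congr`.
  set ext : ((i : Finset.range (t + 1)) → Draw Ξ B b) → ℕ → Draw Ξ B b :=
    fun ρ s => if hs : s ∈ Finset.range (t + 1) then ρ ⟨s, hs⟩ else ρ ⟨0, by simp⟩ with hext
  have hm : ∀ s, Measurable fun ρ => ext ρ s := by
    intro s
    by_cases hs : s ∈ Finset.range (t + 1)
    · simp only [hext, hs, dif_pos]; exact measurable_pi_apply _
    · simp only [hext, hs, dif_neg, not_false_eq_true]; exact measurable_pi_apply _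
  have hψ : Measurable fun ρ : ({t + 1} : Finset ℕ) → Draw Ξ B b => ρ ⟨t + 1, by simp⟩ :=
    measurable_pi_apply _
  have h2 := h1.comp (φ := fun ρ => (stateAfter g W η q x0 R (ext ρ) t).toTuple)
    (measurableState_stateAfter h.var η q x0 R (r := fun s ρ => ext ρ s) hm t).measurable_toTuple
    hψ
  have e1 : (fun w => (runState g W η q x0 R r t w).toTuple)
      = (fun ρ => (stateAfter g W η q x0 R (ext ρ) t).toTuple) ∘
        fun w (i : Finset.range (t + 1)) => r i w := by
    ext1 w
    simp only [Function.comp_apply, runState]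
    congr 1
    refine stateAfter_congr t fun s hs => ?_
    simp [hext, hs]
  rw [e1]
  exact h2

theorem lintegral_comp_of_indepFun {U V : Type*} [MeasurableSpace U] [MeasurableSpace V]
    [IsFiniteMeasure P] {X : Ω → U} {Y : Ω → V} (hXY : IndepFun X Y P) (hX : Measurable X)
    (hY : Measurable Y) {K : U × V → ENNReal} (hK : Measurable K) :
    ∫⁻ w, K (X w, Y w) ∂P = ∫⁻ w, ∫⁻ v, K (X w, v) ∂(P.map Y) ∂P := by
  have h1 := (indepFun_iff_map_prod_eq_prod_map_map hX.aemeasurable hY.aemeasurable).1 hXY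
  rw [← lintegral_map (f := K) hK (hX.prodMk hY), h1, lintegral_prod _ hK.aemeasurable,
    lintegral_map hK.lintegral_prod_right' hX]

/-- Conditional expectation given the past, for functions of the state and the next draws. -/
theorem ValidRun.lintegral_step (h : ValidRun D f g σ L G W p q P r) [IsFiniteMeasure P] (t : ℕ)
    {K : Draw Ξ B b → State m d → ENNReal}
    (hK : Measurable fun z : StateTuple m d × Draw Ξ B b => K z.2 (State.ofTuple z.1)) :
    ∫⁻ w, K (r (t + 1) w) (runState g W η q x0 R r t w) ∂P
      = ∫⁻ w, ∫⁻ ρ, K ρ (runState g W η q x0 R r t w) ∂(drawLaw D B b p q) ∂P := by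
  rw [← h.draw_law (t + 1)]
  exact lintegral_comp_of_indepFun (h.indepFun_runState t)
    (h.measurableState t).measurable_toTuple (h.measurable_draw _) hK

/-! ### Second moments of the states -/

/-- Integrability comes out together with the bound, which is how second moments propagate along the
run without being assumed. -/
theorem integrable_and_integral_le_of_lintegral_le {F H : Ω → ℝ} (hF : Measurable F)
    (hF0 : ∀ w, 0 ≤ F w) (hH : Integrable H P) (hH0 : ∀ w, 0 ≤ H w)
    (hle : ∫⁻ w, ENNReal.ofReal (F w) ∂P ≤ ∫⁻ w, ENNReal.ofReal (H w) ∂P) :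
    Integrable F P ∧ ∫ w, F w ∂P ≤ ∫ w, H w ∂P := by
  rw [← ofReal_integral_eq_lintegral_ofReal hH (Filter.Eventually.of_forall hH0)] at hle
  have hint : Integrable F P := by
    rw [← lintegral_ofReal_ne_top_iff_integrable hF.aestronglyMeasurable
      (Filter.Eventually.of_forall hF0)]
    exact (hle.trans_lt ENNReal.ofReal_lt_top).ne
  refine ⟨hint, ?_⟩
  rw [← ofReal_integral_eq_lintegral_ofReal hint (Filter.Eventually.of_forall hF0)] at hle
  exact (ENNReal.ofReal_le_ofReal_iff (integral_nonneg hH0)).1 hle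

/-- The errors of the local gradient estimators. -/
noncomputable def estError (f : Fin m → EuclideanSpace ℝ (Fin d) → ℝ) (S : State m d)
    (i : Fin m) : EuclideanSpace ℝ (Fin d) :=
  S.y i - gradient (f i) (S.xPrev i)

/-- The total squared movement of the iterates in one iteration, up to averages. -/
noncomputable def movement (S : State m d) : ℝ :=
  deviation S.x + deviation S.xPrev + ‖avg S.x - avg S.xPrev‖ ^ 2

theorem movement_nonneg (S : State m d) : 0 ≤ movement S := by
  have := deviation_nonneg S.x
  have := deviation_nonneg S.xPrev
  unfold movement
  positivity

/-- All the variables of a random state are square integrable. -/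
structure MemLpState (S : Ω → State m d) (P : Measure Ω) : Prop where
  xPrev : ∀ i, MemLp (fun w => (S w).xPrev i) 2 P
  x : ∀ i, MemLp (fun w => (S w).x i) 2 P
  y : ∀ i, MemLp (fun w => (S w).y i) 2 P
  s : ∀ i, MemLp (fun w => (S w).s i) 2 P

theorem memLp_smul {u : Ω → EuclideanSpace ℝ (Fin d)} (a : ℝ) (hu : MemLp u 2 P) :
    MemLp (fun w => a • u w) 2 P :=
  hu.const_smul a

theorem memLp_avg {φ : Ω → Fin m → EuclideanSpace ℝ (Fin d)}
    (hφ : ∀ i, MemLp (fun w => φ w i) 2 P) : MemLp (fun w => avg (φ w)) 2 P :=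
  (memLp_finsetSum Finset.univ fun i _ => hφ i).const_smul (1 / (m : ℝ))

theorem integrable_deviation {φ : Ω → Fin m → EuclideanSpace ℝ (Fin d)}
    (hφ : ∀ i, MemLp (fun w => φ w i) 2 P) : Integrable (fun w => deviation (φ w)) P :=
  integrable_finsetSum _ fun i _ =>
    ((hφ i).sub (memLp_avg hφ)).integrable_norm_pow (p := 2) (by norm_num)

theorem memLp_fastMix (W : Matrix (Fin m) (Fin m) ℝ) (R : ℕ)
    {φ : Ω → Fin m → EuclideanSpace ℝ (Fin d)} (hφ : ∀ i, MemLp (fun w => φ w i) 2 P)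
    (i : Fin m) : MemLp (fun w => fastMix W R (φ w) i) 2 P := by
  have h : ∀ r, (∀ i, MemLp (fun w => (fastMixPair W (φ w) r).1 i) 2 P) ∧
      ∀ i, MemLp (fun w => (fastMixPair W (φ w) r).2 i) 2 P := by
    intro r
    induction r with
    | zero => exact ⟨hφ, hφ⟩
    | succ r ih =>
      refine ⟨fun i => ?_, ih.1⟩
      have h1 : MemLp (fun w => ∑ j, W i j • (fastMixPair W (φ w) r).1 j) 2 P :=
        memLp_finsetSum Finset.univ fun j _ => memLp_smul (W i j) (ih.1 j)
      have h2 : MemLp (fun w => (1 + mixMomentum W) • ∑ j, W i j • (fastMixPair W (φ w) r).1 j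
          - mixMomentum W • (fastMixPair W (φ w) r).2 i) 2 P :=
        (memLp_smul _ h1).sub (memLp_smul _ (ih.2 i))
      exact h2
  exact (h R).1 i

theorem memLp_gradient [∀ i, IsProbabilityMeasure (D i)] [IsFiniteMeasure P]
    (hg : HeterogeneousVariance D f g σ) (hL : MeanSquaredSmooth D g L) (i : Fin m)
    {u : Ω → EuclideanSpace ℝ (Fin d)} (hu : MemLp u 2 P) :
    MemLp (fun w => gradient (f i) (u w)) 2 P := by
  have h1 : MemLp (fun w => ‖gradient (f i) 0‖ + Real.sqrt (m * L ^ 2) * ‖u w‖) 2 P :=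
    (memLp_const ‖gradient (f i) 0‖).add (hu.norm.const_mul (Real.sqrt (m * L ^ 2)))
  refine h1.of_le ((continuous_gradient hg hL i).comp_aestronglyMeasurable
    hu.aestronglyMeasurable) (Filter.Eventually.of_forall fun w => ?_)
  rw [Real.norm_of_nonneg (by positivity)]
  have h2 := norm_gradient_sub_le hg hL i (u w) 0
  have h3 := norm_le_norm_add_norm_sub' (gradient (f i) (u w)) (gradient (f i) 0)
  rw [sub_zero] at h2
  linarith

theorem integrable_sum_norm_sq {φ : Ω → Fin m → EuclideanSpace ℝ (Fin d)}
    (hφ : ∀ i, MemLp (fun w => φ w i) 2 P) : Integrable (fun w => ∑ i, ‖φ w i‖ ^ 2) P :=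
  integrable_finsetSum _ fun i _ => (hφ i).integrable_norm_pow (p := 2) (by norm_num)

theorem integrable_norm_sum_sq {φ : Ω → Fin m → EuclideanSpace ℝ (Fin d)}
    (hφ : ∀ i, MemLp (fun w => φ w i) 2 P) : Integrable (fun w => ‖∑ i, φ w i‖ ^ 2) P :=
  (memLp_finsetSum Finset.univ fun i _ => hφ i).integrable_norm_pow (p := 2) (by norm_num)

theorem MemLpState.integrable_movement {S : Ω → State m d} (hS : MemLpState S P) :
    Integrable (fun w => movement (S w)) P :=
  ((integrable_deviation hS.x).add (integrable_deviation hS.xPrev)).add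
    (((memLp_avg hS.x).sub (memLp_avg hS.xPrev)).integrable_norm_pow (p := 2) (by norm_num))

theorem MemLpState.memLp_estError [∀ i, IsProbabilityMeasure (D i)] [IsFiniteMeasure P]
    (hg : HeterogeneousVariance D f g σ) (hL : MeanSquaredSmooth D g L) {S : Ω → State m d}
    (hS : MemLpState S P) (i : Fin m) : MemLp (fun w => estError f (S w) i) 2 P :=
  (hS.y i).sub (memLp_gradient hg hL i (hS.xPrev i))

theorem MeasurableState.measurable_estError [∀ i, IsProbabilityMeasure (D i)]
    (hg : HeterogeneousVariance D f g σ) (hL : MeanSquaredSmooth D g L) {A : Type*}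
    [MeasurableSpace A] {S : A → State m d} (hS : MeasurableState S) (i : Fin m) :
    Measurable fun a => estError f (S a) i :=
  (hS.y i).sub ((continuous_gradient hg hL i).measurable.comp (hS.xPrev i))

/-- One step of the mean-squared error, for a quadratic functional `N` of the local errors. -/
theorem ValidRun.integral_error_succ_le [∀ i, IsProbabilityMeasure (D i)] [IsProbabilityMeasure P]
    (h : ValidRun D f g σ L G W p q P r) {N : (Fin m → EuclideanSpace ℝ (Fin d)) → ℝ}
    (hN0 : ∀ e, 0 ≤ N e) (hN : Measurable N)
    (hstep : ∀ (R : ℕ) (S : State m d),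
      ∫⁻ ρ, ENNReal.ofReal (N (estError f (step (B := B) (b := b) g W η q R ρ S)))
          ∂(drawLaw D B b p q)
        ≤ ENNReal.ofReal (p * ∑ i, σ i ^ 2 / B i + (1 - p) * (N (estError f S)
          + ∑ i, 1 / ((b : ℝ) * q) * ∫ ξ, ‖g i (S.x i) ξ - g i (S.xPrev i) ξ‖ ^ 2 ∂(D i))))
    (t : ℕ) (hS : MemLpState (runState g W η q x0 R r t) P)
    (hNi : Integrable (fun w => N (estError f (runState g W η q x0 R r t w))) P) :
    Integrable (fun w => N (estError f (runState g W η q x0 R r (t + 1) w))) P ∧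
    ∫ w, N (estError f (runState g W η q x0 R r (t + 1) w)) ∂P
      ≤ p * ∑ i, σ i ^ 2 / B i
        + (1 - p) * (∫ w, N (estError f (runState g W η q x0 R r t w)) ∂P
          + 1 / ((b : ℝ) * q) * (3 * m * L ^ 2)
            * ∫ w, movement (runState g W η q x0 R r t w) ∂P) := by
  have hp0 : 0 ≤ (p : ℝ) := p.2.1
  have hp1 : 0 ≤ 1 - (p : ℝ) := sub_nonneg.2 p.2.2
  have hq := h.prob_pos
  set H : State m d → ℝ := fun S => p * ∑ i, σ i ^ 2 / B i + (1 - p) * (N (estError f S)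
    + 1 / ((b : ℝ) * q) * (3 * m * L ^ 2) * movement S) with hH
  have hH0 : ∀ S, 0 ≤ H S := fun S => by
    have h1 := hN0 (estError f S)
    have h2 := movement_nonneg S
    have h3 : 0 ≤ ∑ i, σ i ^ 2 / (B i : ℝ) := Finset.sum_nonneg fun i _ => by positivity
    positivity
  have hmov := hS.integrable_movement
  have hadd : Integrable (fun w => N (estError f (runState g W η q x0 R r t w))
      + 1 / ((b : ℝ) * q) * (3 * m * L ^ 2) * movement (runState g W η q x0 R r t w)) P :=
    hNi.add (hmov.const_mul _)
  have hHi : Integrable (fun w => H (runState g W η q x0 R r t w)) P :=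
    (integrable_const _).add (hadd.const_mul _)
  have hle : ∀ S : State m d,
      ∫⁻ ρ, ENNReal.ofReal (N (estError f (step (B := B) (b := b) g W η q (R (t + 1)) ρ S)))
          ∂(drawLaw D B b p q) ≤ ENNReal.ofReal (H S) := by
    intro S
    refine (hstep (R (t + 1)) S).trans (ENNReal.ofReal_le_ofReal ?_)
    rw [hH, ← Finset.mul_sum]
    have h1 := sum_integral_norm_sub_sq_le h.var h.smooth h.pos S.x S.xPrev
    have h2 : 1 / ((b : ℝ) * q) * ∑ i, ∫ ξ, ‖g i (S.x i) ξ - g i (S.xPrev i) ξ‖ ^ 2 ∂(D i)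
        ≤ 1 / ((b : ℝ) * q) * (3 * m * L ^ 2) * movement S := by
      rw [mul_assoc]
      exact mul_le_mul_of_nonneg_left h1 (by positivity)
    dsimp only
    gcongr
  have hK : Measurable fun z : StateTuple m d × Draw Ξ B b => ENNReal.ofReal
      (N (estError f (step (B := B) (b := b) g W η q (R (t + 1)) z.2 (State.ofTuple z.1)))) := by
    have hS' := measurableState_step h.var W η q (R (t + 1))
      (measurable_snd (α := StateTuple m d) (β := Draw Ξ B b))
      (measurableState_ofTuple (measurable_fst (α := StateTuple m d) (β := Draw Ξ B b)))
    exact ENNReal.measurable_ofReal.comp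
      (hN.comp (measurable_pi_lambda _ fun i => hS'.measurable_estError h.var h.smooth i))
  have hlin : ∫⁻ w, ENNReal.ofReal (N (estError f (runState g W η q x0 R r (t + 1) w))) ∂P
      ≤ ∫⁻ w, ENNReal.ofReal (H (runState g W η q x0 R r t w)) ∂P := by
    have e := h.lintegral_step (η := η) (x0 := x0) (R := R) t (K := fun ρ S => ENNReal.ofReal
      (N (estError f (step (B := B) (b := b) g W η q (R (t + 1)) ρ S)))) hK
    exact e.trans_le (lintegral_mono fun w => hle _)
  have hfin := integrable_and_integral_le_of_lintegral_le
    (hN.comp (measurable_pi_lambda _ fun i =>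
      (h.measurableState (η := η) (x0 := x0) (R := R) (t + 1)).measurable_estError
        h.var h.smooth i)) (fun w => hN0 _) hHi (fun w => hH0 _) hlin
  refine ⟨hfin.1, hfin.2.trans (le_of_eq ?_)⟩
  rw [hH, integral_add (integrable_const _) (hadd.const_mul (1 - (p : ℝ))), integral_const,
    probReal_univ, one_smul, integral_const_mul (1 - (p : ℝ)),
    integral_add hNi (hmov.const_mul _), integral_const_mul]

/-- Sums the singleton cases of the one-step estimate; the case of all nodes gives the norm of the
sum instead. -/
theorem lintegral_ofReal_sum_norm_sq_le {A : Type*} [MeasurableSpace A] {ν : Measure A}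
    {e : A → Fin m → EuclideanSpace ℝ (Fin d)} (he : ∀ i, Measurable fun a => e a i)
    {c : Fin m → ℝ} (hc : ∀ i, 0 ≤ c i)
    (h : ∀ i, ∫⁻ a, ENNReal.ofReal (‖∑ j ∈ {i}, e a j‖ ^ 2) ∂ν ≤ ENNReal.ofReal (c i)) :
    ∫⁻ a, ENNReal.ofReal (∑ i, ‖e a i‖ ^ 2) ∂ν ≤ ENNReal.ofReal (∑ i, c i) := by
  have h1 : ∀ a, ENNReal.ofReal (∑ i, ‖e a i‖ ^ 2) = ∑ i, ENNReal.ofReal (‖e a i‖ ^ 2) :=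
    fun a => ENNReal.ofReal_sum_of_nonneg fun i _ => by positivity
  simp_rw [h1]
  rw [lintegral_finsetSum (f := fun i a => ENNReal.ofReal (‖e a i‖ ^ 2)) _ fun i _ =>
      ENNReal.measurable_ofReal.comp ((he i).norm.pow_const 2),
    ENNReal.ofReal_sum_of_nonneg fun i _ => hc i]
  refine Finset.sum_le_sum fun i _ => ?_
  have := h i
  simpa only [Finset.sum_singleton] using this

theorem ValidRun.integral_sum_norm_sq_succ_le [∀ i, IsProbabilityMeasure (D i)]
    [IsProbabilityMeasure P] (h : ValidRun D f g σ L G W p q P r) (t : ℕ)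
    (hS : MemLpState (runState g W η q x0 R r t) P) :
    Integrable (fun w => ∑ i, ‖estError f (runState g W η q x0 R r (t + 1) w) i‖ ^ 2) P ∧
    ∫ w, ∑ i, ‖estError f (runState g W η q x0 R r (t + 1) w) i‖ ^ 2 ∂P
      ≤ p * ∑ i, σ i ^ 2 / B i
        + (1 - p) * (∫ w, ∑ i, ‖estError f (runState g W η q x0 R r t w) i‖ ^ 2 ∂P
          + 1 / ((b : ℝ) * q) * (3 * m * L ^ 2)
            * ∫ w, movement (runState g W η q x0 R r t w) ∂P) := by
  refine h.integral_error_succ_le (N := fun e => ∑ i, ‖e i‖ ^ 2)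
    (fun e => Finset.sum_nonneg fun _ _ => by positivity) (by fun_prop) (fun R' S => ?_) t hS
    (integrable_sum_norm_sq (hS.memLp_estError h.var h.smooth))
  have hp0 : 0 ≤ (p : ℝ) := p.2.1
  have hp1 : 0 ≤ 1 - (p : ℝ) := sub_nonneg.2 p.2.2
  have hq := h.prob_pos
  rw [← Finset.sum_add_distrib, Finset.mul_sum, Finset.mul_sum, ← Finset.sum_add_distrib]
  refine lintegral_ofReal_sum_norm_sq_le (fun i => ?_) (fun i => ?_) fun i => ?_
  · exact (measurableState_step h.var W η q R' measurable_id (S := fun _ => S)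
      ⟨fun _ => measurable_const, fun _ => measurable_const,
        fun _ => measurable_const, fun _ => measurable_const⟩).measurable_estError
        h.var h.smooth i
  · have : 0 ≤ ∫ ξ, ‖g i (S.x i) ξ - g i (S.xPrev i) ξ‖ ^ 2 ∂(D i) :=
      integral_nonneg fun _ => by positivity
    positivity
  · have := lintegral_sum_error_step_le h.var h.largeBatch_pos p q h.miniBatch_pos h.prob_pos
      h.one_sub_prob_le W η R' S {i}
    simp only [Finset.sum_singleton] at this ⊢
    exact this

/-- By independence of the nodes the constants match those for the sum of squared norms;
Cauchy–Schwarz would lose a factor `m`. -/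
theorem ValidRun.integral_norm_sum_sq_succ_le [∀ i, IsProbabilityMeasure (D i)]
    [IsProbabilityMeasure P] (h : ValidRun D f g σ L G W p q P r) (t : ℕ)
    (hS : MemLpState (runState g W η q x0 R r t) P) :
    ∫ w, ‖∑ i, estError f (runState g W η q x0 R r (t + 1) w) i‖ ^ 2 ∂P
      ≤ p * ∑ i, σ i ^ 2 / B i
        + (1 - p) * (∫ w, ‖∑ i, estError f (runState g W η q x0 R r t w) i‖ ^ 2 ∂P
          + 1 / ((b : ℝ) * q) * (3 * m * L ^ 2)
            * ∫ w, movement (runState g W η q x0 R r t w) ∂P) :=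
  (h.integral_error_succ_le (N := fun e => ‖∑ i, e i‖ ^ 2)
    (fun e => by positivity) (by fun_prop) (fun R' S =>
      lintegral_sum_error_step_le h.var h.largeBatch_pos p q h.miniBatch_pos h.prob_pos
        h.one_sub_prob_le W η R' S Finset.univ) t hS
    (integrable_norm_sum_sq (hS.memLp_estError h.var h.smooth))).2

theorem ValidRun.integral_error_zero_le [∀ i, IsProbabilityMeasure (D i)]
    [IsProbabilityMeasure P] (h : ValidRun D f g σ L G W p q P r) :
    (Integrable (fun w => ∑ i, ‖estError f (runState g W η q x0 R r 0 w) i‖ ^ 2) P ∧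
    ∫ w, ∑ i, ‖estError f (runState g W η q x0 R r 0 w) i‖ ^ 2 ∂P ≤ ∑ i, σ i ^ 2 / B i) ∧
    ∫ w, ‖∑ i, estError f (runState g W η q x0 R r 0 w) i‖ ^ 2 ∂P ≤ ∑ i, σ i ^ 2 / B i := by
  have h0 : 0 ≤ ∑ i, σ i ^ 2 / (B i : ℝ) := Finset.sum_nonneg fun i _ => by positivity
  have hem : ∀ i, Measurable fun w => estError f (runState g W η q x0 R r 0 w) i := fun i =>
    (h.measurableState 0).measurable_estError h.var h.smooth i
  have hρm : ∀ i, Measurable fun ρ : Draw Ξ B b =>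
      largeBatchGrad g ρ i x0 - gradient (f i) x0 := fun i =>
    (measurable_largeBatchGrad h.var measurable_id i measurable_const).sub measurable_const
  have hlin : ∀ J : Finset (Fin m), ∫⁻ ρ : Draw Ξ B b, ENNReal.ofReal
      (‖∑ i ∈ J, (largeBatchGrad g ρ i x0 - gradient (f i) x0)‖ ^ 2) ∂(drawLaw D B b p q)
      ≤ ENNReal.ofReal (∑ i ∈ J, σ i ^ 2 / B i) := fun J =>
    lintegral_sum_error_initState_le h.var h.largeBatch_pos p q x0 J
  have hle1 : ∫⁻ w, ENNReal.ofReal (∑ i, ‖estError f (runState g W η q x0 R r 0 w) i‖ ^ 2) ∂P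
      ≤ ∫⁻ _, ENNReal.ofReal (∑ i, σ i ^ 2 / B i) ∂P := by
    have e := lintegral_ofReal_sum_norm_sq_le (ν := drawLaw D B b p q) hρm
      (c := fun i => σ i ^ 2 / B i) (fun i => by positivity)
      (fun i => by simpa only [Finset.sum_singleton] using hlin {i})
    rw [← h.draw_law 0, lintegral_map _ (h.measurable_draw 0)] at e
    · rw [lintegral_const, measure_univ, mul_one]; exact e
    · exact ENNReal.measurable_ofReal.comp
        (Finset.measurable_fun_sum _ fun i _ => (hρm i).norm.pow_const 2)
  have hle2 : ∫⁻ w, ENNReal.ofReal (‖∑ i, estError f (runState g W η q x0 R r 0 w) i‖ ^ 2) ∂P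
      ≤ ∫⁻ _, ENNReal.ofReal (∑ i, σ i ^ 2 / B i) ∂P := by
    have e := hlin Finset.univ
    rw [← h.draw_law 0, lintegral_map _ (h.measurable_draw 0)] at e
    · rw [lintegral_const, measure_univ, mul_one]; exact e
    · exact ENNReal.measurable_ofReal.comp
        ((Finset.measurable_fun_sum _ fun i _ => hρm i).norm.pow_const 2)
  have r1 := integrable_and_integral_le_of_lintegral_le
    (Finset.measurable_fun_sum _ fun i _ => (hem i).norm.pow_const 2)
    (fun w => Finset.sum_nonneg fun _ _ => by positivity) (integrable_const _) (fun _ => h0) hle1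
  have r2 := integrable_and_integral_le_of_lintegral_le
    ((Finset.measurable_fun_sum _ fun i _ => hem i).norm.pow_const 2)
    (fun w => by positivity) (integrable_const _) (fun _ => h0) hle2
  simp only [integral_const, probReal_univ, one_smul] at r1 r2
  exact ⟨r1, r2.2⟩

theorem memLp_two_of_integrable_sum {e : Ω → Fin m → EuclideanSpace ℝ (Fin d)}
    (he : ∀ i, Measurable fun w => e w i) (hi : Integrable (fun w => ∑ i, ‖e w i‖ ^ 2) P)
    (i : Fin m) : MemLp (fun w => e w i) 2 P := by
  rw [memLp_two_iff_integrable_sq_norm (he i).aestronglyMeasurable]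
  refine hi.mono' ((he i).norm.pow_const 2).aestronglyMeasurable
    (Filter.Eventually.of_forall fun w => ?_)
  rw [Real.norm_of_nonneg (by positivity)]
  exact Finset.single_le_sum (f := fun i => ‖e w i‖ ^ 2) (fun _ _ => by positivity)
    (Finset.mem_univ i)

/-- Square integrability of one state bounds the next estimation error; adding back the gradient
gives `y`, and linearity of FastMix gives `s` and `x`. -/
theorem ValidRun.memLpState [∀ i, IsProbabilityMeasure (D i)]
    [IsProbabilityMeasure P] (h : ValidRun D f g σ L G W p q P r) (t : ℕ) :
    MemLpState (runState g W η q x0 R r t) P := by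
  have hy : ∀ t, (∀ i, MemLp (fun w => (runState g W η q x0 R r t w).xPrev i) 2 P) →
      Integrable (fun w => ∑ i, ‖estError f (runState g W η q x0 R r t w) i‖ ^ 2) P →
      ∀ i, MemLp (fun w => (runState g W η q x0 R r t w).y i) 2 P := by
    intro t hx hi i
    have h1 := memLp_two_of_integrable_sum (fun i => (h.measurableState (η := η) (x0 := x0)
      (R := R) t).measurable_estError h.var h.smooth i) hi i
    have h2 := h1.add (memLp_gradient h.var h.smooth i (hx i))
    convert h2 using 1
    ext1 w
    simp [estError]
  induction t with
  | zero =>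
    have hx : ∀ i, MemLp (fun w => (runState g W η q x0 R r 0 w).xPrev i) 2 P :=
      fun i => memLp_const x0
    have hy0 := hy 0 hx h.integral_error_zero_le.1.1
    have hs : ∀ i, MemLp (fun w => (runState g W η q x0 R r 0 w).s i) 2 P :=
      fun i => memLp_fastMix W (R 0) hy0 i
    exact ⟨hx, fun i => memLp_fastMix W (R 0)
      (fun i => (memLp_const x0).sub ((hs i).const_smul η)) i, hy0, hs⟩
  | succ t ih =>
    have hx : ∀ i, MemLp (fun w => (runState g W η q x0 R r (t + 1) w).xPrev i) 2 P := ih.x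
    have hy1 := hy (t + 1) hx (h.integral_sum_norm_sq_succ_le t ih).1
    have hs : ∀ i, MemLp (fun w => (runState g W η q x0 R r (t + 1) w).s i) 2 P :=
      fun i => memLp_fastMix W (R (t + 1)) (fun i => ((ih.s i).add (hy1 i)).sub (ih.y i)) i
    exact ⟨hx, fun i => memLp_fastMix W (R (t + 1))
      (fun i => (ih.x i).sub ((hs i).const_smul η)) i, hy1, hs⟩

end Run

/-! ### Convergence of the averaged run -/

/-! ### Summation of the coupled recursions -/

section Numeric

theorem sum_range_succ_le_of_succ_le {u v : ℕ → ℝ} {c : ℝ} {T : ℕ} (h0 : u 0 ≤ c)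
    (h : ∀ t, u (t + 1) ≤ v t) :
    ∑ t ∈ Finset.range (T + 1), u t ≤ c + ∑ t ∈ Finset.range T, v t := by
  rw [Finset.sum_range_succ']
  have := Finset.sum_le_sum (s := Finset.range T) fun t _ => h t
  linarith

theorem sum_range_le_sum_range_succ {u : ℕ → ℝ} (hu : ∀ t, 0 ≤ u t) (T : ℕ) :
    ∑ t ∈ Finset.range T, u t ≤ ∑ t ∈ Finset.range (T + 1), u t := by
  rw [Finset.sum_range_succ]
  linarith [hu T]

theorem sum_range_shift_le_sum_range_succ {u : ℕ → ℝ} (hu : ∀ t, 0 ≤ u t) (T : ℕ) :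
    ∑ t ∈ Finset.range T, u (t + 1) ≤ ∑ t ∈ Finset.range (T + 1), u t := by
  rw [Finset.sum_range_succ']
  linarith [hu 0]

/-- The sums of a recursively bounded variance sequence. -/
theorem sum_variance_le {U Y : ℕ → ℝ} {p c K e : ℝ} {T : ℕ} (hp0 : 0 < p) (hp1 : p ≤ 1)
    (hU : ∀ t, 0 ≤ U t) (hc : c ≤ e) (he : 0 ≤ e)
    (hT : 2 / p ≤ T) (h0 : U 0 ≤ c) (hrec : ∀ t, U (t + 1) ≤ p * c + (1 - p) * U t + p * K * Y t) :
    ∑ t ∈ Finset.range (T + 1), U t ≤ 3 / 2 * T * e + K * ∑ t ∈ Finset.range T, Y t := by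
  have h1 := sum_range_succ_le_of_succ_le (T := T) h0 hrec
  simp only [Finset.sum_add_distrib, ← Finset.mul_sum, Finset.sum_const, Finset.card_range, nsmul_eq_mul] at h1
  have h2 := mul_le_mul_of_nonneg_left (sum_range_le_sum_range_succ hU T) (sub_nonneg.2 hp1)
  set u := ∑ t ∈ Finset.range (T + 1), U t
  set y := ∑ t ∈ Finset.range T, Y t
  -- As `p * T ≥ 2`, the initial error is at most half of the accumulated reset noise `p * T * e`;
  -- hence the factor `3 / 2`.
  have h3 : 1 ≤ p * T / 2 := by
    rw [div_le_iff₀ hp0] at hT; linarith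
  have h4 : c ≤ p * T / 2 * e := by nlinarith
  have hpT : 0 ≤ p * T := by positivity
  have h5 : p * u ≤ p * (3 / 2 * T * e + K * y) := by nlinarith
  exact le_of_mul_le_mul_left h5 hp0

/-- The arithmetic of `sum_gradient_le_of_recursions`, in terms of the sums `sX, …` over
`0, …, T` and the sums `sX0, …` over `0, …, T - 1` and `sX1, …` over `1, …, T`. -/
theorem gradient_le_of_sums {sX sS sA sU sQ sF sX0 sX1 sA0 sS0 sU0 sU1 m L ε Δ η δ s0 T : ℝ}
    (hm : 1 ≤ m) (hηL : L ^ 2 * η ^ 2 = 1 / 2304) (hT0 : 0 ≤ T)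
    (hδ0 : 0 ≤ δ) (hδ : δ ≤ 1 / (1000 * m ^ 2)) (hs0 : s0 ≤ ε ^ 2 / 10)
    (hT2 : 384 * Δ * L ≤ T * ε ^ 2) (gX : 0 ≤ sX) (gS : 0 ≤ sS) (gA : 0 ≤ sA)
    (fX : sX0 ≤ sX) (fX' : sX1 ≤ sX) (fS : sS0 ≤ sS) (fA : sA0 ≤ sA) (fU : sU0 ≤ sU)
    (fU' : sU1 ≤ sU)
    (eX : sX ≤ 0 + 2 * δ * (sX0 + η ^ 2 * sS0))
    (eS : sS ≤ s0 + 2 * δ * (sS0 + 3 * (sU1 + sU0 + 3 * m * L ^ 2 * (sX1 + sX0 + η ^ 2 * sA0))))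
    (eU : sU ≤ 3 / 2 * T * (m ^ 2 * ε ^ 2 / 32)
      + 3 * m ^ 2 * L ^ 2 * (sX1 + sX0 + η ^ 2 * sA0))
    (eQ : sQ ≤ 3 / 2 * T * (m ^ 2 * ε ^ 2 / 32)
      + 3 * m ^ 2 * L ^ 2 * (sX1 + sX0 + η ^ 2 * sA0))
    (hdesc : sF ≤ 96 * L * Δ + (2 / m ^ 2 * sQ + 2 * L ^ 2 * sX - 47 / 48 * sA)) :
    2 * sF + 2 * L ^ 2 * sX ≤ (T + 1) * ε ^ 2 := by
  have hm0 : 0 < m := by linarith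
  -- Movement and consensus error are measured in units of `L ^ 2`, so that `η` enters only through
  -- `L ^ 2 * η ^ 2 = 1 / 48 ^ 2 = 1 / 2304`.
  obtain ⟨y, hy⟩ : ∃ y, y = L ^ 2 * (sX1 + sX0 + η ^ 2 * sA0) := ⟨_, rfl⟩
  obtain ⟨x, hx⟩ : ∃ x, x = L ^ 2 * sX := ⟨_, rfl⟩
  have hx0 : 0 ≤ x := by rw [hx]; positivity
  have hyle : y ≤ 2 * x + sA / 2304 := by
    have h1 : L ^ 2 * (sX1 + sX0 + η ^ 2 * sA0) ≤ L ^ 2 * (sX + sX + η ^ 2 * sA) := by gcongr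
    have h2 : L ^ 2 * (sX + sX + η ^ 2 * sA) = 2 * x + (L ^ 2 * η ^ 2) * sA := by rw [hx]; ring
    rw [hηL] at h2
    rw [hy]; linarith
  have hy0 : 0 ≤ 2 * x + sA / 2304 := by positivity
  have hδm : δ * m ^ 2 ≤ 1 / 1000 := by
    calc δ * m ^ 2 ≤ 1 / (1000 * m ^ 2) * m ^ 2 := by gcongr
      _ = 1 / 1000 := by field_simp
  have hδm1 : δ * m ≤ 1 / 1000 := by nlinarith
  have hδ1 : δ ≤ 1 / 1000 := by nlinarith
  -- consensus error of the iterates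
  have kX : x ≤ 2 * δ * (x + sS / 2304) := by
    have h1 : L ^ 2 * sX ≤ L ^ 2 * (0 + 2 * δ * (sX0 + η ^ 2 * sS0)) := by gcongr
    have h2 : L ^ 2 * (0 + 2 * δ * (sX0 + η ^ 2 * sS0))
        ≤ L ^ 2 * (0 + 2 * δ * (sX + η ^ 2 * sS)) := by gcongr
    have h3 : L ^ 2 * (0 + 2 * δ * (sX + η ^ 2 * sS)) = 2 * δ * (x + (L ^ 2 * η ^ 2) * sS) := by
      rw [hx]; ring
    rw [hηL] at h3
    linarith
  have kX2 : x ≤ 2 / 1000 * (x + sS / 2304) := by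
    have : 2 * δ * (x + sS / 2304) ≤ 2 * (1 / 1000) * (x + sS / 2304) := by gcongr
    linarith
  -- variances
  obtain ⟨v, hv⟩ : ∃ v, v = 3 / 2 * T * (ε ^ 2 / 32) + 3 * (2 * x + sA / 2304) := ⟨_, rfl⟩
  have hv0 : 0 ≤ v := by rw [hv]; positivity
  have kU : sU ≤ m ^ 2 * v := by
    have h1 : 3 * m ^ 2 * L ^ 2 * (sX1 + sX0 + η ^ 2 * sA0) = m ^ 2 * (3 * y) := by rw [hy]; ring
    have h2 : m ^ 2 * (3 * y) ≤ m ^ 2 * (3 * (2 * x + sA / 2304)) := by gcongr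
    rw [h1] at eU
    rw [hv]; linarith
  have kQ : 2 / m ^ 2 * sQ ≤ 2 * v := by
    have h1 : 3 * m ^ 2 * L ^ 2 * (sX1 + sX0 + η ^ 2 * sA0) = m ^ 2 * (3 * y) := by rw [hy]; ring
    have h2 : m ^ 2 * (3 * y) ≤ m ^ 2 * (3 * (2 * x + sA / 2304)) := by gcongr
    rw [h1] at eQ
    have h3 : sQ ≤ m ^ 2 * v := by rw [hv]; linarith
    calc 2 / m ^ 2 * sQ ≤ 2 / m ^ 2 * (m ^ 2 * v) := by gcongr
      _ = 2 * v := by field_simp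
  -- consensus error of the gradient trackers
  have kS : sS ≤ ε ^ 2 / 10 + 2 / 1000 * sS + 12 / 1000 * v + 18 / 1000 * (2 * x + sA / 2304) := by
    have h1 : sS ≤ s0 + 2 * δ * (sS0 + 3 * (sU1 + sU0
        + 3 * m * L ^ 2 * (sX1 + sX0 + η ^ 2 * sA0))) := eS
    have h2 : 3 * m * L ^ 2 * (sX1 + sX0 + η ^ 2 * sA0) = m * (3 * y) := by rw [hy]; ring
    rw [h2] at h1
    have h3 : 2 * δ * (sS0 + 3 * (sU1 + sU0 + m * (3 * y)))
        ≤ 2 * δ * (sS + 3 * (m ^ 2 * v + m ^ 2 * v + m * (3 * (2 * x + sA / 2304)))) := by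
      gcongr <;> linarith
    have h4 : 2 * δ * (sS + 3 * (m ^ 2 * v + m ^ 2 * v + m * (3 * (2 * x + sA / 2304))))
        = 2 * δ * sS + 12 * (δ * m ^ 2) * v + 18 * (δ * m) * (2 * x + sA / 2304) := by ring
    have h5 : 2 * δ * sS + 12 * (δ * m ^ 2) * v + 18 * (δ * m) * (2 * x + sA / 2304)
        ≤ 2 * (1 / 1000) * sS + 12 * (1 / 1000) * v + 18 * (1 / 1000) * (2 * x + sA / 2304) := by
      gcongr
    linarith
  have hxx : 2 * L ^ 2 * sX = 2 * x := by rw [hx]; ring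
  rw [hxx] at hdesc ⊢
  have hTε : 0 ≤ T * ε ^ 2 := by positivity
  have hε2 : 0 ≤ ε ^ 2 := by positivity
  have hv' : v = 3 / 64 * (T * ε ^ 2) + 6 * x + 3 * sA / 2304 := by rw [hv]; ring
  have hgoal : (T + 1) * ε ^ 2 = T * ε ^ 2 + ε ^ 2 := by ring
  rw [hgoal]
  -- Budget for the doubled descent inequality: the gap takes half of `T * ε ^ 2`, the reset noise
  -- 3/16 of it, the consensus terms have tiny coefficients, and `-47 / 24 * sA` outweighs every
  -- other multiple of `sA`.
  linarith

/-- The combination of the recursions for the consensus errors, the variances and the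
descent inequality. -/
theorem sum_gradient_le_of_recursions {X S A U Q F : ℕ → ℝ} {m L ε Δ η δ p c s0 : ℝ} {T : ℕ}
    (hX : ∀ t, 0 ≤ X t) (hS : ∀ t, 0 ≤ S t) (hA : ∀ t, 0 ≤ A t) (hU : ∀ t, 0 ≤ U t)
    (hQ : ∀ t, 0 ≤ Q t) (hm : 1 ≤ m) (hL : 0 < L) (hε : 0 < ε) (hη : η = 1 / (48 * L))
    (hδ0 : 0 ≤ δ) (hδ : δ ≤ 1 / (1000 * m ^ 2)) (hp0 : 0 < p) (hp1 : p ≤ 1)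
    (hc : c ≤ m ^ 2 * ε ^ 2 / 32) (hs0 : s0 ≤ ε ^ 2 / 10)
    (hT : 384 * Δ * L / ε ^ 2 + 2 / p ≤ T) (hΔ : 0 ≤ Δ)
    (hX0 : X 0 ≤ 0) (hXs : ∀ t, X (t + 1) ≤ 2 * δ * (X t + η ^ 2 * S t))
    (hS0 : S 0 ≤ s0)
    (hSs : ∀ t, S (t + 1) ≤ 2 * δ * (S t + 3 * (U (t + 1) + U t
      + 3 * m * L ^ 2 * (X (t + 1) + X t + η ^ 2 * A t))))
    (hU0 : U 0 ≤ c) (hUs : ∀ t, U (t + 1) ≤ p * c + (1 - p) * U t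
      + p * (3 * m ^ 2 * L ^ 2) * (X (t + 1) + X t + η ^ 2 * A t))
    (hQ0 : Q 0 ≤ c) (hQs : ∀ t, Q (t + 1) ≤ p * c + (1 - p) * Q t
      + p * (3 * m ^ 2 * L ^ 2) * (X (t + 1) + X t + η ^ 2 * A t))
    (hdesc : ∑ t ∈ Finset.range (T + 1), F t ≤ 96 * L * Δ
      + ∑ t ∈ Finset.range (T + 1), (2 / m ^ 2 * Q t + 2 * L ^ 2 * X t - 47 / 48 * A t)) :
    2 * ∑ t ∈ Finset.range (T + 1), F t + 2 * L ^ 2 * ∑ t ∈ Finset.range (T + 1), X t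
      ≤ ((T : ℝ) + 1) * ε ^ 2 := by
  have hm0 : 0 < m := by linarith
  have hηL : L ^ 2 * η ^ 2 = 1 / 2304 := by rw [hη]; field_simp; norm_num
  have hT1 : 2 / p ≤ T := by
    have : 0 ≤ 384 * Δ * L / ε ^ 2 := by positivity
    linarith
  have hT2 : 384 * Δ * L ≤ T * ε ^ 2 := by
    have h1 : 0 ≤ 2 / p := by positivity
    have h2 : 384 * Δ * L / ε ^ 2 ≤ T := by linarith
    rwa [div_le_iff₀ (by positivity)] at h2
  have eX := sum_range_succ_le_of_succ_le (T := T) hX0 hXs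
  have eS := sum_range_succ_le_of_succ_le (T := T) hS0 hSs
  have eU := sum_variance_le hp0 hp1 hU hc (by positivity) hT1 hU0 hUs
  have eQ := sum_variance_le hp0 hp1 hQ hc (by positivity) hT1 hQ0 hQs
  simp only [← Finset.mul_sum, Finset.sum_add_distrib, Finset.sum_sub_distrib] at eX eS eU eQ hdesc
  have fX := sum_range_le_sum_range_succ hX T
  have fX' := sum_range_shift_le_sum_range_succ hX T
  have fS := sum_range_le_sum_range_succ hS T
  have fA := sum_range_le_sum_range_succ hA T
  have fU := sum_range_le_sum_range_succ hU T
  have fU' := sum_range_shift_le_sum_range_succ hU T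
  have gX : 0 ≤ ∑ t ∈ Finset.range (T + 1), X t := Finset.sum_nonneg fun t _ => hX t
  have gS : 0 ≤ ∑ t ∈ Finset.range (T + 1), S t := Finset.sum_nonneg fun t _ => hS t
  have gA : 0 ≤ ∑ t ∈ Finset.range (T + 1), A t := Finset.sum_nonneg fun t _ => hA t
  exact gradient_le_of_sums hm hηL (Nat.cast_nonneg T) hδ0 hδ hs0 hT2 gX gS gA fX fX' fS fA fU fU'
    eX eS eU eQ hdesc

end Numeric

/-! ### Averages along a run -/

section Run

variable {m d : ℕ} {Ξ : Fin m → Type*} {f : Fin m → EuclideanSpace ℝ (Fin d) → ℝ}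
  {g : ∀ i, EuclideanSpace ℝ (Fin d) → Ξ i → EuclideanSpace ℝ (Fin d)} {σ : Fin m → ℝ} {L : ℝ}
  {G : SimpleGraph (Fin m)} {W : Matrix (Fin m) (Fin m) ℝ} {B : Fin m → ℕ} {b : ℕ}
  {p q : unitInterval} {Ω : Type*} {r : ℕ → Ω → Draw Ξ B b}
  {η : ℝ} {x0 : EuclideanSpace ℝ (Fin d)} {R : ℕ → ℕ}

theorem runState_x (t : ℕ) (w : Ω) :
    (runState g W η q x0 R r t w).x = fastMix W (R t) fun i =>
      (runState g W η q x0 R r t w).xPrev i - η • (runState g W η q x0 R r t w).s i := by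
  cases t <;> rfl

/-- The gradient tracking invariant: the increments of `y` telescope under the average. -/
theorem avg_runState_s (hW : AdmissibleMixing G W) (t : ℕ) (w : Ω) :
    avg (runState g W η q x0 R r t w).s = avg (runState g W η q x0 R r t w).y := by
  induction t with
  | zero => exact avg_fastMix hW _ _
  | succ t ih =>
    have h : (runState g W η q x0 R r (t + 1) w).s = fastMix W (R (t + 1)) fun i =>
      (runState g W η q x0 R r t w).s i + (runState g W η q x0 R r (t + 1) w).y i
        - (runState g W η q x0 R r t w).y i := rfl
    rw [h, avg_fastMix hW, avg_sub, avg_add, ih]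
    abel

theorem avg_runState_x (hW : AdmissibleMixing G W) (t : ℕ) (w : Ω) :
    avg (runState g W η q x0 R r t w).x = avg (runState g W η q x0 R r t w).xPrev
      - η • avg (runState g W η q x0 R r t w).y := by
  rw [runState_x, avg_fastMix hW, avg_sub, avg_smul, avg_runState_s hW]

end Run

/-! ### Recursions in expectation and the stationarity bound -/

section Expectation

variable {m d : ℕ} {Ξ : Fin m → Type*} [∀ i, MeasurableSpace (Ξ i)]
  {D : ∀ i, Measure (Ξ i)} [∀ i, IsProbabilityMeasure (D i)]
  {f : Fin m → EuclideanSpace ℝ (Fin d) → ℝ}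
  {g : ∀ i, EuclideanSpace ℝ (Fin d) → Ξ i → EuclideanSpace ℝ (Fin d)} {σ : Fin m → ℝ} {L : ℝ}
  {G : SimpleGraph (Fin m)} {W : Matrix (Fin m) (Fin m) ℝ} {B : Fin m → ℕ} {b : ℕ}
  {p q : unitInterval} {Ω : Type*} [MeasurableSpace Ω] {P : Measure Ω}
  {r : ℕ → Ω → Draw Ξ B b} {η : ℝ} {x0 : EuclideanSpace ℝ (Fin d)} {R : ℕ → ℕ}

/-- The summed descent inequality along a run. -/
theorem ValidRun.sum_norm_gradient_sq_le (h : ValidRun D f g σ L G W p q P r)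
    (hbdd : BddBelow (Set.range (avgFun f))) (hη : η = 1 / (48 * L)) (N : ℕ) (w : Ω) :
    ∑ t ∈ Finset.range N, ‖gradient (avgFun f) (avg (runState g W η q x0 R r t w).xPrev)‖ ^ 2
      ≤ 96 * L * initialGap f x0 + ∑ t ∈ Finset.range N,
        (2 / (m : ℝ) ^ 2 * ‖∑ i, estError f (runState g W η q x0 R r t w) i‖ ^ 2
          + 2 * L ^ 2 * deviation (runState g W η q x0 R r t w).xPrev
          - 47 / 48 * ‖avg (runState g W η q x0 R r t w).y‖ ^ 2) := by
  have hL := h.smooth.const_pos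
  set a : ℕ → ℝ := fun t => ‖gradient (avgFun f) (avg (runState g W η q x0 R r t w).xPrev)‖ ^ 2
  set c : ℕ → ℝ := fun t =>
    (2 / (m : ℝ) ^ 2 * ‖∑ i, estError f (runState g W η q x0 R r t w) i‖ ^ 2
      + 2 * L ^ 2 * deviation (runState g W η q x0 R r t w).xPrev
      - 47 / 48 * ‖avg (runState g W η q x0 R r t w).y‖ ^ 2)
  set u : ℕ → ℝ := fun t => avgFun f (avg (runState g W η q x0 R r t w).xPrev) with hu
  have hstep : ∀ t, a t ≤ 96 * L * (u t - u (t + 1)) + c t := by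
    intro t
    set S := runState g W η q x0 R r t w with hSdef
    have h1 := avgFun_step_le h.diff h.var h.smooth η (avg S.xPrev) (avg S.y)
    have h2 := norm_avg_sub_gradient_sq_le h.diff h.var h.smooth h.pos S.xPrev S.y
    have h3 : u (t + 1) = avgFun f (avg S.xPrev - η • avg S.y) := by
      rw [hu, ← avg_runState_x h.mixing]; rfl
    -- `96 * L` is `2 / η`, which normalises the gradient term to coefficient one and leaves `1 - L
    -- * η = 47 / 48` for `‖avg y‖ ^ 2`.
    have h4 : L * η = 1 / 48 := by rw [hη]; field_simp
    have h5 : 96 * L * (η / 2) = 1 := by linarith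
    rw [← h3] at h1
    have h6 := mul_le_mul_of_nonneg_left h1 (by positivity : 0 ≤ 96 * L)
    have h7 : 96 * L * (avgFun f (avg S.xPrev)
        - η / 2 * ‖gradient (avgFun f) (avg S.xPrev)‖ ^ 2
        - (η / 2 - L * η ^ 2 / 2) * ‖avg S.y‖ ^ 2
        + η / 2 * ‖avg S.y - gradient (avgFun f) (avg S.xPrev)‖ ^ 2)
        = 96 * L * u t - a t - 47 / 48 * ‖avg S.y‖ ^ 2
          + ‖avg S.y - gradient (avgFun f) (avg S.xPrev)‖ ^ 2 := by
      have e1 : 96 * L * (L * η ^ 2 / 2) = 1 / 48 := by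
        have : 96 * L * (L * η ^ 2 / 2) = 48 * (L * η) ^ 2 := by ring
        rw [this, h4]; norm_num
      linear_combination (-‖gradient (avgFun f) (avg S.xPrev)‖ ^ 2 - ‖avg S.y‖ ^ 2
        + ‖avg S.y - gradient (avgFun f) (avg S.xPrev)‖ ^ 2) * h5 + ‖avg S.y‖ ^ 2 * e1
    rw [h7] at h6
    have h8 : c t = 2 / (m : ℝ) ^ 2 * ‖∑ i, (S.y i - gradient (f i) (S.xPrev i))‖ ^ 2
        + 2 * L ^ 2 * deviation S.xPrev - 47 / 48 * ‖avg S.y‖ ^ 2 := rfl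
    rw [h8]
    linarith
  have hsum := Finset.sum_le_sum (s := Finset.range N) fun t _ => hstep t
  rw [Finset.sum_add_distrib, ← Finset.mul_sum, Finset.sum_range_sub'] at hsum
  have h0 : u 0 = avgFun f x0 := by
    have : avg (runState g W η q x0 R r 0 w).xPrev = x0 := avg_const h.pos x0
    rw [hu]; simp only [this]
  have hN : ⨅ x, avgFun f x ≤ u N := ciInf_le hbdd _
  have hgap : u 0 - u N ≤ initialGap f x0 := by
    rw [h0, initialGap]; linarith
  have := mul_le_mul_of_nonneg_left hgap (by positivity : 0 ≤ 96 * L)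
  linarith

theorem initialGap_nonneg (hbdd : BddBelow (Set.range (avgFun f))) (x0 : EuclideanSpace ℝ (Fin d)) :
    0 ≤ initialGap f x0 :=
  sub_nonneg.2 (ciInf_le hbdd x0)

variable [IsProbabilityMeasure P]

theorem ValidRun.integral_movement (h : ValidRun D f g σ L G W p q P r) (t : ℕ) :
    ∫ w, movement (runState g W η q x0 R r t w) ∂P
      = ∫ w, deviation (runState g W η q x0 R r (t + 1) w).xPrev ∂P
        + ∫ w, deviation (runState g W η q x0 R r t w).xPrev ∂P
        + η ^ 2 * ∫ w, ‖avg (runState g W η q x0 R r t w).y‖ ^ 2 ∂P := by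
  have hS := h.memLpState (η := η) (x0 := x0) (R := R) t
  have h1 : ∀ w, movement (runState g W η q x0 R r t w)
      = deviation (runState g W η q x0 R r (t + 1) w).xPrev
        + deviation (runState g W η q x0 R r t w).xPrev
        + η ^ 2 * ‖avg (runState g W η q x0 R r t w).y‖ ^ 2 := by
    intro w
    have e : (runState g W η q x0 R r (t + 1) w).xPrev = (runState g W η q x0 R r t w).x := rfl
    rw [movement, avg_runState_x h.mixing, e, sub_sub_cancel_left, norm_neg, norm_smul, mul_pow,
      Real.norm_eq_abs, sq_abs]
  have i1 : Integrable (fun w => deviation (runState g W η q x0 R r (t + 1) w).xPrev) P :=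
    integrable_deviation hS.x
  have i2 := integrable_deviation hS.xPrev
  have i3 : Integrable (fun w => ‖avg (runState g W η q x0 R r t w).y‖ ^ 2) P :=
    (memLp_avg hS.y).integrable_norm_pow (p := 2) (by norm_num)
  simp_rw [h1]
  have i12 : Integrable (fun w => deviation (runState g W η q x0 R r (t + 1) w).xPrev
    + deviation (runState g W η q x0 R r t w).xPrev) P := i1.add i2
  rw [integral_add i12 (i3.const_mul _), integral_add i1 i2, integral_const_mul]

/-- Contraction of the consensus error of the iterates. -/
theorem ValidRun.integral_deviation_xPrev_succ_le (h : ValidRun D f g σ L G W p q P r) {δ : ℝ}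
    (hδ0 : 0 ≤ δ) (hmix : ∀ t φ, deviation (d := d) (fastMix W (R t) φ) ≤ δ * deviation φ)
    (t : ℕ) :
    ∫ w, deviation (runState g W η q x0 R r (t + 1) w).xPrev ∂P
      ≤ 2 * δ * (∫ w, deviation (runState g W η q x0 R r t w).xPrev ∂P
        + η ^ 2 * ∫ w, deviation (runState g W η q x0 R r t w).s ∂P) := by
  have hS := h.memLpState (η := η) (x0 := x0) (R := R) t
  have i1 : Integrable (fun w => deviation (runState g W η q x0 R r (t + 1) w).xPrev) P :=
    integrable_deviation hS.x
  have i2 := integrable_deviation hS.xPrev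
  have i3 := integrable_deviation hS.s
  rw [← integral_const_mul, ← integral_add i2 (i3.const_mul _), ← integral_const_mul]
  refine integral_mono i1 ((i2.add (i3.const_mul _)).const_mul _) fun w => ?_
  have e : (runState g W η q x0 R r (t + 1) w).xPrev = (runState g W η q x0 R r t w).x := rfl
  dsimp only
  rw [e, runState_x]
  refine (hmix _ _).trans ?_
  have h1 := deviation_add_le (runState g W η q x0 R r t w).xPrev
    (fun i => (-η) • (runState g W η q x0 R r t w).s i)
  rw [deviation_smul] at h1
  simp only [neg_smul, ← sub_eq_add_neg, neg_sq] at h1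
  have h2 := mul_le_mul_of_nonneg_left h1 hδ0
  linarith

/-- Contraction of the consensus error of the gradient trackers. -/
theorem ValidRun.integral_deviation_s_succ_le (h : ValidRun D f g σ L G W p q P r) {δ : ℝ}
    (hδ0 : 0 ≤ δ) (hmix : ∀ t φ, deviation (d := d) (fastMix W (R t) φ) ≤ δ * deviation φ)
    (t : ℕ) :
    ∫ w, deviation (runState g W η q x0 R r (t + 1) w).s ∂P
      ≤ 2 * δ * (∫ w, deviation (runState g W η q x0 R r t w).s ∂P
        + 3 * (∫ w, ∑ i, ‖estError f (runState g W η q x0 R r (t + 1) w) i‖ ^ 2 ∂P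
          + ∫ w, ∑ i, ‖estError f (runState g W η q x0 R r t w) i‖ ^ 2 ∂P
          + 3 * m * L ^ 2 * ∫ w, movement (runState g W η q x0 R r t w) ∂P)) := by
  have hS := h.memLpState (η := η) (x0 := x0) (R := R) t
  have hS' := h.memLpState (η := η) (x0 := x0) (R := R) (t + 1)
  have i1 := integrable_deviation hS'.s
  have i2 := integrable_deviation hS.s
  have i3 := integrable_sum_norm_sq (hS'.memLp_estError h.var h.smooth)
  have i4 := integrable_sum_norm_sq (hS.memLp_estError h.var h.smooth)
  have i5 := hS.integrable_movement
  have i34 : Integrable (fun w => ∑ i, ‖estError f (runState g W η q x0 R r (t + 1) w) i‖ ^ 2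
    + ∑ i, ‖estError f (runState g W η q x0 R r t w) i‖ ^ 2) P := i3.add i4
  have i345 : Integrable (fun w => ∑ i, ‖estError f (runState g W η q x0 R r (t + 1) w) i‖ ^ 2
    + ∑ i, ‖estError f (runState g W η q x0 R r t w) i‖ ^ 2
    + 3 * m * L ^ 2 * movement (runState g W η q x0 R r t w)) P := i34.add (i5.const_mul _)
  rw [← integral_const_mul (3 * m * L ^ 2), ← integral_add i3 i4,
    ← integral_add i34 (i5.const_mul _), ← integral_const_mul 3,
    ← integral_add i2 (i345.const_mul _), ← integral_const_mul]
  refine integral_mono i1 ((i2.add (i345.const_mul _)).const_mul _) fun w => ?_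
  set S := runState g W η q x0 R r t w with hSdef
  set S' := runState g W η q x0 R r (t + 1) w with hSdef'
  have e : S'.s = fastMix W (R (t + 1)) fun i => S.s i + S'.y i - S.y i := rfl
  have ex : S'.xPrev = S.x := rfl
  dsimp only
  rw [e]
  refine (hmix _ _).trans ?_
  have h1 := deviation_add_le S.s (fun i => S'.y i - S.y i)
  simp only [← add_sub_assoc] at h1
  have h2 := deviation_le_sum_sq h.pos (fun i => S'.y i - S.y i)
  -- The increment of `y` is the new error minus the old one plus a difference of gradients.
  have h3 : ∑ i, ‖S'.y i - S.y i‖ ^ 2 ≤ ∑ i, 3 * (‖estError f S' i‖ ^ 2 + ‖estError f S i‖ ^ 2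
      + ∫ ξ, ‖g i (S.x i) ξ - g i (S.xPrev i) ξ‖ ^ 2 ∂(D i)) := by
    refine Finset.sum_le_sum fun i _ => ?_
    have e1 : S'.y i - S.y i = estError f S' i + (-estError f S i)
        + (gradient (f i) (S.x i) - gradient (f i) (S.xPrev i)) := by
      rw [estError, estError, ex]; abel
    have e2 := norm_add_add_sq_le_three (estError f S' i) (-estError f S i)
      (gradient (f i) (S.x i) - gradient (f i) (S.xPrev i))
    rw [← e1, norm_neg] at e2
    have e3 := h.var.norm_gradient_sub_sq_le i (S.x i) (S.xPrev i)
    linarith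
  rw [← Finset.mul_sum, Finset.sum_add_distrib, Finset.sum_add_distrib] at h3
  have h4 := sum_integral_norm_sub_sq_le h.var h.smooth h.pos S.x S.xPrev
  have h5 : deviation (fun i => S.s i + S'.y i - S.y i) ≤ 2 * (deviation S.s
      + 3 * (∑ i, ‖estError f S' i‖ ^ 2 + ∑ i, ‖estError f S i‖ ^ 2
        + 3 * m * L ^ 2 * movement S)) := by
    unfold movement
    linarith
  have h6 := mul_le_mul_of_nonneg_left h5 hδ0
  linarith

/-- The first estimators scatter around the local gradients at `x0`, which need not agree; only the
mixing at iteration 0 reduces this. -/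
theorem ValidRun.integral_deviation_s_zero_le (h : ValidRun D f g σ L G W p q P r) {δ c : ℝ}
    (hδ0 : 0 ≤ δ) (hmix : ∀ φ, deviation (d := d) (fastMix W (R 0) φ) ≤ δ * deviation φ)
    (hc : ∑ i, σ i ^ 2 / B i ≤ c) :
    ∫ w, deviation (runState g W η q x0 R r 0 w).s ∂P
      ≤ δ * (2 * c + 2 * initialGradSize f x0 ^ 2) := by
  have hS := h.memLpState (η := η) (x0 := x0) (R := R) 0
  have hU := (h.integral_error_zero_le (η := η) (x0 := x0) (R := R)).1
  have h1 : ∫ w, deviation (runState g W η q x0 R r 0 w).s ∂P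
      ≤ ∫ w, δ * (2 * ∑ i, ‖estError f (runState g W η q x0 R r 0 w) i‖ ^ 2
        + 2 * initialGradSize f x0 ^ 2) ∂P := by
    refine integral_mono (integrable_deviation hS.s)
      (((hU.1.const_mul 2).add (integrable_const _)).const_mul δ) fun w => ?_
    set S := runState g W η q x0 R r 0 w with hSdef
    have e : S.s = fastMix W (R 0) S.y := rfl
    dsimp only
    rw [e]
    refine (hmix _).trans (mul_le_mul_of_nonneg_left ?_ hδ0)
    refine (deviation_le_sum_sq h.pos _).trans ?_
    rw [initialGradSize, Real.sq_sqrt (Finset.sum_nonneg fun _ _ => by positivity),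
      Finset.mul_sum, Finset.mul_sum, ← Finset.sum_add_distrib]
    refine Finset.sum_le_sum fun i _ => ?_
    have h2 := norm_add_sq_le_two (estError f S i) (gradient (f i) x0)
    have h3 : estError f S i + gradient (f i) x0 = S.y i := by
      have : S.xPrev i = x0 := rfl
      rw [estError, this, sub_add_cancel]
    rwa [h3] at h2
  refine h1.trans ?_
  rw [integral_const_mul, integral_add (hU.1.const_mul 2) (integrable_const _),
    integral_const_mul, integral_const, probReal_univ, one_smul]
  have h2 := hU.2.trans hc
  gcongr

/-- The average of the expected squared gradient norms at the iterates of any node. -/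
theorem ValidRun.sum_integral_norm_gradient_sq_le (h : ValidRun D f g σ L G W p q P r)
    (hbdd : BddBelow (Set.range (avgFun f))) (hη : η = 1 / (48 * L)) {ε δ δ' : ℝ} (hε : 0 < ε)
    (hp : 0 < (p : ℝ)) (hpq : (1 - (p : ℝ)) * (1 / ((b : ℝ) * q)) = p * m)
    (hc : ∑ i, σ i ^ 2 / B i ≤ m ^ 2 * ε ^ 2 / 32) (hδ0 : 0 ≤ δ)
    (hδ : δ ≤ 1 / (1000 * (m : ℝ) ^ 2))
    (hmix : ∀ t φ, deviation (d := d) (fastMix W (R t) φ) ≤ δ * deviation φ) (hδ0' : 0 ≤ δ')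
    (hδ' : δ' * (2 * (m ^ 2 * ε ^ 2 / 32) + 2 * initialGradSize f x0 ^ 2) ≤ ε ^ 2 / 10)
    (hmix' : ∀ φ, deviation (d := d) (fastMix W (R 0) φ) ≤ δ' * deviation φ) {T : ℕ}
    (hT : 384 * initialGap f x0 * L / ε ^ 2 + 2 / (p : ℝ) ≤ T) (i : Fin m) :
    (∀ t, Integrable (fun w =>
      ‖gradient (avgFun f) ((runState g W η q x0 R r t w).xPrev i)‖ ^ 2) P) ∧
    ∑ t ∈ Finset.range (T + 1),
      ∫ w, ‖gradient (avgFun f) ((runState g W η q x0 R r t w).xPrev i)‖ ^ 2 ∂P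
      ≤ ((T : ℝ) + 1) * ε ^ 2 := by
  have hS := h.memLpState (η := η) (x0 := x0) (R := R)
  have hgradm : ∀ {u : Ω → EuclideanSpace ℝ (Fin d)}, MemLp u 2 P →
      Integrable (fun w => ‖gradient (avgFun f) (u w)‖ ^ 2) P := by
    intro u hu
    have h1 : MemLp (fun w => avg fun i => gradient (f i) (u w)) 2 P :=
      memLp_avg fun i => memLp_gradient h.var h.smooth i hu
    simp_rw [gradient_avgFun h.diff]
    exact h1.integrable_norm_pow (p := 2) (by norm_num)
  have iF := fun t => hgradm (memLp_avg (hS t).xPrev)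
  have iX := fun t => integrable_deviation (hS t).xPrev
  have iQ := fun t => integrable_norm_sum_sq ((hS t).memLp_estError h.var h.smooth)
  have iA : ∀ t, Integrable (fun w => ‖avg (runState g W η q x0 R r t w).y‖ ^ 2) P := fun t =>
    (memLp_avg (hS t).y).integrable_norm_pow (p := 2) (by norm_num)
  refine ⟨fun t => hgradm ((hS t).xPrev i), ?_⟩
  -- The balance `hpq` extracts a factor `p`, as the summation of the variance recursion requires.
  have hvar : ∀ t, (1 - (p : ℝ)) * (1 / ((b : ℝ) * q) * (3 * m * L ^ 2)
      * ∫ w, movement (runState g W η q x0 R r t w) ∂P)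
      = p * (3 * (m : ℝ) ^ 2 * L ^ 2) * (∫ w, deviation (runState g W η q x0 R r (t + 1) w).xPrev ∂P
        + ∫ w, deviation (runState g W η q x0 R r t w).xPrev ∂P
        + η ^ 2 * ∫ w, ‖avg (runState g W η q x0 R r t w).y‖ ^ 2 ∂P) := by
    intro t
    rw [← h.integral_movement]
    linear_combination 3 * m * L ^ 2 * (∫ w, movement (runState g W η q x0 R r t w) ∂P) * hpq
  have hdesc : ∑ t ∈ Finset.range (T + 1),
      ∫ w, ‖gradient (avgFun f) (avg (runState g W η q x0 R r t w).xPrev)‖ ^ 2 ∂P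
      ≤ 96 * L * initialGap f x0 + ∑ t ∈ Finset.range (T + 1),
        (2 / (m : ℝ) ^ 2 * ∫ w, ‖∑ i, estError f (runState g W η q x0 R r t w) i‖ ^ 2 ∂P
          + 2 * L ^ 2 * ∫ w, deviation (runState g W η q x0 R r t w).xPrev ∂P
          - 47 / 48 * ∫ w, ‖avg (runState g W η q x0 R r t w).y‖ ^ 2 ∂P) := by
    have i12 : ∀ t, Integrable (fun w =>
        2 / (m : ℝ) ^ 2 * ‖∑ i, estError f (runState g W η q x0 R r t w) i‖ ^ 2
        + 2 * L ^ 2 * deviation (runState g W η q x0 R r t w).xPrev) P :=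
      fun t => ((iQ t).const_mul _).add ((iX t).const_mul _)
    have i123 : ∀ t, Integrable (fun w =>
        2 / (m : ℝ) ^ 2 * ‖∑ i, estError f (runState g W η q x0 R r t w) i‖ ^ 2
        + 2 * L ^ 2 * deviation (runState g W η q x0 R r t w).xPrev
        - 47 / 48 * ‖avg (runState g W η q x0 R r t w).y‖ ^ 2) P :=
      fun t => (i12 t).sub ((iA t).const_mul _)
    have h1 := integral_mono (integrable_finsetSum (Finset.range (T + 1)) fun t _ => iF t)
      ((integrable_const (96 * L * initialGap f x0)).add
        (integrable_finsetSum (Finset.range (T + 1)) fun t _ => i123 t))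
      (fun w => h.sum_norm_gradient_sq_le (x0 := x0) (R := R) hbdd hη (T + 1) w)
    rw [integral_finsetSum _ fun t _ => iF t, integral_add' (integrable_const _)
      (integrable_finsetSum _ fun t _ => i123 t), integral_finsetSum _ fun t _ => i123 t,
      integral_const, probReal_univ, one_smul] at h1
    refine h1.trans_eq ?_
    congr 1
    refine Finset.sum_congr rfl fun t _ => ?_
    rw [integral_sub (i12 t) ((iA t).const_mul _), integral_add ((iQ t).const_mul _)
      ((iX t).const_mul _), integral_const_mul, integral_const_mul, integral_const_mul]
  have hmain := sum_gradient_le_of_recursions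
    (X := fun t => ∫ w, deviation (runState g W η q x0 R r t w).xPrev ∂P)
    (S := fun t => ∫ w, deviation (runState g W η q x0 R r t w).s ∂P)
    (A := fun t => ∫ w, ‖avg (runState g W η q x0 R r t w).y‖ ^ 2 ∂P)
    (U := fun t => ∫ w, ∑ i, ‖estError f (runState g W η q x0 R r t w) i‖ ^ 2 ∂P)
    (Q := fun t => ∫ w, ‖∑ i, estError f (runState g W η q x0 R r t w) i‖ ^ 2 ∂P)
    (F := fun t => ∫ w, ‖gradient (avgFun f) (avg (runState g W η q x0 R r t w).xPrev)‖ ^ 2 ∂P)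
    (m := m) (p := p) (T := T) (c := ∑ i, σ i ^ 2 / B i)
    (fun t => integral_nonneg fun w => deviation_nonneg _)
    (fun t => integral_nonneg fun w => deviation_nonneg _)
    (fun t => integral_nonneg fun w => by positivity)
    (fun t => integral_nonneg fun w => by positivity)
    (fun t => integral_nonneg fun w => by positivity)
    (by exact_mod_cast h.pos) h.smooth.const_pos hε hη hδ0 hδ hp p.2.2 hc hδ' hT
    (initialGap_nonneg hbdd x0)
    (le_of_eq (by
      have : ∀ w, deviation (runState g W η q x0 R r 0 w).xPrev = 0 := fun w =>
        deviation_const h.pos x0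
      simp [this]))
    (fun t => h.integral_deviation_xPrev_succ_le hδ0 hmix t)
    (h.integral_deviation_s_zero_le hδ0' hmix' hc)
    (fun t => by
      have := h.integral_deviation_s_succ_le (η := η) (x0 := x0) hδ0 hmix t
      rwa [h.integral_movement] at this)
    h.integral_error_zero_le.1.2
    (fun t => by
      have h1 := (h.integral_sum_norm_sq_succ_le (η := η) (x0 := x0) (R := R) t (hS t)).2
      have h2 := hvar t
      linarith)
    h.integral_error_zero_le.2
    (fun t => by
      have h1 := h.integral_norm_sum_sq_succ_le (η := η) (x0 := x0) (R := R) t (hS t)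
      have h2 := hvar t
      linarith)
    hdesc
  -- Passage from the average to node `i`: smoothness bounds the gradient difference by `L ^ 2`
  -- times the deviation.
  refine le_trans ?_ hmain
  rw [Finset.mul_sum, Finset.mul_sum, ← Finset.sum_add_distrib]
  refine Finset.sum_le_sum fun t _ => ?_
  rw [← integral_const_mul, ← integral_const_mul,
    ← integral_add ((iF t).const_mul _) ((iX t).const_mul _)]
  refine integral_mono (hgradm ((hS t).xPrev i)) (((iF t).const_mul _).add ((iX t).const_mul _))
    fun w => ?_
  set x := (runState g W η q x0 R r t w).xPrev
  have h1 := norm_add_sq_le_two (gradient (avgFun f) (avg x))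
    (gradient (avgFun f) (x i) - gradient (avgFun f) (avg x))
  rw [add_sub_cancel] at h1
  have h2 := norm_gradient_avgFun_sub_sq_le h.diff h.var h.smooth (x i) (avg x)
  have h3 := mul_le_mul_of_nonneg_left (norm_sub_avg_sq_le x i) (sq_nonneg L)
  simp only
  linarith

end Expectation

/-! ### The parameter choices -/

section Parameters

variable {m : ℕ} {B : Fin m → ℕ}

theorem sqrtTotal_sq (B : Fin m → ℕ) : sqrtTotal B ^ 2 = ∑ i, (B i : ℝ) :=
  Real.sq_sqrt (Finset.sum_nonneg fun _ _ => Nat.cast_nonneg _)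

theorem one_le_sqrtTotal (hm : 0 < m) (hB : ∀ i, 1 ≤ B i) : 1 ≤ sqrtTotal B := by
  refine Real.one_le_sqrt.2 ?_
  have h := Finset.single_le_sum (f := fun i => (B i : ℝ)) (fun _ _ => Nat.cast_nonneg _)
    (Finset.mem_univ ⟨0, hm⟩)
  have h2 : (1 : ℝ) ≤ B ⟨0, hm⟩ := by exact_mod_cast hB _
  linarith

theorem miniBatch_pos (hm : 0 < m) (hB : ∀ i, 1 ≤ B i) : 0 < miniBatch B := by
  have := one_le_sqrtTotal hm hB
  exact Nat.ceil_pos.2 (by positivity)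

theorem miniBatch_mul_skipProb (hm : 0 < m) (hB : ∀ i, 1 ≤ B i) :
    (miniBatch B : ℝ) * (skipProb B : ℝ) = sqrtTotal B / m := by
  have hb : (0 : ℝ) < miniBatch B := by exact_mod_cast miniBatch_pos hm hB
  have hm' : (0 : ℝ) < m := by exact_mod_cast hm
  simp only [skipProb]
  field_simp

theorem skipProb_pos (hm : 0 < m) (hB : ∀ i, 1 ≤ B i) : 0 < (skipProb B : ℝ) := by
  have h1 := one_le_sqrtTotal hm hB
  have hb : (0 : ℝ) < miniBatch B := by exact_mod_cast miniBatch_pos hm hB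
  have hm' : (0 : ℝ) < m := by exact_mod_cast hm
  simp only [skipProb]
  positivity

/-- `b` is the ceiling of bq, so b - 1 < bq. -/
theorem one_sub_skipProb_le (hm : 0 < m) (hB : ∀ i, 1 ≤ B i) :
    1 - (skipProb B : ℝ) ≤ 1 / (miniBatch B : ℝ) := by
  have hb : (0 : ℝ) < miniBatch B := by exact_mod_cast miniBatch_pos hm hB
  have h1 := miniBatch_mul_skipProb hm hB
  have h2 : (miniBatch B : ℝ) < sqrtTotal B / m + 1 :=
    Nat.ceil_lt_add_one (by have := one_le_sqrtTotal hm hB; positivity)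
  rw [le_div_iff₀ hb]
  linarith

theorem resetProb_eq (hm : 0 < m) (hB : ∀ i, 1 ≤ B i) :
    (resetProb B : ℝ) = 1 / (1 + sqrtTotal B) := by
  have h1 := one_le_sqrtTotal hm hB
  have hm' : (0 : ℝ) < m := by exact_mod_cast hm
  simp only [resetProb]
  rw [miniBatch_mul_skipProb hm hB, ← sqrtTotal_sq]
  field_simp

theorem resetProb_pos (hm : 0 < m) (hB : ∀ i, 1 ≤ B i) : 0 < (resetProb B : ℝ) := by
  rw [resetProb_eq hm hB]
  have := one_le_sqrtTotal hm hB
  positivity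

/-- With N = `sqrtTotal B`, p = 1/(1+N) gives 1-p = pN, while bq = N/m. -/
theorem one_sub_resetProb_mul (hm : 0 < m) (hB : ∀ i, 1 ≤ B i) :
    (1 - (resetProb B : ℝ)) * (1 / ((miniBatch B : ℝ) * skipProb B)) = resetProb B * m := by
  have h1 := one_le_sqrtTotal hm hB
  have hm' : (0 : ℝ) < m := by exact_mod_cast hm
  rw [resetProb_eq hm hB, miniBatch_mul_skipProb hm hB]
  field_simp
  ring

variable {σ : Fin m → ℝ} {ε : ℝ}

theorem one_le_largeBatch (σ : Fin m → ℝ) (ε : ℝ) (i : Fin m) : 1 ≤ largeBatch σ ε i :=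
  le_max_right _ _

/-- Taking B i proportional to σ i makes each term proportional to σ i, so the terms add up exactly
to the target. -/
theorem sum_sq_div_largeBatch_le (hσ : ∀ i, 0 < σ i) (hε : 0 < ε) :
    ∑ i, σ i ^ 2 / (largeBatch σ ε i : ℝ) ≤ (m : ℝ) ^ 2 * ε ^ 2 / 32 := by
  rcases Nat.eq_zero_or_pos m with rfl | hm
  · simp
  have hm' : (0 : ℝ) < m := by exact_mod_cast hm
  have hs : 0 < ∑ j, σ j := Finset.sum_pos (fun j _ => hσ j) ⟨⟨0, hm⟩, Finset.mem_univ _⟩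
  have h : ∀ i, σ i ^ 2 / (largeBatch σ ε i : ℝ)
      ≤ σ i * ((m : ℝ) ^ 2 * ε ^ 2 / (32 * ∑ j, σ j)) := by
    intro i
    have hi := hσ i
    have h1 : 32 * σ i * (∑ j, σ j) / ((m : ℝ) ^ 2 * ε ^ 2) ≤ largeBatch σ ε i :=
      (Nat.le_ceil _).trans (Nat.cast_le.2 (le_max_left _ _))
    have h2 : 0 < 32 * σ i * (∑ j, σ j) / ((m : ℝ) ^ 2 * ε ^ 2) := by positivity
    calc σ i ^ 2 / (largeBatch σ ε i : ℝ)
        ≤ σ i ^ 2 / (32 * σ i * (∑ j, σ j) / ((m : ℝ) ^ 2 * ε ^ 2)) := by gcongr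
      _ = σ i * ((m : ℝ) ^ 2 * ε ^ 2 / (32 * ∑ j, σ j)) := by field_simp
  refine (Finset.sum_le_sum fun i _ => h i).trans (le_of_eq ?_)
  rw [← Finset.sum_mul]
  field_simp

theorem sigmaAM_pos (hm : 0 < m) (hσ : ∀ i, 0 < σ i) : 0 < sigmaAM σ := by
  have hm' : (0 : ℝ) < m := by exact_mod_cast hm
  have hs : 0 < ∑ j, σ j := Finset.sum_pos (fun j _ => hσ j) ⟨⟨0, hm⟩, Finset.mem_univ _⟩
  unfold sigmaAM
  positivity

theorem sqrtTotal_largeBatch_sq_le (hm : 0 < m) (hσ : ∀ i, 0 < σ i) (hε : 0 < ε) :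
    sqrtTotal (largeBatch σ ε) ^ 2 ≤ 32 * sigmaAM σ ^ 2 / ε ^ 2 + m := by
  have hm' : (0 : ℝ) < m := by exact_mod_cast hm
  have hs : 0 < ∑ j, σ j := Finset.sum_pos (fun j _ => hσ j) ⟨⟨0, hm⟩, Finset.mem_univ _⟩
  have h : ∀ i, (largeBatch σ ε i : ℝ) ≤ 32 * σ i * (∑ j, σ j) / ((m : ℝ) ^ 2 * ε ^ 2) + 1 := by
    intro i
    have hi := hσ i
    have h0 : 0 ≤ 32 * σ i * (∑ j, σ j) / ((m : ℝ) ^ 2 * ε ^ 2) := by positivity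
    unfold largeBatch
    rw [Nat.cast_max, Nat.cast_one]
    exact max_le (Nat.ceil_lt_add_one h0).le (by linarith)
  rw [sqrtTotal_sq]
  refine (Finset.sum_le_sum fun i _ => h i).trans (le_of_eq ?_)
  rw [Finset.sum_add_distrib, ← Finset.sum_div, ← Finset.sum_mul, ← Finset.mul_sum, sigmaAM]
  simp
  field_simp

theorem sqrtTotal_largeBatch_le (hm : 0 < m) (hσ : ∀ i, 0 < σ i) (hε : 0 < ε) :
    sqrtTotal (largeBatch σ ε) ≤ 6 * sigmaAM σ / ε + Real.sqrt m := by
  have hs := sigmaAM_pos hm hσ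
  refine le_of_sq_le_sq ((sqrtTotal_largeBatch_sq_le hm hσ hε).trans ?_) (by positivity)
  have h1 : Real.sqrt m ^ 2 = m := Real.sq_sqrt (Nat.cast_nonneg _)
  have h2 : 0 ≤ 6 * sigmaAM σ / ε * Real.sqrt m := by positivity
  have h3 : (6 * sigmaAM σ / ε + Real.sqrt m) ^ 2
      = 36 * sigmaAM σ ^ 2 / ε ^ 2 + 2 * (6 * sigmaAM σ / ε * Real.sqrt m) + m := by
    linear_combination (norm := (field_simp; ring)) h1
  have h4 : 32 * sigmaAM σ ^ 2 / ε ^ 2 ≤ 36 * sigmaAM σ ^ 2 / ε ^ 2 := by gcongr; norm_num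
  rw [h3]
  linarith

/-- 2/p = 2 + 2N and the ceiling adds one; the constant 3 is absorbed using N ≥ 1. -/
theorem horizon_bounds (hm : 0 < m) (hB : ∀ i, 1 ≤ B i) {Δ L : ℝ} (hΔ : 0 ≤ Δ) (hL : 0 < L)
    (hε : 0 < ε) :
    384 * Δ * L / ε ^ 2 + 2 / (resetProb B : ℝ) ≤ horizon Δ L ε (resetProb B) ∧
    (horizon Δ L ε (resetProb B) : ℝ) ≤ 384 * (Δ * L / ε ^ 2) + 5 * sqrtTotal B := by
  refine ⟨Nat.le_ceil _, ?_⟩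
  have hs := one_le_sqrtTotal hm hB
  have hp := resetProb_pos hm hB
  refine (Nat.ceil_lt_add_one (by positivity)).le.trans ?_
  have h1 : 2 / (resetProb B : ℝ) = 2 * (1 + sqrtTotal B) := by
    rw [resetProb_eq hm hB]; field_simp
  have h2 : 384 * Δ * L / ε ^ 2 = 384 * (Δ * L / ε ^ 2) := by ring
  rw [h1, h2]
  linarith

end Parameters

/-! ### The number of FastMix rounds -/

section Rounds

variable {m d : ℕ} {G : SimpleGraph (Fin m)} {W : Matrix (Fin m) (Fin m) ℝ}

theorem deviation_eq_zero_of_one (φ : Fin 1 → EuclideanSpace ℝ (Fin d)) : deviation φ = 0 := by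
  have : φ = fun _ => φ 0 := funext fun i => by rw [Subsingleton.elim i 0]
  rw [this]
  exact deviation_const one_pos _

theorem deviation_fastMix_le_of_rounds (hW : AdmissibleMixing G W) (hm : 0 < m) {M : ℝ}
    (hM : 0 < M) {R : ℕ} (hR : 40 / Real.sqrt (spectralGap W) * Real.log M ≤ R)
    (φ : Fin m → EuclideanSpace ℝ (Fin d)) :
    deviation (fastMix W R φ) ≤ 9 / M ^ 20 * deviation φ := by
  refine (deviation_fastMix_le hW hm φ R).trans
    (mul_le_mul_of_nonneg_right ?_ (deviation_nonneg φ))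
  have hχ : 0 < Real.sqrt (spectralGap W) := Real.sqrt_pos.2 (hW.spectralGap_pos hm).1
  have h1 : 40 * Real.log M ≤ Real.sqrt (spectralGap W) * R := by
    calc 40 * Real.log M
        = Real.sqrt (spectralGap W) * (40 / Real.sqrt (spectralGap W) * Real.log M) := by
          field_simp
      _ ≤ Real.sqrt (spectralGap W) * R := by gcongr
  have h2 : Real.exp (-Real.sqrt (spectralGap W) * R / 2) ≤ (M ^ 20)⁻¹ := by
    have h3 : (M ^ 20)⁻¹ = Real.exp (-(20 * Real.log M)) := by
      rw [Real.exp_neg]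
      congr 1
      have := Real.exp_nat_mul (Real.log M) 20
      rw [Real.exp_log hM] at this
      rw [← this]; norm_num
    rw [h3]
    refine Real.exp_le_exp.2 ?_
    linarith
  exact mul_le_mul_of_nonneg_left h2 (by norm_num)

/-- Eighteen of the twenty powers pay for numerical constants, and two remain for the polynomial
factor. -/
theorem two_pow_mul_sq_le {M : ℝ} (hM : 2 ≤ M) : 262144 * M ^ 2 ≤ M ^ 20 := by
  have h1 : (2 : ℝ) ^ 18 ≤ M ^ 18 := by gcongr
  have h2 : (2 : ℝ) ^ 18 = 262144 := by norm_num
  calc 262144 * M ^ 2 = 2 ^ 18 * M ^ 2 := by rw [h2]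
    _ ≤ M ^ 18 * M ^ 2 := by gcongr
    _ = M ^ 20 := by ring

theorem deviation_fastMix_mixRounds_le (hW : AdmissibleMixing G W) (hm : 0 < m) {G₀ ε : ℝ}
    (hG : 0 ≤ G₀) (hε : 0 < ε) (t : ℕ) (φ : Fin m → EuclideanSpace ℝ (Fin d)) :
    deviation (fastMix W (mixRounds 40 (spectralGap W) m G₀ ε t) φ)
      ≤ 1 / (1000 * (m : ℝ) ^ 2) * deviation φ := by
  have hm' : (0 : ℝ) < m := by exact_mod_cast hm
  -- For a single node log m = 0 may prescribe no rounds at all, but the deviation is identically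
  -- zero.
  rcases (Nat.succ_le_of_lt hm).eq_or_lt with h1 | h1
  · obtain rfl : m = 1 := h1.symm
    rw [deviation_eq_zero_of_one, deviation_eq_zero_of_one]
    simp
  · have h2 : (2 : ℝ) ≤ m := by exact_mod_cast h1
    have hR : 40 / Real.sqrt (spectralGap W) * Real.log m
        ≤ (mixRounds 40 (spectralGap W) m G₀ ε t : ℝ) := by
      unfold mixRounds
      split_ifs
      · refine le_trans ?_ (Nat.le_ceil _)
        have : 0 ≤ G₀ / ε := by positivity
        gcongr
        linarith
      · exact Nat.le_ceil _
    refine (deviation_fastMix_le_of_rounds hW hm hm' hR φ).trans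
      (mul_le_mul_of_nonneg_right ?_ (deviation_nonneg φ))
    have h3 := two_pow_mul_sq_le h2
    have h4 : 0 < (m : ℝ) ^ 2 := by positivity
    rw [div_le_div_iff₀ (by positivity) (by positivity)]
    linarith

/-- For M = m + G₀/ε, the quantity M²ε² dominates m²ε² + G₀², which is why this sum stands inside
the logarithm. -/
theorem exists_deviation_fastMix_mixRounds_zero_le (hW : AdmissibleMixing G W) (hm : 0 < m)
    {G₀ ε : ℝ} (hG : 0 ≤ G₀) (hε : 0 < ε) :
    ∃ δ : ℝ, 0 ≤ δ ∧ δ * (2 * ((m : ℝ) ^ 2 * ε ^ 2 / 32) + 2 * G₀ ^ 2) ≤ ε ^ 2 / 10 ∧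
      ∀ φ : Fin m → EuclideanSpace ℝ (Fin d),
        deviation (fastMix W (mixRounds 40 (spectralGap W) m G₀ ε 0) φ) ≤ δ * deviation φ := by
  rcases (Nat.succ_le_of_lt hm).eq_or_lt with h1 | h1
  · obtain rfl : m = 1 := h1.symm
    refine ⟨0, le_rfl, by rw [zero_mul]; positivity, fun φ => ?_⟩
    rw [deviation_eq_zero_of_one]
    simp
  · have h2 : (2 : ℝ) ≤ m := by exact_mod_cast h1
    have hGε : 0 ≤ G₀ / ε := by positivity
    obtain ⟨M, hM⟩ : ∃ M, M = (m : ℝ) + G₀ / ε := ⟨_, rfl⟩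
    have hM2 : 2 ≤ M := by rw [hM]; linarith
    have hM0 : 0 < M := by linarith
    refine ⟨9 / M ^ 20, by positivity, ?_, fun φ => ?_⟩
    · have h3 := two_pow_mul_sq_le hM2
      have h4 : (m : ℝ) ^ 2 * ε ^ 2 + G₀ ^ 2 ≤ M ^ 2 * ε ^ 2 := by
        have h5 : G₀ ^ 2 = (G₀ / ε) ^ 2 * ε ^ 2 := by field_simp
        have h6 : (m : ℝ) ^ 2 + (G₀ / ε) ^ 2 ≤ M ^ 2 := by
          rw [hM]
          have : 0 ≤ (m : ℝ) * (G₀ / ε) := by positivity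
          linarith [sq_nonneg ((m : ℝ) + G₀ / ε), add_sq (m : ℝ) (G₀ / ε)]
        rw [h5, ← add_mul]
        gcongr
      have h7 : 0 ≤ (m : ℝ) ^ 2 * ε ^ 2 := by positivity
      have h8 : 2 * ((m : ℝ) ^ 2 * ε ^ 2 / 32) + 2 * G₀ ^ 2 ≤ 2 * (M ^ 2 * ε ^ 2) := by
        linarith
      have h9 : 0 ≤ M ^ 2 * ε ^ 2 := by positivity
      calc 9 / M ^ 20 * (2 * ((m : ℝ) ^ 2 * ε ^ 2 / 32) + 2 * G₀ ^ 2)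
          ≤ 9 / (262144 * M ^ 2) * (2 * (M ^ 2 * ε ^ 2)) := by gcongr
        _ = 18 / 262144 * ε ^ 2 := by field_simp; ring
        _ ≤ ε ^ 2 / 10 := by linarith [sq_nonneg ε]
    · refine deviation_fastMix_le_of_rounds hW hm hM0 ?_ φ
      rw [mixRounds, if_pos rfl, hM]
      exact Nat.le_ceil _

theorem mixRounds_le {χ G₀ ε : ℝ} (hm : 0 < m) (hχ0 : 0 < χ) (hχ1 : χ ≤ 1) (hG : 0 ≤ G₀)
    (hε : 0 < ε) (t : ℕ) :
    (mixRounds 40 χ m G₀ ε t : ℝ) ≤ 41 / Real.sqrt χ * (1 + Real.log ((m : ℝ) + G₀ / ε)) := by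
  have hm1 : (1 : ℝ) ≤ m := by exact_mod_cast hm
  have hGε : 0 ≤ G₀ / ε := by positivity
  have hs : 0 < Real.sqrt χ := Real.sqrt_pos.2 hχ0
  -- Since `χ ≤ 1`, the unit lost to the ceiling fits into a multiple of `1 / √χ`.
  have hs1 : 1 ≤ 1 / Real.sqrt χ := by
    rw [le_div_iff₀ hs, one_mul]
    exact Real.sqrt_le_one.2 hχ1
  have hlm : 0 ≤ Real.log m := Real.log_nonneg hm1
  have hle : Real.log m ≤ Real.log ((m : ℝ) + G₀ / ε) :=
    Real.log_le_log (by linarith) (by linarith)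
  have hl : 0 ≤ Real.log ((m : ℝ) + G₀ / ε) := hlm.trans hle
  have h1 : (mixRounds 40 χ m G₀ ε t : ℝ)
      ≤ 40 / Real.sqrt χ * Real.log ((m : ℝ) + G₀ / ε) + 1 := by
    unfold mixRounds
    split_ifs
    · exact (Nat.ceil_lt_add_one (by positivity)).le
    · refine (Nat.ceil_lt_add_one (by positivity)).le.trans ?_
      gcongr
  have h2 : 40 / Real.sqrt χ * Real.log ((m : ℝ) + G₀ / ε) + 1
      ≤ 41 / Real.sqrt χ * Real.log ((m : ℝ) + G₀ / ε) + 41 * (1 / Real.sqrt χ) := by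
    gcongr
    · norm_num
    · linarith
  refine (h1.trans h2).trans (le_of_eq ?_)
  ring

theorem commCount_mixRounds_le {χ G₀ ε : ℝ} (hm : 0 < m) (hχ0 : 0 < χ) (hχ1 : χ ≤ 1)
    (hG : 0 ≤ G₀) (hε : 0 < ε) (T : ℕ) :
    (commCount (mixRounds 40 χ m G₀ ε) T : ℝ)
      ≤ 82 * T / Real.sqrt χ * (1 + Real.log ((m : ℝ) + G₀ / ε)) := by
  unfold commCount
  push_cast
  refine (Finset.sum_le_sum fun t _ => mul_le_mul_of_nonneg_left
    (mixRounds_le hm hχ0 hχ1 hG hε t) zero_le_two).trans (le_of_eq ?_)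
  rw [Finset.sum_const, Finset.card_range, nsmul_eq_mul]
  ring

end Rounds

/-! ### The expected number of samples -/

section Samples

variable {m : ℕ} {Ξ : Fin m → Type*} {B : Fin m → ℕ} {b : ℕ}

/-- The number of gradient evaluations of an iteration `t ≥ 1` in terms of its draws. -/
def drawCost (ρ : Draw Ξ B b) : ℝ :=
  if ρ.1 then ∑ i, (B i : ℝ) else ∑ i, if ρ.2.1 i then 2 * (b : ℝ) else 0

theorem norm_drawCost_le (ρ : Draw Ξ B b) :
    ‖drawCost ρ‖ ≤ ∑ i, (B i : ℝ) + ∑ _i : Fin m, 2 * (b : ℝ) := by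
  have h0 : 0 ≤ ∑ i, (B i : ℝ) := Finset.sum_nonneg fun _ _ => Nat.cast_nonneg _
  have h1 : 0 ≤ ∑ i, (if ρ.2.1 i then 2 * (b : ℝ) else 0) :=
    Finset.sum_nonneg fun i _ => by split_ifs <;> positivity
  have h2 : ∑ i, (if ρ.2.1 i then 2 * (b : ℝ) else 0) ≤ ∑ _i : Fin m, 2 * (b : ℝ) :=
    Finset.sum_le_sum fun i _ => by split_ifs <;> first | exact le_rfl | positivity
  rw [drawCost, Real.norm_eq_abs, abs_of_nonneg (by split_ifs <;> assumption)]
  split_ifs <;> linarith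

theorem gradEvals_eq {r : ℕ → Draw Ξ B b} (t : ℕ) :
    (gradEvals r t : ℝ) = if t = 0 then ∑ i, (B i : ℝ) else drawCost (r t) := by
  unfold gradEvals drawCost
  by_cases h : t = 0
  · simp [h]
  · by_cases h2 : (r t).1 <;> simp [h, h2]

variable [∀ i, MeasurableSpace (Ξ i)] {D : ∀ i, Measure (Ξ i)} {p q : unitInterval}
  {Ω : Type*} [MeasurableSpace Ω] {P : Measure Ω}

theorem measurable_drawCost : Measurable (drawCost : Draw Ξ B b → ℝ) := by
  refine Measurable.ite ((measurableSet_singleton true).preimage measurable_fst)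
    measurable_const (Finset.measurable_fun_sum _ fun i _ => Measurable.ite
      ((measurableSet_singleton true).preimage ?_) measurable_const measurable_const)
  exact (measurable_pi_apply i).comp (measurable_fst.comp measurable_snd)

theorem integral_drawCost [∀ i, IsProbabilityMeasure (D i)] :
    Integrable drawCost (drawLaw D B b p q) ∧
    ∫ ρ, drawCost ρ ∂(drawLaw D B b p q)
      = p * ∑ i, (B i : ℝ) + (1 - p) * (m * (q * (2 * b))) := by
  have hint : Integrable drawCost (drawLaw D B b p q) := by
    unfold drawLaw
    exact Integrable.of_bound measurable_drawCost.aestronglyMeasurable _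
      (Filter.Eventually.of_forall norm_drawCost_le)
  refine ⟨hint, ?_⟩
  unfold drawLaw at hint ⊢
  rw [integral_prod _ hint, integral_bernoulliMeasure]
  simp only [drawCost, if_true, Bool.false_eq_true, if_false, smul_eq_mul]
  rw [integral_const, probReal_univ, one_smul,
    integral_fun_fst (fun ω : Fin m → Bool => ∑ i, if ω i then 2 * (b : ℝ) else 0),
    probReal_univ, one_smul, integral_finsetSum _ fun i _ => Integrable.of_finite]
  have h : ∀ i : Fin m, ∫ ω : Fin m → Bool, (if ω i then 2 * (b : ℝ) else 0)
      ∂(Measure.pi fun _ => bernoulliMeasure true false q) = q * (2 * b) := fun i => by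
    rw [integral_pi_bernoulliMeasure q (fun t => if t then 2 * (b : ℝ) else 0) i]
    simp
  simp [h]

theorem integral_sampleCount_le [∀ i, IsProbabilityMeasure (D i)] [IsProbabilityMeasure P]
    {r : ℕ → Ω → Draw Ξ B b} (hr : ∀ t, Measurable (r t))
    (hlaw : ∀ t, P.map (r t) = drawLaw D B b p q) {c : ℝ}
    (hc : p * ∑ i, (B i : ℝ) + (1 - p) * (m * (q * (2 * b))) ≤ c) (T : ℕ) :
    Integrable (fun w => (sampleCount (fun t => r t w) T : ℝ)) P ∧
    ∫ w, (sampleCount (fun t => r t w) T : ℝ) ∂P ≤ ∑ i, (B i : ℝ) + T * c := by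
  have hstep : ∀ t, Integrable (fun w => (gradEvals (fun t => r t w) t : ℝ)) P ∧
      ∫ w, (gradEvals (fun t => r t w) t : ℝ) ∂P ≤ (if t = 0 then ∑ i, (B i : ℝ) else 0) + c := by
    intro t
    simp_rw [gradEvals_eq]
    have hD := integral_drawCost (D := D) (B := B) (b := b) (p := p) (q := q)
    have hc0 : 0 ≤ c := by
      refine le_trans ?_ hc
      have hp := p.2.1
      have hp1 : 0 ≤ 1 - (p : ℝ) := sub_nonneg.2 p.2.2
      have hq := q.2.1
      positivity
    by_cases ht : t = 0
    · simp only [ht, if_true]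
      refine ⟨integrable_const _, ?_⟩
      rw [integral_const, probReal_univ, one_smul]
      linarith
    · simp only [ht, if_false, zero_add]
      rw [← hlaw t] at hD
      refine ⟨(integrable_map_measure measurable_drawCost.aestronglyMeasurable
        (hr t).aemeasurable).1 hD.1, ?_⟩
      rw [integral_map (hr t).aemeasurable measurable_drawCost.aestronglyMeasurable] at hD
      exact hD.2.trans_le hc
  unfold sampleCount
  push_cast
  refine ⟨integrable_finsetSum _ fun t _ => (hstep t).1, ?_⟩
  rw [integral_finsetSum _ fun t _ => (hstep t).1]
  refine (Finset.sum_le_sum fun t _ => (hstep t).2).trans ?_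
  rw [Finset.sum_add_distrib, Finset.sum_const, Finset.card_range, nsmul_eq_mul,
    Finset.sum_ite_eq']
  have : 0 ≤ ∑ i, (B i : ℝ) := Finset.sum_nonneg fun _ _ => Nat.cast_nonneg _
  split_ifs <;> linarith

/-- A reset costs N² with probability 1/(1+N), at most N on average; a mini-batch step costs m·q·2b
= 2N on average. -/
theorem resetProb_cost_le {B : Fin m → ℕ} (hm : 0 < m) (hB : ∀ i, 1 ≤ B i) :
    (resetProb B : ℝ) * ∑ i, (B i : ℝ)
      + (1 - resetProb B) * (m * (skipProb B * (2 * miniBatch B))) ≤ 3 * sqrtTotal B := by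
  have hs := one_le_sqrtTotal hm hB
  have hm' : (0 : ℝ) < m := by exact_mod_cast hm
  have h1 : (m : ℝ) * (skipProb B * (2 * miniBatch B)) = 2 * sqrtTotal B := by
    have := miniBatch_mul_skipProb hm hB
    rw [eq_div_iff hm'.ne'] at this
    linear_combination 2 * this
  rw [h1, ← sqrtTotal_sq, resetProb_eq hm hB]
  have h2 : 1 / (1 + sqrtTotal B) * sqrtTotal B ^ 2 ≤ sqrtTotal B := by
    rw [one_div, inv_mul_le_iff₀ (by positivity)]
    nlinarith
  have h3 : 0 ≤ 1 / (1 + sqrtTotal B) * (2 * sqrtTotal B) := by positivity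
  linarith

end Samples

/-! ### A uniformly distributed output index -/

/-- Split over the value of `τ`; each indicator is independent of `X` and has mean 1/(T+1). -/
theorem integral_uniform_index {Ω V : Type*} [MeasurableSpace Ω] [MeasurableSpace V]
    {P : Measure Ω} [IsProbabilityMeasure P] {T : ℕ} {τ : Ω → Fin (T + 1)} (hτ : Measurable τ)
    (hlaw : P.map τ = (PMF.uniformOfFintype (Fin (T + 1))).toMeasure) {X : Ω → V}
    (hind : IndepFun τ X P) {F : ℕ → V → ℝ} (hF : ∀ t, Measurable (F t))
    (hFi : ∀ t, Integrable (fun w => F t (X w)) P) :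
    Integrable (fun w => F (τ w) (X w)) P ∧
    ∫ w, F (τ w) (X w) ∂P = 1 / ((T : ℝ) + 1) * ∑ t ∈ Finset.range (T + 1),
      ∫ w, F t (X w) ∂P := by
  have hdecomp : ∀ w, F (τ w) (X w)
      = ∑ k : Fin (T + 1), (if τ w = k then (1 : ℝ) else 0) * F k (X w) := by
    intro w
    simp
  set e : Fin (T + 1) → Fin (T + 1) → ℝ := fun k j => if j = k then 1 else 0 with he
  have hem : ∀ k, Measurable (e k) := fun k => measurable_of_finite _
  have hei : ∀ k, Integrable (fun w => e k (τ w)) P := fun k =>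
    Integrable.of_bound ((hem k).comp hτ).aestronglyMeasurable 1
      (Filter.Eventually.of_forall fun w => by simp only [he]; split_ifs <;> simp)
  have hik : ∀ k : Fin (T + 1), IndepFun (fun w => e k (τ w)) (fun w => F k (X w)) P := fun k =>
    hind.comp (hem k) (hF k)
  have hprod : ∀ k : Fin (T + 1), Integrable (fun w => e k (τ w) * F k (X w)) P := fun k =>
    (hik k).integrable_mul (hei k) (hFi k)
  have hmean : ∀ k, ∫ w, e k (τ w) ∂P = 1 / ((T : ℝ) + 1) := by
    intro k
    rw [← integral_map (φ := τ) (f := e k) hτ.aemeasurable (hem k).aestronglyMeasurable, hlaw,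
      PMF.integral_eq_sum]
    have hT : ((T : ENNReal) + 1).toReal = (T : ℝ) + 1 := by
      exact_mod_cast ENNReal.toReal_natCast (T + 1)
    simp [he, hT]
  simp_rw [hdecomp]
  refine ⟨integrable_finsetSum _ fun k _ => hprod k, ?_⟩
  rw [integral_finsetSum _ fun k _ => hprod k,
    ← Fin.sum_univ_eq_sum_range (fun t => ∫ w, F t (X w) ∂P), Finset.mul_sum]
  refine Finset.sum_congr rfl fun k _ => ?_
  rw [← hmean k]
  exact (hik k).integral_fun_mul_eq_mul_integral (hei k).aestronglyMeasurable
    (hFi k).aestronglyMeasurable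

/-! ### The three complexity guarantees -/

section Complexity

theorem iterate_eq_xPrev {m d : ℕ} {Ξ : Fin m → Type*} {B : Fin m → ℕ} {b : ℕ}
    (g : ∀ i, EuclideanSpace ℝ (Fin d) → Ξ i → EuclideanSpace ℝ (Fin d))
    (W : Matrix (Fin m) (Fin m) ℝ) (η q : ℝ) (x0 : EuclideanSpace ℝ (Fin d)) (R : ℕ → ℕ)
    (r : ℕ → Draw Ξ B b) (t : ℕ) (i : Fin m) :
    iterate g W η q x0 R r t i = (stateAfter g W η q x0 R r t).xPrev i := by
  cases t <;> rfl

variable {m d : ℕ} {Ξ : Fin m → Type*} [∀ i, MeasurableSpace (Ξ i)] {D : ∀ i, Measure (Ξ i)}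
  [∀ i, IsProbabilityMeasure (D i)] {f : Fin m → EuclideanSpace ℝ (Fin d) → ℝ}
  {g : ∀ i, EuclideanSpace ℝ (Fin d) → Ξ i → EuclideanSpace ℝ (Fin d)} {σ : Fin m → ℝ}
  {L ε : ℝ} {G : SimpleGraph (Fin m)} {W : Matrix (Fin m) (Fin m) ℝ}
  {x0 : EuclideanSpace ℝ (Fin d)}

theorem integral_norm_gradient_output_sq_le (hm : 0 < m) (hf : ∀ i, Differentiable ℝ (f i))
    (hbdd : BddBelow (Set.range (avgFun f))) (hg : HeterogeneousVariance D f g σ)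
    (hW : AdmissibleMixing G W) (hL : MeanSquaredSmooth D g L) (hε : 0 < ε)
    {Ω : Type*} [MeasurableSpace Ω] {P : Measure Ω} [IsProbabilityMeasure P]
    {r : ℕ → Ω → Draw Ξ (largeBatch σ ε) (miniBatch (largeBatch σ ε))}
    {T : ℕ} (hT : 384 * initialGap f x0 * L / ε ^ 2 + 2 / (resetProb (largeBatch σ ε) : ℝ) ≤ T)
    {τ : Ω → Fin (T + 1)}
    (hrun : IsRun D (largeBatch σ ε) (miniBatch (largeBatch σ ε)) (resetProb (largeBatch σ ε))
      (skipProb (largeBatch σ ε)) T P r τ) (i : Fin m) :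
    Integrable (fun w => ‖gradient (avgFun f) (iterate g W (1 / (48 * L))
      (skipProb (largeBatch σ ε)) x0
      (mixRounds 40 (spectralGap W) m (initialGradSize f x0) ε) (fun t => r t w) (τ w) i)‖ ^ 2) P ∧
    ∫ w, ‖gradient (avgFun f) (iterate g W (1 / (48 * L)) (skipProb (largeBatch σ ε)) x0
      (mixRounds 40 (spectralGap W) m (initialGradSize f x0) ε) (fun t => r t w) (τ w) i)‖ ^ 2 ∂P
      ≤ ε ^ 2 := by
  have hB := one_le_largeBatch σ ε
  have hG : 0 ≤ initialGradSize f x0 := Real.sqrt_nonneg _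
  have h : ValidRun D f g σ L G W (resetProb (largeBatch σ ε)) (skipProb (largeBatch σ ε)) P r :=
    { pos := hm
      diff := hf
      var := hg
      smooth := hL
      mixing := hW
      largeBatch_pos := hB
      miniBatch_pos := miniBatch_pos hm hB
      prob_pos := skipProb_pos hm hB
      one_sub_prob_le := one_sub_skipProb_le hm hB
      measurable_draw := hrun.measurable_draw
      draw_law := hrun.draw_law
      draw_indep := hrun.draw_indep }
  obtain ⟨δ', hδ0', hδ', hmix'⟩ :=
    exists_deviation_fastMix_mixRounds_zero_le (d := d) hW hm hG hε
  obtain ⟨hi, hsum⟩ := h.sum_integral_norm_gradient_sq_le (η := 1 / (48 * L)) (x0 := x0)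
    (R := mixRounds 40 (spectralGap W) m (initialGradSize f x0) ε) hbdd rfl hε
    (resetProb_pos hm hB) (one_sub_resetProb_mul hm hB)
    (sum_sq_div_largeBatch_le hg.sigma_pos hε) (by positivity) le_rfl
    (deviation_fastMix_mixRounds_le hW hm hG hε) hδ0' hδ' hmix' hT i
  have hgm : Measurable fun x => ‖gradient (avgFun f) x‖ ^ 2 := by
    have h1 : gradient (avgFun f) = fun x => avg fun i => gradient (f i) x :=
      funext fun x => gradient_avgFun hf x
    have h2 : Continuous (gradient (avgFun f)) := by
      rw [h1]
      exact (continuous_finsetSum _ fun i _ => continuous_gradient hg hL i).const_smul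
        (1 / (m : ℝ))
    exact (h2.norm.pow 2).measurable
  have hF : ∀ t, Measurable fun a : ℕ → Draw Ξ (largeBatch σ ε) (miniBatch (largeBatch σ ε)) =>
      ‖gradient (avgFun f) (iterate g W (1 / (48 * L)) (skipProb (largeBatch σ ε)) x0
        (mixRounds 40 (spectralGap W) m (initialGradSize f x0) ε) a t i)‖ ^ 2 := by
    intro t
    simp_rw [iterate_eq_xPrev]
    exact hgm.comp ((measurableState_stateAfter hg (1 / (48 * L)) (skipProb (largeBatch σ ε)) x0
      (mixRounds 40 (spectralGap W) m (initialGradSize f x0) ε)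
      (A := ℕ → Draw Ξ (largeBatch σ ε) (miniBatch (largeBatch σ ε)))
      (r := fun t a => a t) (fun t => measurable_pi_apply t) t).xPrev i)
  have hu := integral_uniform_index hrun.measurable_out hrun.out_law hrun.out_indep hF
    fun t => by simp_rw [iterate_eq_xPrev]; exact hi t
  refine ⟨hu.1, hu.2.trans_le ?_⟩
  simp_rw [iterate_eq_xPrev]
  have hT1 : (0 : ℝ) < (T : ℝ) + 1 := by positivity
  rw [one_div, inv_mul_le_iff₀ hT1]
  exact hsum

/-- The left side is at most a multiple of (ΔL/ε²)N + N². The linear bound on N serves the first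
term and the quadratic bound the second, so no mixed term σ√m/ε arises. -/
theorem sampleCount_bound_le (hm : 0 < m) (hσ : ∀ i, 0 < σ i) (hε : 0 < ε) {Δ T : ℝ} (hΔ : 0 ≤ Δ)
    (hL : 0 < L) (hT : T ≤ 384 * (Δ * L / ε ^ 2) + 5 * sqrtTotal (largeBatch σ ε)) :
    ∑ i, (largeBatch σ ε i : ℝ) + T * (3 * sqrtTotal (largeBatch σ ε))
      ≤ 40000 * (Δ * L * sigmaAM σ / ε ^ 3 + sigmaAM σ ^ 2 / ε ^ 2
          + Real.sqrt m * (Δ * L / ε ^ 2) + m) := by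
  have hs := sigmaAM_pos hm hσ
  have h1 := sqrtTotal_largeBatch_sq_le hm hσ hε
  have h2 := sqrtTotal_largeBatch_le hm hσ hε
  have h3 : 0 ≤ sqrtTotal (largeBatch σ ε) := Real.sqrt_nonneg _
  rw [← sqrtTotal_sq]
  have hA : 0 ≤ Δ * L / ε ^ 2 := by positivity
  have hm0 : (0 : ℝ) ≤ m := Nat.cast_nonneg _
  have hAs : 0 ≤ Δ * L * sigmaAM σ / ε ^ 3 := by positivity
  have hss : 0 ≤ sigmaAM σ ^ 2 / ε ^ 2 := by positivity
  have hmA : 0 ≤ Real.sqrt m * (Δ * L / ε ^ 2) := by positivity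
  have h4 := mul_le_mul_of_nonneg_right hT (mul_nonneg zero_le_three h3)
  have h5 := mul_le_mul_of_nonneg_left h2 hA
  have h6 : Δ * L / ε ^ 2 * (6 * sigmaAM σ / ε + Real.sqrt m)
      = 6 * (Δ * L * sigmaAM σ / ε ^ 3) + Real.sqrt m * (Δ * L / ε ^ 2) := by
    field_simp
  have h7 : 32 * sigmaAM σ ^ 2 / ε ^ 2 = 32 * (sigmaAM σ ^ 2 / ε ^ 2) := by ring
  rw [h6] at h5
  rw [h7] at h1
  nlinarith

theorem commCount_bound_le (hm : 0 < m) (hσ : ∀ i, 0 < σ i) (hε : 0 < ε) {Δ χ T c : ℝ}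
    (hΔ : 0 ≤ Δ) (hL : 0 < L) (hχ : 0 < χ) (hc : 0 ≤ c)
    (hT : T ≤ 384 * (Δ * L / ε ^ 2) + 5 * sqrtTotal (largeBatch σ ε)) :
    82 * T / Real.sqrt χ * c
      ≤ 40000 * (Δ * L / (Real.sqrt χ * ε ^ 2) + sigmaAM σ / (Real.sqrt χ * ε)
          + Real.sqrt m / Real.sqrt χ) * c ∧
    (Real.sqrt m * ε ≤ sigmaAM σ → 82 * T / Real.sqrt χ * c
      ≤ 40000 * (Δ * L / (Real.sqrt χ * ε ^ 2) + sigmaAM σ / (Real.sqrt χ * ε)) * c) := by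
  have hs := sigmaAM_pos hm hσ
  have h2 := sqrtTotal_largeBatch_le hm hσ hε
  have hx : 0 < Real.sqrt χ := Real.sqrt_pos.2 hχ
  have hA : 0 ≤ Δ * L / ε ^ 2 := by positivity
  have hS : 0 ≤ sigmaAM σ / ε := by positivity
  have hM : 0 ≤ Real.sqrt m := Real.sqrt_nonneg _
  have h3 : 6 * sigmaAM σ / ε = 6 * (sigmaAM σ / ε) := by ring
  rw [h3] at h2
  have e1 : Δ * L / (Real.sqrt χ * ε ^ 2) + sigmaAM σ / (Real.sqrt χ * ε)
      = (Δ * L / ε ^ 2 + sigmaAM σ / ε) / Real.sqrt χ := by field_simp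
  refine ⟨mul_le_mul_of_nonneg_right ?_ hc, fun h => mul_le_mul_of_nonneg_right ?_ hc⟩
  · rw [e1, ← add_div, ← mul_div_assoc]
    gcongr ?_ / _
    linarith
  -- In this regime the rounding of batch sizes up to one is hidden by the noise term.
  · have h4 : Real.sqrt m ≤ sigmaAM σ / ε := (le_div_iff₀ hε).2 h
    rw [e1, ← mul_div_assoc]
    gcongr ?_ / _
    linarith

end Complexity

end DNSSVR

open DNSSVR in
theorem theorem4p1 :
    ∃ κ C : ℝ, 0 < κ ∧ 0 < C ∧
    ∀ (m d : ℕ) (_ : 0 < m)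
      (Ξ : Fin m → Type*) [∀ i, MeasurableSpace (Ξ i)]
      (D : ∀ i, Measure (Ξ i)) [∀ i, IsProbabilityMeasure (D i)]
      (f : Fin m → EuclideanSpace ℝ (Fin d) → ℝ)
      (g : ∀ i, EuclideanSpace ℝ (Fin d) → Ξ i → EuclideanSpace ℝ (Fin d))
      (σ : Fin m → ℝ) (L ε : ℝ)
      (G : SimpleGraph (Fin m)) (W : Matrix (Fin m) (Fin m) ℝ)
      (x0 : EuclideanSpace ℝ (Fin d)),
      (∀ i, Differentiable ℝ (f i)) →
      BddBelow (Set.range (avgFun f)) →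
      HeterogeneousVariance D f g σ →
      AdmissibleMixing G W →
      MeanSquaredSmooth D g L →
      0 < ε →
      let Δ : ℝ := initialGap f x0
      let χ : ℝ := spectralGap W
      let G₀ : ℝ := initialGradSize f x0
      let η : ℝ := 1 / (48 * L)
      let B : Fin m → ℕ := largeBatch σ ε
      let b : ℕ := miniBatch B
      let q : unitInterval := skipProb B
      let p : unitInterval := resetProb B
      let T : ℕ := horizon Δ L ε p
      let R : ℕ → ℕ := mixRounds κ χ m G₀ ε
      -- the output of every node is an `ε`-stationary point
      (∀ (Ω : Type*) [MeasurableSpace Ω] (P : Measure Ω) [IsProbabilityMeasure P]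
        (r : ℕ → Ω → Draw Ξ B b) (τ : Ω → Fin (T + 1)), IsRun D B b p q T P r τ →
        (∀ i : Fin m,
          Integrable (fun w => ‖gradient (avgFun f)
            (iterate g W η q x0 R (fun t => r t w) (τ w) i)‖ ^ 2) P ∧
          ∫ w, ‖gradient (avgFun f)
            (iterate g W η q x0 R (fun t => r t w) (τ w) i)‖ ^ 2 ∂P ≤ ε ^ 2) ∧
        -- the expected sample complexity
        Integrable (fun w => (sampleCount (fun t => r t w) T : ℝ)) P ∧
        ∫ w, (sampleCount (fun t => r t w) T : ℝ) ∂P ≤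
          C * (Δ * L * sigmaAM σ / ε ^ 3 + sigmaAM σ ^ 2 / ε ^ 2
            + Real.sqrt m * (Δ * L / ε ^ 2) + m)) ∧
      -- the communication complexity, for all `ε` and in the small-`ε` regime
      (commCount R T : ℝ) ≤
        C * (Δ * L / (Real.sqrt χ * ε ^ 2) + sigmaAM σ / (Real.sqrt χ * ε)
          + Real.sqrt m / Real.sqrt χ) * (1 + Real.log ((m : ℝ) + G₀ / ε)) ∧
      (Real.sqrt m * ε ≤ sigmaAM σ →
        (commCount R T : ℝ) ≤
          C * (Δ * L / (Real.sqrt χ * ε ^ 2) + sigmaAM σ / (Real.sqrt χ * ε))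
            * (1 + Real.log ((m : ℝ) + G₀ / ε))) := by
  -- κ = 40 yields the contraction 9/M²⁰; the largest coefficient that C must cover is 82 · 384 =
  -- 31488, from the number of rounds.
  refine ⟨40, 40000, by norm_num, by norm_num, ?_⟩
  intro m d hm Ξ _ D _ f g σ L ε G W x0 hf hbdd hg hW hL hε Δ χ G₀ η B b q p T R
  have hΔ : 0 ≤ Δ := initialGap_nonneg hbdd x0
  have hB : ∀ i, 1 ≤ B i := one_le_largeBatch σ ε
  obtain ⟨hT, hT'⟩ := horizon_bounds hm hB hΔ hL.const_pos hε
  obtain ⟨hχ0, hχ1⟩ := hW.spectralGap_pos hm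
  have hG : 0 ≤ G₀ := Real.sqrt_nonneg _
  have hlog : 0 ≤ 1 + Real.log ((m : ℝ) + G₀ / ε) := by
    have h1 : (1 : ℝ) ≤ m := by exact_mod_cast hm
    have h2 : 0 ≤ G₀ / ε := by positivity
    linarith [Real.log_nonneg (h1.trans (le_add_of_nonneg_right h2))]
  have hcomm := commCount_mixRounds_le hm hχ0 hχ1 hG hε T
  obtain ⟨hcomm1, hcomm2⟩ :=
    commCount_bound_le hm hg.sigma_pos hε hΔ hL.const_pos hχ0 hlog hT'
  refine ⟨?_, hcomm.trans hcomm1, fun h => hcomm.trans (hcomm2 h)⟩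
  intro Ω _ P _ r τ hrun
  refine ⟨fun i => integral_norm_gradient_output_sq_le hm hf hbdd hg hW hL hε hT hrun i, ?_⟩
  obtain ⟨h1, h2⟩ := integral_sampleCount_le hrun.measurable_draw hrun.draw_law
    (resetProb_cost_le hm hB) T
  exact ⟨h1, h2.trans (sampleCount_bound_le hm hg.sigma_pos hε hΔ hL.const_pos hT')⟩
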